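/- Let $\mathbb{K}$ be a field of characteristic $0$, let $\mathcal{A}$ be a central arrangement in $V=\mathbb{K}^3$ (a finite set of $2$-dimensional linear subspaces), and let $H\in\mathcal{A}$. For each hyperplane fix a linear form $\alpha_{H'}$ with kernel $H'$. Let $\chi(\mathcal{A},t)=\sum_{X}\mu(X)t^{\dim X}$ be the characteristic polynomial, the sum running over the lattice of all intersections of members of $\mathcal{A}$ (including $V$) ordered by reverse inclusion, with M\"obius function $\mu$ normalised by $\mu(V)=1$, and let $\chi_0(\mathcal{A},t)=\chi(\mathcal{A},t)/(t-1)$. Let $(\mathcal{A}^H,\mathbf{k})$ be the restricted multiarrangement: $\mathcal{A}^H=\{H'\cap H\mid H'\in\mathcal{A}\setminus\{H\}\}$ and $\mathbf{k}(X)=\#\{H'\in\mathcal{A}\mid H'\cap H=X\}$. For a multiarrangement $(\mathcal{B},\mathbf{k})$ in a vector space $W$ with ring of polynomial functions $\mathbb{K}[W]$, put $Q=\prod_{X\in\mathcal{B}}\alpha_X^{\mathbf{k}(X)}$, let $D(\mathcal{B},\mathbf{k})$ be the module of polynomial vector fields $\delta$ on $W$ with $\delta(\alpha_X)\in\alpha_X^{\mathbf{k}(X)}\mathbb{K}[W]$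 for all $X\in\mathcal{B}$, and let $\Omega^1(\mathcal{B},\mathbf{k})$ be the module of $\omega\in\frac1Q\Omega^1_W$ such that $Q\,\alpha_X^{-\mathbf{k}(X)}\,d\alpha_X\wedge\omega$ is a polynomial $2$-form for all $X\in\mathcal{B}$; write $\Omega^1(\mathcal{A})$ for $\Omega^1(\mathcal{A},1)$. Choose linear coordinates $(z_1,z_2,z_3)$ on $V$ with $H=\{z_1=0\}$. Every $\omega\in\Omega^1(\mathcal{A})$ is uniquely $\omega_1+\frac{dz_1}{z_1}\wedge\omega_2$ with $\omega_2$ a rational function and $\omega_1$ a rational combination of $dz_2,dz_3$; the coefficients of $\omega_1$ have no pole along $H$, and the restriction map sends $\omega$ to $\omega_1|_H$. Then $D(\mathcal{A}^H,\mathbf{k})$ is a free $\mathbb{K}[H]$-module with a homogeneous basis of two elements, the restriction map takes $\Omega^1(\mathcal{A})$ into $\Omega^1(\mathcal{A}^H,\mathbf{k})$, and, if $(d_2',d_3')$ are the degrees of any such basis (the multiexponents), the image $M^1$ of the restriction map $\Omega^1(\mathcal{A})\to\Omega^1(\mathcal{A}^H,\mathbf{k})$ has finite codimension over $\mathbb{K}$,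 and $$\dim_{\mathbb{K}}\bigl(\Omega^1(\mathcal{A}^H,\mathbf{k})/M^1\bigr)=\chi_0(\mathcal{A},0)-d_2'd_3'.$$ -/

import Mathlib

namespace HypArr

/-- A central hyperplane arrangement in `V`: a finite set of linear subspaces of codimension one. -/
structure Arrangement (K V : Type*) [Field K] [AddCommGroup V] [Module K V] where
  hyperplanes : Finset (Submodule K V)
  codim_one : ∀ H ∈ hyperplanes, Module.finrank K (V ⧸ H) = 1

/-- A multiarrangement: an arrangement with a multiplicity for each of its hyperplanes (the values
of `mult` at subspaces that are not members are never used). -/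
structure MultiArrangement (K V : Type*) [Field K] [AddCommGroup V] [Module K V] extends
    Arrangement K V where
  mult : Submodule K V → ℕ

section Basics

variable {K V : Type*} [Field K] [AddCommGroup V] [Module K V]

/-- An arrangement as a multiarrangement with constant multiplicity one. -/
def Arrangement.toMulti (A : Arrangement K V) : MultiArrangement K V where
  toArrangement := A
  mult := fun _ => 1

/-! ### The characteristic polynomial -/

open Classical in
/-- The intersection lattice: all intersections of members of `A`; the empty intersection is `V`. -/
noncomputable def Arrangement.flats (A : Arrangement K V) : Finset (Submodule K V) :=
  A.hyperplanes.powerset.image (fun s => s.inf id)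

open Classical in
/-- The Möbius function of the intersection lattice ordered by reverse inclusion:
`μ(V) = 1` and `μ(X) = - ∑_{Y ∈ L, Y ⊋ X} μ(Y)` for `X ≠ V`. -/
noncomputable def Arrangement.moebius (A : Arrangement K V) (X : Submodule K V) : ℤ :=
  if X = ⊤ then 1
  else - ∑ Y : {Y // Y ∈ A.flats.filter (fun Y => X < Y)}, A.moebius Y.1
termination_by (A.flats.filter (fun Y => X < Y)).card
decreasing_by
  have hY := Finset.mem_filter.1 Y.2
  apply Finset.card_lt_card
  refine Finset.ssubset_iff_of_subset ?_ |>.2 ⟨Y.1, Y.2, by simp⟩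
  intro Z hZ
  rw [Finset.mem_filter] at hZ ⊢
  exact ⟨hZ.1, hY.2.trans hZ.2⟩

/-- The characteristic polynomial `χ(A, t) = ∑_{X ∈ L} μ(X) t^{dim X}`. -/
noncomputable def Arrangement.charPoly (A : Arrangement K V) : Polynomial ℤ :=
  ∑ X ∈ A.flats, Polynomial.C (A.moebius X) * Polynomial.X ^ Module.finrank K X

/-- The reduced characteristic polynomial `χ₀(A, t) = χ(A, t) / (t - 1)`. -/
noncomputable def Arrangement.reducedCharPoly (A : Arrangement K V) : Polynomial ℤ :=
  A.charPoly /ₘ (Polynomial.X - Polynomial.C 1)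

theorem Arrangement.ne_top (A : Arrangement K V) {H : Submodule K V} (hH : H ∈ A.hyperplanes) :
    H ≠ ⊤ := by
  rintro rfl
  have h := A.codim_one _ hH
  have : Subsingleton (V ⧸ (⊤ : Submodule K V)) := Submodule.Quotient.subsingleton_iff.2 rfl
  rw [Module.finrank_zero_of_subsingleton] at h
  exact zero_ne_one h

/-- For a nonempty arrangement the division in the definition of `χ₀` is exact. -/
theorem Arrangement.mul_reducedCharPoly (A : Arrangement K V) {H : Submodule K V}
    (hH : H ∈ A.hyperplanes) :
    (Polynomial.X - Polynomial.C 1) * A.reducedCharPoly = A.charPoly := by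
  classical
  rw [Arrangement.reducedCharPoly, Polynomial.mul_divByMonic_eq_iff_isRoot]
  rw [Polynomial.IsRoot.def, Arrangement.charPoly, Polynomial.eval_finsetSum]
  simp only [Polynomial.eval_mul, Polynomial.eval_C, Polynomial.eval_pow, Polynomial.eval_X,
    one_pow, mul_one]
  set Z : Submodule K V := A.hyperplanes.inf id with hZ
  have hZmem : Z ∈ A.flats :=
    Finset.mem_image.2 ⟨A.hyperplanes, Finset.mem_powerset_self _, rfl⟩
  have hZtop : Z ≠ ⊤ := by
    intro h
    have : Z ≤ H := Finset.inf_le (f := id) hH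
    rw [h, top_le_iff] at this
    exact A.ne_top hH this
  have hle : ∀ X ∈ A.flats, Z ≤ X := by
    intro X hX
    obtain ⟨s, hs, rfl⟩ := Finset.mem_image.1 hX
    exact Finset.inf_mono (Finset.mem_powerset.1 hs)
  have hfil : A.flats.filter (fun Y => Z < Y) = A.flats.erase Z := by
    ext Y
    simp only [Finset.mem_filter, Finset.mem_erase]
    constructor
    · rintro ⟨h1, h2⟩
      exact ⟨h2.ne', h1⟩
    · rintro ⟨h1, h2⟩
      exact ⟨h2, lt_of_le_of_ne (hle Y h2) (Ne.symm h1)⟩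
  have hμ : A.moebius Z = - ∑ Y ∈ A.flats.erase Z, A.moebius Y := by
    rw [Arrangement.moebius, if_neg hZtop, ← hfil]
    congr 1
    exact Finset.sum_coe_sort (A.flats.filter (fun Y => Z < Y)) A.moebius
  rw [← Finset.add_sum_erase _ _ hZmem, hμ]
  ring

/-! ### Restriction to a hyperplane -/

theorem finrank_quotient_submoduleOf (H H' : Submodule K V)
    (hH : Module.finrank K (V ⧸ H) = 1) (hH' : Module.finrank K (V ⧸ H') = 1) (hne : H' ≠ H) :
    Module.finrank K (H ⧸ H'.submoduleOf H) = 1 := by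
  let f : H →ₗ[K] V ⧸ H' := H'.mkQ ∘ₗ H.subtype
  have hker : LinearMap.ker f = H'.submoduleOf H := by
    rw [LinearMap.ker_comp, Submodule.ker_mkQ]
    rfl
  have cH : IsCoatom H := by
    rw [← isSimpleModule_iff_isCoatom]
    exact isSimpleModule_iff_finrank_eq_one.2 hH
  have hsimple : IsSimpleModule K (V ⧸ H') := isSimpleModule_iff_finrank_eq_one.2 hH'
  have cH' : IsCoatom H' := isSimpleModule_iff_isCoatom.1 hsimple
  have hf : f ≠ 0 := by
    intro h0
    have hle : H ≤ H' := by
      intro x hx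
      have : f ⟨x, hx⟩ = 0 := by rw [h0]; rfl
      simpa [f] using this
    rcases cH.le_iff.1 hle with h | h
    · exact cH'.1 h
    · exact hne h
  have hsurj : Function.Surjective f := by
    rcases LinearMap.surjective_or_eq_zero f with h | h
    · exact h
    · exact absurd h hf
  rw [← hker, (f.quotKerEquivOfSurjective hsurj).finrank_eq, hH']

open Classical in
/-- The restricted multiarrangement on `H ∈ A`: its hyperplanes are the `H' ∩ H` for
`H' ∈ A \ {H}`, and the multiplicity of `X` is the number of `H' ∈ A` with `H' ∩ H = X`. -/
noncomputable def Arrangement.restriction (A : Arrangement K V) (H : Submodule K V)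
    (hH : H ∈ A.hyperplanes) : MultiArrangement K H where
  hyperplanes := (A.hyperplanes.erase H).image (fun H' => H'.submoduleOf H)
  codim_one := by
    intro X hX
    obtain ⟨H', hH', rfl⟩ := Finset.mem_image.1 hX
    rw [Finset.mem_erase] at hH'
    exact finrank_quotient_submoduleOf H H' (A.codim_one H hH) (A.codim_one H' hH'.2) hH'.1
  mult := fun X => (A.hyperplanes.filter (fun H' => H'.submoduleOf H = X)).card

/-! ### Logarithmic vector fields and logarithmic 1-forms

A basis `b` of `V` gives the dual coordinates `z_i`; the ring of polynomial functions on `V` is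
`K[z_i]`, realised as `MvPolynomial ι K`, with field of rational functions its `FractionRing`. -/

/-- A linear form `α_H` with kernel `H` (it exists, and is nonzero, when `H` has codimension 1). -/
noncomputable def defForm (H : Submodule K V) : Module.Dual K V :=
  Classical.epsilon (fun α : Module.Dual K V => LinearMap.ker α = H)

theorem ker_defForm {H : Submodule K V} (hH : Module.finrank K (V ⧸ H) = 1) :
    LinearMap.ker (defForm H) = H := by
  have : ∃ α : Module.Dual K V, LinearMap.ker α = H := by
    have hfin : FiniteDimensional K (V ⧸ H) := FiniteDimensional.of_finrank_pos (by rw [hH]; simp)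
    let e : (V ⧸ H) ≃ₗ[K] K := LinearEquiv.ofFinrankEq _ _ (by rw [hH, Module.finrank_self])
    exact ⟨e.toLinearMap ∘ₗ H.mkQ, by simp [LinearMap.ker_comp]⟩
  exact Classical.epsilon_spec this

variable {ι : Type*} [Fintype ι]

/-- The polynomial `∑ α(b_i) z_i` of a linear form `α`. -/
noncomputable def linPoly (b : Module.Basis ι K V) (α : Module.Dual K V) : MvPolynomial ι K :=
  ∑ i, MvPolynomial.C (α (b i)) * MvPolynomial.X i

/-- `Q(A, k) = ∏ α_H ^ k(H)`. -/
noncomputable def MultiArrangement.Q (A : MultiArrangement K V) (b : Module.Basis ι K V) :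
    MvPolynomial ι K :=
  ∏ H ∈ A.hyperplanes, linPoly b (defForm H) ^ A.mult H

/-- The module `D(A, k)` of logarithmic vector fields: polynomial vector fields `δ` with
`δ(α_H) ∈ α_H ^ k(H) S` for all `H`. -/
noncomputable def MultiArrangement.logDer (A : MultiArrangement K V) (b : Module.Basis ι K V) :
    Submodule (MvPolynomial ι K) (Derivation K (MvPolynomial ι K) (MvPolynomial ι K)) where
  carrier := {δ | ∀ H ∈ A.hyperplanes,
    linPoly b (defForm H) ^ A.mult H ∣ δ (linPoly b (defForm H))}
  zero_mem' := fun H _ => by simp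
  add_mem' := fun h1 h2 H hH => by simpa using dvd_add (h1 H hH) (h2 H hH)
  smul_mem' := fun c δ h H hH => by simpa using (h H hH).mul_left c

/-- `d` lists the multiexponents of `(A, k)`: `D(A, k)` is free over `S` with a basis of
homogeneous vector fields `θ_i = ∑_j f_{ij} ∂/∂z_j`, all `f_{ij}` being homogeneous of degree `d_i`. -/
def MultiArrangement.IsMultiexponents (A : MultiArrangement K V) (b : Module.Basis ι K V)
    (d : ι → ℕ) : Prop :=
  ∃ θ : Module.Basis ι (MvPolynomial ι K) (A.logDer b),
    ∀ i j, ((θ i).1 (MvPolynomial.X j)).IsHomogeneous (d i)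

/-- A rational 1-form `∑ ω_i dz_i`, given by its coefficients. -/
abbrev RatForm (ι K : Type*) [Field K] : Type _ := ι → FractionRing (MvPolynomial ι K)

/-- A rational function is a polynomial. -/
def IsPoly {ι K : Type*} [Field K] (f : FractionRing (MvPolynomial ι K)) : Prop :=
  f ∈ (algebraMap (MvPolynomial ι K) (FractionRing (MvPolynomial ι K))).range

theorem IsPoly.add {ι K : Type*} [Field K] {f g : FractionRing (MvPolynomial ι K)}
    (hf : IsPoly f) (hg : IsPoly g) : IsPoly (f + g) :=
  add_mem (S := Subring (FractionRing (MvPolynomial ι K))) hf hg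

theorem IsPoly.mul {ι K : Type*} [Field K] {f g : FractionRing (MvPolynomial ι K)}
    (hf : IsPoly f) (hg : IsPoly g) : IsPoly (f * g) :=
  mul_mem (S := Subring (FractionRing (MvPolynomial ι K))) hf hg

theorem isPoly_zero {ι K : Type*} [Field K] : IsPoly (0 : FractionRing (MvPolynomial ι K)) :=
  ⟨0, map_zero _⟩

/-- The coefficient of `dz_i ∧ dz_j` in the wedge product of two rational 1-forms. -/
noncomputable def wedge {ι K : Type*} [Field K] (ω η : RatForm ι K) (i j : ι) : FractionRing (MvPolynomial ι K) :=
  ω i * η j - ω j * η i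

theorem wedge_zero {ι K : Type*} [Field K] (ω : RatForm ι K) (i j : ι) : wedge ω 0 i j = 0 := by
  rw [wedge, Pi.zero_apply, Pi.zero_apply, mul_zero, mul_zero, sub_zero]

theorem wedge_add {ι K : Type*} [Field K] (ω η η' : RatForm ι K) (i j : ι) :
    wedge ω (η + η') i j = wedge ω η i j + wedge ω η' i j := by
  rw [wedge, wedge, wedge, Pi.add_apply, Pi.add_apply, mul_add, mul_add, add_sub_add_comm]

theorem wedge_smul {ι K : Type*} [Field K] (c : MvPolynomial ι K) (ω η : RatForm ι K) (i j : ι) :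
    wedge ω (c • η) i j = algebraMap _ _ c * wedge ω η i j := by
  rw [wedge, wedge, Pi.smul_apply, Pi.smul_apply, Algebra.smul_def, Algebra.smul_def, mul_sub,
    mul_left_comm, mul_left_comm (ω j)]

/-- The differential `dα = ∑ α(b_i) dz_i` of a linear form. -/
noncomputable def dForm (b : Module.Basis ι K V) (α : Module.Dual K V) : RatForm ι K :=
  fun i => algebraMap K _ (α (b i))

/-- The module `Ω¹(A, k)` of logarithmic 1-forms: all `ω ∈ (1/Q) Ω¹_V` such that
`Q · (dα_H / α_H ^ k(H)) ∧ ω` is a polynomial 2-form for all `H`. -/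
noncomputable def MultiArrangement.logForms (A : MultiArrangement K V) (b : Module.Basis ι K V) :
    Submodule (MvPolynomial ι K) (RatForm ι K) where
  carrier := {ω | (∀ i, IsPoly (algebraMap _ _ (A.Q b) * ω i)) ∧
    ∀ H ∈ A.hyperplanes, ∀ i j, IsPoly (algebraMap _ _ (A.Q b) *
      wedge ((algebraMap (MvPolynomial ι K) (FractionRing (MvPolynomial ι K))
        (linPoly b (defForm H) ^ A.mult H))⁻¹ • dForm b (defForm H)) ω i j)}
  zero_mem' := by
    refine ⟨fun i => ?_, fun H _ i j => ?_⟩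
    · rw [Pi.zero_apply, mul_zero]
      exact isPoly_zero
    · rw [wedge_zero, mul_zero]
      exact isPoly_zero
  add_mem' := by
    rintro ω η ⟨h1, h2⟩ ⟨h3, h4⟩
    refine ⟨fun i => ?_, fun H hH i j => ?_⟩
    · rw [Pi.add_apply, mul_add]
      exact (h1 i).add (h3 i)
    · rw [wedge_add, mul_add]
      exact (h2 H hH i j).add (h4 H hH i j)
  smul_mem' := by
    rintro c ω ⟨h1, h2⟩
    refine ⟨fun i => ?_, fun H hH i j => ?_⟩
    · rw [Pi.smul_apply, Algebra.smul_def, mul_left_comm]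
      exact IsPoly.mul ⟨c, rfl⟩ (h1 i)
    · rw [wedge_smul, mul_left_comm]
      exact IsPoly.mul ⟨c, rfl⟩ (h2 H hH i j)

end Basics

/-! ### The restriction map

Coordinates `z_0, …, z_n` on `V` with `H = {z_0 = 0}`, and `z_1, …, z_n` as coordinates on `H`. -/

section Restriction

variable {K V : Type*} [Field K] [AddCommGroup V] [Module K V] {n : ℕ}

/-- Restriction of polynomial functions to `z_0 = 0`. -/
noncomputable def polyRestrict :
    MvPolynomial (Fin (n + 1)) K →ₐ[K] MvPolynomial (Fin n) K :=
  MvPolynomial.aeval (Fin.cons 0 MvPolynomial.X)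

/-- `g` is the restriction to `z_0 = 0` of the rational function `f`, which has no pole there:
`f = p / q` and `g = p|_H / q|_H` for polynomials `p, q` with `q|_H ≠ 0`. -/
def IsRestriction (f : FractionRing (MvPolynomial (Fin (n + 1)) K))
    (g : FractionRing (MvPolynomial (Fin n) K)) : Prop :=
  ∃ p q : MvPolynomial (Fin (n + 1)) K, polyRestrict q ≠ 0 ∧
    f = algebraMap _ _ p / algebraMap _ _ q ∧
    g = algebraMap _ _ (polyRestrict p) / algebraMap _ _ (polyRestrict q)

theorem polyRestrict_ne_zero {q : MvPolynomial (Fin (n + 1)) K} (h : polyRestrict q ≠ 0) :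
    q ≠ 0 := by
  rintro rfl
  simp at h

theorem IsRestriction.unique {f : FractionRing (MvPolynomial (Fin (n + 1)) K)}
    {g g' : FractionRing (MvPolynomial (Fin n) K)}
    (h : IsRestriction f g) (h' : IsRestriction f g') : g = g' := by
  obtain ⟨p, q, hq, hf, hg⟩ := h
  obtain ⟨p', q', hq', hf', hg'⟩ := h'
  have inj := IsFractionRing.injective (MvPolynomial (Fin (n + 1)) K)
    (FractionRing (MvPolynomial (Fin (n + 1)) K))
  have inj' := IsFractionRing.injective (MvPolynomial (Fin n) K)
    (FractionRing (MvPolynomial (Fin n) K))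
  rw [hf, div_eq_div_iff ((map_ne_zero_iff _ inj).2 (polyRestrict_ne_zero hq))
    ((map_ne_zero_iff _ inj).2 (polyRestrict_ne_zero hq')), ← map_mul, ← map_mul] at hf'
  have := congrArg polyRestrict (inj hf')
  rw [hg, hg', div_eq_div_iff ((map_ne_zero_iff _ inj').2 hq) ((map_ne_zero_iff _ inj').2 hq'),
    ← map_mul, ← map_mul, ← map_mul, ← map_mul, this]

theorem IsRestriction.add {f f' : FractionRing (MvPolynomial (Fin (n + 1)) K)}
    {g g' : FractionRing (MvPolynomial (Fin n) K)}
    (h : IsRestriction f g) (h' : IsRestriction f' g') : IsRestriction (f + f') (g + g') := by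
  obtain ⟨p, q, hq, hf, hg⟩ := h
  obtain ⟨p', q', hq', hf', hg'⟩ := h'
  have inj := IsFractionRing.injective (MvPolynomial (Fin (n + 1)) K)
    (FractionRing (MvPolynomial (Fin (n + 1)) K))
  have inj' := IsFractionRing.injective (MvPolynomial (Fin n) K)
    (FractionRing (MvPolynomial (Fin n) K))
  refine ⟨p * q' + q * p', q * q', by rw [map_mul]; exact mul_ne_zero hq hq', ?_, ?_⟩
  · rw [hf, hf', div_add_div _ _ ((map_ne_zero_iff _ inj).2 (polyRestrict_ne_zero hq))
      ((map_ne_zero_iff _ inj).2 (polyRestrict_ne_zero hq'))]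
    simp only [map_add, map_mul]
  · rw [hg, hg', div_add_div _ _ ((map_ne_zero_iff _ inj').2 hq) ((map_ne_zero_iff _ inj').2 hq')]
    simp only [map_add, map_mul]

theorem algebraMap_smul_frac {ι K : Type*} [Field K] (c : K) (p : MvPolynomial ι K) :
    algebraMap (MvPolynomial ι K) (FractionRing (MvPolynomial ι K)) (c • p) =
      c • algebraMap (MvPolynomial ι K) (FractionRing (MvPolynomial ι K)) p := by
  rw [Algebra.algebraMap_eq_smul_one, smul_assoc, ← Algebra.algebraMap_eq_smul_one]

theorem IsRestriction.smul {f : FractionRing (MvPolynomial (Fin (n + 1)) K)}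
    {g : FractionRing (MvPolynomial (Fin n) K)} (c : K)
    (h : IsRestriction f g) : IsRestriction (c • f) (c • g) := by
  obtain ⟨p, q, hq, hf, hg⟩ := h
  refine ⟨c • p, q, hq, ?_, ?_⟩
  · rw [hf, algebraMap_smul_frac, smul_div_assoc]
  · rw [hg, map_smul, algebraMap_smul_frac, smul_div_assoc]

theorem polyRestrict_linPoly {H : Submodule K V} (b : Module.Basis (Fin (n + 1)) K V)
    (bH : Module.Basis (Fin n) K H) (hb : ∀ i, (bH i : V) = b i.succ) (α : Module.Dual K V) :
    polyRestrict (linPoly b α) = linPoly bH (α ∘ₗ H.subtype) := by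
  simp [polyRestrict, linPoly, Fin.sum_univ_succ, hb]

theorem linPoly_ne_zero {ι : Type*} [Fintype ι] (b : Module.Basis ι K V) {α : Module.Dual K V}
    (hα : α ≠ 0) : linPoly b α ≠ 0 := by
  classical
  intro h
  apply hα
  refine b.ext fun i => ?_
  have := congrArg (MvPolynomial.eval (Pi.single i (1 : K))) h
  simpa [linPoly, Pi.single_apply] using this

/-- The coefficients `ω_1, …, ω_n` of a logarithmic 1-form have no pole along `H = {z_0 = 0}`. -/
theorem exists_isRestriction (A : Arrangement K V) {H : Submodule K V} (hH : H ∈ A.hyperplanes)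
    (b : Module.Basis (Fin (n + 1)) K V) (bH : Module.Basis (Fin n) K H)
    (hb : ∀ i, (bH i : V) = b i.succ) (ω : RatForm (Fin (n + 1)) K)
    (hω : ω ∈ A.toMulti.logForms b) (j : Fin n) : ∃ g, IsRestriction (ω j.succ) g := by
  classical
  have inj := IsFractionRing.injective (MvPolynomial (Fin (n + 1)) K)
    (FractionRing (MvPolynomial (Fin (n + 1)) K))
  obtain ⟨p, hp⟩ := hω.2 H hH 0 j.succ
  have hker := ker_defForm (A.codim_one H hH)
  have hsucc : defForm H (b j.succ) = 0 := by
    rw [← LinearMap.mem_ker, hker, ← hb]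
    exact (bH j).2
  have hα : defForm H ≠ 0 := by
    intro h
    rw [h, LinearMap.ker_zero] at hker
    exact A.ne_top hH hker.symm
  have hzero : defForm H (b 0) ≠ 0 := by
    intro h0
    apply hα
    refine b.ext fun i => ?_
    refine Fin.cases h0 (fun i => ?_) i
    change defForm H (b i.succ) = 0
    rw [← LinearMap.mem_ker, hker, ← hb]
    exact (bH i).2
  set q : MvPolynomial (Fin (n + 1)) K :=
    ∏ H' ∈ A.hyperplanes.erase H, linPoly b (defForm H') with hqdef
  have hQ : A.toMulti.Q b = linPoly b (defForm H) * q := by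
    rw [hqdef, Finset.mul_prod_erase _ (fun H' => linPoly b (defForm H')) hH]
    simp [MultiArrangement.Q, Arrangement.toMulti]
  have hq : polyRestrict q ≠ 0 := by
    rw [hqdef, map_prod, Finset.prod_ne_zero_iff]
    intro H' hH'
    rw [Finset.mem_erase] at hH'
    rw [polyRestrict_linPoly b bH hb]
    apply linPoly_ne_zero
    intro h0
    have hle : H ≤ H' := by
      intro x hx
      rw [← ker_defForm (A.codim_one H' hH'.2), LinearMap.mem_ker]
      exact LinearMap.congr_fun h0 ⟨x, hx⟩
    have cH : IsCoatom H := by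
      rw [← isSimpleModule_iff_isCoatom]
      exact isSimpleModule_iff_finrank_eq_one.2 (A.codim_one H hH)
    rcases cH.le_iff.1 hle with h | h
    · exact A.ne_top hH'.2 h
    · exact hH'.1 h
  have hl : algebraMap (MvPolynomial (Fin (n + 1)) K)
      (FractionRing (MvPolynomial (Fin (n + 1)) K)) (linPoly b (defForm H)) ≠ 0 :=
    (map_ne_zero_iff _ inj).2 (linPoly_ne_zero b hα)
  have hq0 : algebraMap (MvPolynomial (Fin (n + 1)) K)
      (FractionRing (MvPolynomial (Fin (n + 1)) K)) q ≠ 0 :=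
    (map_ne_zero_iff _ inj).2 (polyRestrict_ne_zero hq)
  have key : algebraMap (MvPolynomial (Fin (n + 1)) K)
      (FractionRing (MvPolynomial (Fin (n + 1)) K)) ((defForm H (b 0))⁻¹ • p)
      = algebraMap _ _ q * ω j.succ := by
    rw [algebraMap_smul_frac, hp, hQ]
    simp only [wedge, dForm, Pi.smul_apply, smul_eq_mul, hsucc, map_zero, mul_zero, zero_mul,
      sub_zero, map_mul, Arrangement.toMulti, pow_one, Algebra.smul_def, map_inv₀]
    have hz : algebraMap K (FractionRing (MvPolynomial (Fin (n + 1)) K)) (defForm H (b 0)) ≠ 0 :=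
      (map_ne_zero _).2 hzero
    field_simp
  exact ⟨_, (defForm H (b 0))⁻¹ • p, q, hq, by rw [key]; field_simp, rfl⟩

/-- The restriction map on `Ω¹(A)`: writing `ω = ω₁ + (dz_0 / z_0) ∧ ω₂`, with `ω₁` the part of `ω`
in `dz_1, …, dz_n`, it sends `ω` to `ω₁|_H`. -/
noncomputable def Arrangement.res (A : Arrangement K V) (H : Submodule K V)
    (hH : H ∈ A.hyperplanes)
    (b : Module.Basis (Fin (n + 1)) K V) (bH : Module.Basis (Fin n) K H)
    (hb : ∀ i, (bH i : V) = b i.succ) :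
    (A.toMulti.logForms b) →ₗ[K] RatForm (Fin n) K where
  toFun ω j := (exists_isRestriction A hH b bH hb ω.1 ω.2 j).choose
  map_add' ω η := by
    funext j
    exact (exists_isRestriction A hH b bH hb _ (ω + η).2 j).choose_spec.unique
      ((exists_isRestriction A hH b bH hb _ ω.2 j).choose_spec.add
        (exists_isRestriction A hH b bH hb _ η.2 j).choose_spec)
  map_smul' c ω := by
    funext j
    exact (exists_isRestriction A hH b bH hb _ (c • ω).2 j).choose_spec.unique
      ((exists_isRestriction A hH b bH hb _ ω.2 j).choose_spec.smul c)

theorem Arrangement.isRestriction_res (A : Arrangement K V) (H : Submodule K V)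
    (hH : H ∈ A.hyperplanes)
    (b : Module.Basis (Fin (n + 1)) K V) (bH : Module.Basis (Fin n) K H)
    (hb : ∀ i, (bH i : V) = b i.succ) (ω : A.toMulti.logForms b) (j : Fin n) :
    IsRestriction (ω.1 j.succ) (A.res H hH b bH hb ω j) :=
  (exists_isRestriction A hH b bH hb ω.1 ω.2 j).choose_spec

/-- The image `M¹` of the restriction map, as a `K`-subspace of the rational 1-forms on `H`. -/
noncomputable def Arrangement.resImage (A : Arrangement K V) (H : Submodule K V)
    (hH : H ∈ A.hyperplanes)
    (b : Module.Basis (Fin (n + 1)) K V) (bH : Module.Basis (Fin n) K H)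
    (hb : ∀ i, (bH i : V) = b i.succ) : Submodule K (RatForm (Fin n) K) :=
  LinearMap.range (A.res H hH b bH hb)

end Restriction

end HypArr

/-! Take H as the line at infinity z_0 = 0, let T be the set of the m other planes (affine lines in
the chart z_0 = 1), and let Q' be the product of the forms of T. The dz_1, dz_2 part of a
logarithmic form is g / Q' with g = (g_0, g_1), and g occurs exactly when the form α_s = a_s0 z_0 +
a_s1 z_1 + a_s2 z_2 divides a_s1 g_1 - a_s2 g_0 for every s in T (`lineForms`): a suitable dz_0
coefficient is found by making the contraction with the Euler field vanish. In the same way the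
numerators of Ω¹(A^H, k) form `planeForms`, which a rotation identifies with D(A^H, k), degrees
included. The restriction map becomes g ↦ g|_{z_0 = 0} up to a scalar, everything is graded, and the
codimension can be read off from Hilbert functions.

Three counts are needed. (1) `planeForms` is free on generators of degrees d_0, d_1
(`exists_basis_planeForms`), so its part in degrees less than N has dimension ∑ C(N - d_i + 1, 2)
for large N. (2) The kernel of restriction in degree s + 1 is z_0 times the forms of degree s, so
the dimensions telescope: the restricted forms of degree at most N are as many as the `lineForms` of
degree N (`finrank_restrictedForms`). (3) The lines of T are added one at a time
(`finrank_lineForms_insert`). Contracting g with the direction of a new line t and restricting to t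
has as kernel the forms for T together with t; in degree e ≥ |T| its image consists of all multiples
of an explicit content polynomial. The dimension drops by e - |T| + p + 1, where p is the number of
points off H in which t meets T. The sum of the p's is `affineCount`, which equals χ₀(0).

Both dimensions in degrees less than N are thus quadratic in N with the same leading coefficient.
The determinant of a basis of `planeForms` is divisible by Q(A^H, k), which gives m ≤ d_0 + d_1; the
inclusion of the restricted forms in `planeForms` gives the opposite inequality. With d_0 + d_1 = m
the difference is the constant χ₀(0) - d_0 d_1. -/

namespace HypArr

open MvPolynomial

/-! ### Linear forms: divisibility, primality, proportionality -/

section LinearForms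

variable {K σ τ : Type*} [Field K]

/-- Modulo `d` the endomorphism `χ` is the identity on variables, hence everywhere. This turns
divisibility by a linear form into the vanishing of a substitution. -/
theorem dvd_sub_algHom (d : MvPolynomial σ K) (χ : MvPolynomial σ K →ₐ[K] MvPolynomial σ K)
    (h : ∀ i, d ∣ X i - χ (X i)) (f : MvPolynomial σ K) : d ∣ f - χ f := by
  induction f using MvPolynomial.induction_on with
  | C a => simp [← algebraMap_eq]
  | add p q hp hq => simpa [add_sub_add_comm] using dvd_add hp hq
  | mul_X p i hp =>
    have : p * X i - χ (p * X i) = (p - χ p) * X i + χ p * (X i - χ (X i)) := by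
      rw [map_mul]; ring
    rw [this]
    exact dvd_add (hp.mul_right _) ((h i).mul_left _)

theorem IsHomogeneous.aeval_C_mul {f : MvPolynomial σ K} {d : ℕ} (hf : f.IsHomogeneous d)
    (p : σ → K) (l : MvPolynomial τ K) :
    aeval (fun i => C (p i) * l) f = C (eval p f) * l ^ d := by
  rw [aeval_def, eval₂_eq, eval_eq, map_sum, Finset.sum_mul]
  refine Finset.sum_congr rfl fun m hm => ?_
  have hd : ∑ i ∈ m.support, m i = d := (hf.degree_eq_sum_deg_support hm).symm
  simp only [mul_pow, Finset.prod_mul_distrib, Finset.prod_pow_eq_pow_sum, hd, algebraMap_eq,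
    map_mul, map_prod, map_pow, mul_assoc]

/-- The linear form with coefficient vector `a`. -/
noncomputable def lin [Fintype σ] (a : σ → K) : MvPolynomial σ K := ∑ i, C (a i) * X i

theorem linPoly_eq_lin {V : Type*} [AddCommGroup V] [Module K V] [Fintype σ]
    (b : Module.Basis σ K V) (α : Module.Dual K V) : linPoly b α = lin (fun i => α (b i)) := rfl

variable [Fintype σ]

theorem isHomogeneous_lin (a : σ → K) : (lin a).IsHomogeneous 1 :=
  IsHomogeneous.sum _ _ _ fun i _ => isHomogeneous_C_mul_X (a i) i

theorem aeval_lin {B : Type*} [CommRing B] [Algebra K B] (a : σ → K) (p : σ → B) :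
    aeval p (lin a) = ∑ i, a i • p i := by
  simp [lin, Algebra.smul_def]

theorem eval_lin (a p : σ → K) : eval p (lin a) = ∑ i, a i * p i := by
  simp [lin]

theorem lin_ne_zero {a : σ → K} (ha : a ≠ 0) : lin a ≠ 0 := by
  classical
  intro h
  apply ha
  funext i
  have := congrArg (eval (Pi.single i (1 : K))) h
  simpa [eval_lin, Pi.single_apply] using this

theorem exists_pairing_eq_one {a : σ → K} (ha : a ≠ 0) : ∃ w : σ → K, ∑ i, a i * w i = 1 := by
  classical
  obtain ⟨i, hi⟩ := Function.ne_iff.1 ha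
  exact ⟨Pi.single i (a i)⁻¹, by simpa [Pi.single_apply] using mul_inv_cancel₀ hi⟩

/-- Projection along `w` onto the zeros of `lin a` kills `lin a` and is the identity modulo it, so
the kernel of the substitution is the ideal generated by `lin a`. Primality follows, the target
being a domain. -/
theorem exists_algHom_dvd_iff {a : σ → K} (w : σ → K) (hw : ∑ i, a i * w i = 1)
    (f : MvPolynomial σ K) :
    lin a ∣ f ↔ aeval (fun i => X i - C (w i) * lin a) f = 0 := by
  have h0 : aeval (fun i => X i - C (w i) * lin a) (lin a) = 0 := by
    rw [aeval_lin]
    simp only [smul_sub, Finset.sum_sub_distrib, smul_eq_C_mul, ← mul_assoc, ← C_mul,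
      ← Finset.sum_mul]
    rw [← map_sum, hw, C_1, one_mul, sub_eq_zero]
    rfl
  constructor
  · rintro ⟨g, rfl⟩
    rw [map_mul, h0, zero_mul]
  · intro h
    have := dvd_sub_algHom (lin a) (aeval (fun i => X i - C (w i) * lin a)) (fun i => by simp) f
    rwa [h, sub_zero] at this

theorem prime_lin {a : σ → K} (ha : a ≠ 0) : Prime (lin a) := by
  obtain ⟨w, hw⟩ := exists_pairing_eq_one ha
  refine ⟨lin_ne_zero ha, fun h => ?_, fun f g h => ?_⟩
  · have := (exists_algHom_dvd_iff w hw 1).1 h.dvd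
    simp at this
  · simp only [exists_algHom_dvd_iff w hw, map_mul, mul_eq_zero] at h ⊢
    exact h

theorem lin_injective : Function.Injective (lin : (σ → K) → MvPolynomial σ K) := by
  classical
  intro a c h
  funext i
  have := congrArg (eval (Pi.single i (1 : K))) h
  simpa [eval_lin, Pi.single_apply] using this

theorem lin_smul (k : K) (a : σ → K) : lin (k • a) = C k * lin a := by
  simp [lin, Finset.mul_sum, mul_assoc]

theorem lin_dvd_lin {a c : σ → K} (ha : a ≠ 0) (h : lin a ∣ lin c) : ∃ k : K, c = k • a := by
  obtain ⟨w, hw⟩ := exists_pairing_eq_one ha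
  rw [exists_algHom_dvd_iff w hw, aeval_lin] at h
  refine ⟨∑ i, c i * w i, lin_injective ?_⟩
  rw [lin_smul, ← sub_eq_zero, ← h, map_sum, Finset.sum_mul]
  simp only [lin, smul_eq_C_mul, mul_sub, Finset.sum_sub_distrib, C_mul, mul_assoc]

theorem isRelPrime_lin {a c : σ → K} (ha : a ≠ 0) (h : ∀ k : K, c ≠ k • a) :
    IsRelPrime (lin a) (lin c) := by
  rw [(prime_lin ha).irreducible.isRelPrime_iff_not_dvd]
  intro h'
  obtain ⟨k, hk⟩ := lin_dvd_lin ha h'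
  exact h k hk

end LinearForms

/-! ### Homogeneous components and dimensions of spaces of forms -/

section Graded

variable {K σ τ : Type*} [Field K]

theorem homogeneousComponent_mul_right {c x : MvPolynomial σ K} {d : ℕ} (hx : x.IsHomogeneous d)
    (u : ℕ) : homogeneousComponent (u + d) (c * x) = homogeneousComponent u c * x := by
  let := MvPolynomial.gradedAlgebra (σ := σ) (R := K)
  have := DirectSum.coe_decompose_mul_add_of_right_mem (homogeneousSubmodule σ K) (a := c) (b := x)
    (i := u) (j := d) hx
  rwa [← decomposition.decompose'_apply, ← decomposition.decompose'_apply]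

theorem homogeneousComponent_mul_right_of_lt {c x : MvPolynomial σ K} {d : ℕ}
    (hx : x.IsHomogeneous d) {s : ℕ} (hs : s < d) : homogeneousComponent s (c * x) = 0 := by
  classical
  apply homogeneousComponent_eq_zero'
  intro m hm
  have hm' : coeff m (c * x) ≠ 0 := mem_support_iff.1 hm
  intro hms
  apply hm'
  rw [coeff_mul]
  refine Finset.sum_eq_zero fun y hy => ?_
  rw [hx.coeff_eq_zero (d := y.2), mul_zero]
  rw [Finset.HasAntidiagonal.mem_antidiagonal] at hy
  have : m.degree = y.1.degree + y.2.degree := by rw [← hy, map_add]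
  omega

theorem homogeneousComponent_ext {f g : MvPolynomial σ K}
    (h : ∀ s, homogeneousComponent s f = homogeneousComponent s g) : f = g := by
  ext m
  have := congrArg (coeff m) (h m.degree)
  simpa [coeff_homogeneousComponent] using this

theorem isHomogeneous_of_homogeneousComponent {f : MvPolynomial σ K} {s : ℕ}
    (h : ∀ u, u ≠ s → homogeneousComponent u f = 0) : f.IsHomogeneous s := by
  have : f = homogeneousComponent s f := by
    refine homogeneousComponent_ext fun u => ?_
    rw [homogeneousComponent_of_mem (homogeneousComponent_mem s f)]
    split_ifs with hu
    · rw [hu]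
    · exact h u hu
  rw [this]
  exact homogeneousComponent_isHomogeneous s f

theorem IsHomogeneous.of_mul_right {c x : MvPolynomial σ K} {d s : ℕ} (hx : x.IsHomogeneous d)
    (hx0 : x ≠ 0) (h : (c * x).IsHomogeneous (s + d)) : c.IsHomogeneous s := by
  refine isHomogeneous_of_homogeneousComponent fun u hu => ?_
  have := homogeneousComponent_mul_right (c := c) hx u
  rw [homogeneousComponent_of_mem h, if_neg (by omega)] at this
  exact (mul_eq_zero.1 this.symm).resolve_right hx0

theorem IsHomogeneous.eq_zero_of_mul_right {c x : MvPolynomial σ K} {d s : ℕ}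
    (hx : x.IsHomogeneous d) (h : (c * x).IsHomogeneous s) (hs : s < d) : c * x = 0 := by
  rw [← homogeneousComponent_eq_self h]
  exact homogeneousComponent_mul_right_of_lt hx hs

theorem homogeneousComponent_aeval (p : σ → MvPolynomial τ K) (hp : ∀ i, (p i).IsHomogeneous 1)
    (s : ℕ) (f : MvPolynomial σ K) :
    homogeneousComponent s (aeval p f) = aeval p (homogeneousComponent s f) := by
  induction f using MvPolynomial.induction_on' with
  | monomial d c =>
    have h := isHomogeneous_monomial (σ := σ) c (rfl : d.degree = d.degree)
    have h2 := h.aeval p hp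
    rw [one_mul] at h2
    rw [homogeneousComponent_of_mem h, homogeneousComponent_of_mem h2]
    split_ifs <;> simp
  | add p q hp hq => simp only [map_add, hp, hq]

theorem finrank_homogeneousSubmodule (n s : ℕ) :
    Module.finrank K (homogeneousSubmodule (Fin n) K s) = (n + s - 1).choose s := by
  classical
  have h : homogeneousSubmodule (Fin n) K s
      = restrictSupport K ((Finset.univ.finsuppAntidiag s : Finset (Fin n →₀ ℕ)) : Set _) := by
    rw [homogeneousSubmodule_eq_finsupp_supported]
    change _ = AddMonoidAlgebra.supported _ _ _
    congr 1
    ext d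
    simp [Finset.mem_finsuppAntidiag, Finsupp.degree_eq_sum]
  rw [h, Module.finrank_eq_card_finset_basis (basisRestrictSupport K _),
    Finset.card_finsuppAntidiag_nat_eq_choose, Finset.card_univ, Fintype.card_fin]

theorem finrank_homogeneousSubmodule_two (s : ℕ) :
    Module.finrank K (homogeneousSubmodule (Fin 2) K s) = s + 1 := by
  rw [finrank_homogeneousSubmodule, show 2 + s - 1 = s + 1 by omega, Nat.choose_succ_self_right]

theorem finrank_homogeneousSubmodule_three (s : ℕ) :
    2 * Module.finrank K (homogeneousSubmodule (Fin 3) K s) = (s + 1) * (s + 2) := by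
  rw [finrank_homogeneousSubmodule, show 3 + s - 1 = s + 2 by omega, Nat.choose_symm_add,
    Nat.choose_two_right, show s + 2 - 1 = s + 1 by omega, mul_comm (s + 2)]
  exact Nat.mul_div_cancel' (Nat.even_mul_succ_self (s + 1)).two_dvd

/-- A homogeneous binary form is divisible by the linear form of each of its zeros. -/
theorem IsHomogeneous.lin_dvd_of_eval_eq_zero {f : MvPolynomial (Fin 2) K} {d : ℕ}
    (hf : f.IsHomogeneous d) {p : Fin 2 → K} (hp : p ≠ 0) (h0 : eval p f = 0) :
    lin ![p 1, -p 0] ∣ f := by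
  obtain ⟨q, hq⟩ := exists_pairing_eq_one hp
  rw [Fin.sum_univ_two] at hq
  -- Modulo the linear form vanishing at `p`, each `X i` is `p i` times the dual form `lin q`, so
  -- `f` becomes `f(p) * lin q ^ d`.
  have := dvd_sub_algHom (lin ![p 1, -p 0]) (aeval (fun i => C (p i) * lin q)) ?_ f
  · rwa [IsHomogeneous.aeval_C_mul hf, h0, C_0, zero_mul, sub_zero] at this
  · have e : (C (p 0) * C (q 0) + C (p 1) * C (q 1) : MvPolynomial (Fin 2) K) = 1 := by
      rw [← C_mul, ← C_mul, ← C_add, hq, C_1]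
    intro i
    fin_cases i
    · refine ⟨C (q 1), ?_⟩
      simp [lin, Fin.sum_univ_two]
      linear_combination (-X 0) * e
    · refine ⟨-C (q 0), ?_⟩
      simp [lin, Fin.sum_univ_two]
      linear_combination (-X 1) * e

end Graded

/-! ### Dimensions of images, kernels and products -/

section LinearAlgebra

variable {K E F : Type*} [Field K] [AddCommGroup E] [Module K E] [AddCommGroup F] [Module K F]

theorem finrank_map_of_injective {f : E →ₗ[K] F} (hf : Function.Injective f)
    (p : Submodule K E) : Module.finrank K (p.map f) = Module.finrank K p :=
  (LinearEquiv.finrank_eq (Submodule.equivMapOfInjective f hf p)).symm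

theorem finrank_map_add_finrank_inf_ker (f : E →ₗ[K] F) (p : Submodule K E) [Module.Finite K p] :
    Module.finrank K (p.map f) + Module.finrank K (p ⊓ LinearMap.ker f : Submodule K E)
      = Module.finrank K p := by
  have h : (LinearMap.ker (f.domRestrict p)).map p.subtype = p ⊓ LinearMap.ker f := by
    ext x
    simp [and_comm]
  rw [← LinearMap.finrank_range_add_finrank_ker (f.domRestrict p), LinearMap.range_domRestrict,
    ← h, finrank_map_of_injective p.injective_subtype]

/-- A product of submodules, as a product of modules. -/
def submodulePiEquiv {ι : Type*} {M : ι → Type*} [∀ i, AddCommGroup (M i)] [∀ i, Module K (M i)]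
    (p : ∀ i, Submodule K (M i)) : Submodule.pi Set.univ p ≃ₗ[K] (∀ i, p i) where
  toFun x i := ⟨x.1 i, x.2 i trivial⟩
  invFun x := ⟨fun i => (x i).1, fun i _ => (x i).2⟩
  map_add' _ _ := rfl
  map_smul' _ _ := rfl
  left_inv _ := rfl
  right_inv _ := rfl

theorem finrank_submodulePi {ι : Type*} [Fintype ι] {M : ι → Type*} [∀ i, AddCommGroup (M i)]
    [∀ i, Module K (M i)] (p : ∀ i, Submodule K (M i)) [∀ i, Module.Finite K (p i)] :
    Module.finrank K (Submodule.pi Set.univ p) = ∑ i, Module.finrank K (p i) := by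
  rw [(submodulePiEquiv p).finrank_eq, Module.finrank_pi_fintype]

end LinearAlgebra

/-! ### Graded subspaces and finite codimension -/

section GradedSubspaces

variable {K σ ι : Type*} [Field K]

/-- The polynomials all of whose homogeneous components of degree at least `N` vanish. -/
noncomputable def ltDegree (K σ : Type*) [Field K] (N : ℕ) : Submodule K (MvPolynomial σ K) :=
  ⨅ s : Set.Ici N, LinearMap.ker (homogeneousComponent (s : ℕ))

theorem mem_ltDegree {N : ℕ} {f : MvPolynomial σ K} :
    f ∈ ltDegree K σ N ↔ ∀ s, N ≤ s → homogeneousComponent s f = 0 := by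
  simp [ltDegree]

theorem ltDegree_succ_inf_ker (N : ℕ) :
    ltDegree K σ (N + 1) ⊓ LinearMap.ker (homogeneousComponent N) = ltDegree K σ N := by
  ext f
  simp only [Submodule.mem_inf, mem_ltDegree, LinearMap.mem_ker]
  constructor
  · rintro ⟨h1, h2⟩ s hs
    rcases hs.eq_or_lt with rfl | h
    · exact h2
    · exact h1 s h
  · exact fun h => ⟨fun s hs => h s (by omega), h N le_rfl⟩

theorem map_ltDegree_succ (N : ℕ) :
    (ltDegree K σ (N + 1)).map (homogeneousComponent N) = homogeneousSubmodule σ K N := by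
  apply le_antisymm
  · rintro _ ⟨f, -, rfl⟩
    exact homogeneousComponent_mem N f
  · intro f hf
    refine ⟨f, mem_ltDegree.2 fun s hs => ?_, homogeneousComponent_eq_self hf⟩
    rw [homogeneousComponent_of_mem hf, if_neg (by omega)]

theorem ltDegree_zero : ltDegree K σ 0 = ⊥ := by
  rw [eq_bot_iff]
  intro f hf
  rw [mem_ltDegree] at hf
  exact homogeneousComponent_ext fun s => by simpa using hf s (Nat.zero_le s)

instance finite_homogeneousSubmodule [Finite σ] (N : ℕ) :
    Module.Finite K (homogeneousSubmodule σ K N) :=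
  Module.Finite.iff_fg.2 (homogeneousSubmodule_fg σ K N)

instance finite_ltDegree [Finite σ] (N : ℕ) : Module.Finite K (ltDegree K σ N) := by
  rw [Module.Finite.iff_fg]
  induction N with
  | zero => rw [ltDegree_zero]; exact Submodule.fg_bot
  | succ N ih =>
    apply Submodule.fg_of_fg_map_of_fg_inf_ker (homogeneousComponent N)
    · rw [map_ltDegree_succ]; exact homogeneousSubmodule_fg σ K N
    · rwa [ltDegree_succ_inf_ker]

theorem two_mul_finrank_ltDegree (N : ℕ) :
    2 * Module.finrank K (ltDegree K (Fin 2) N) = N * (N + 1) := by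
  induction N with
  | zero => simp [ltDegree_zero]
  | succ N ih =>
    have := finrank_map_add_finrank_inf_ker (homogeneousComponent N) (ltDegree K (Fin 2) (N + 1))
    rw [map_ltDegree_succ, ltDegree_succ_inf_ker, finrank_homogeneousSubmodule_two] at this
    rw [← this, mul_add, ih]
    ring

/-- The homogeneous component of degree `s` of a vector of polynomials. -/
noncomputable def vecComponent (K σ ι : Type*) [Field K] (s : ℕ) :
    (ι → MvPolynomial σ K) →ₗ[K] (ι → MvPolynomial σ K) :=
  (homogeneousComponent s).compLeft ι

theorem vecComponent_apply (s : ℕ) (f : ι → MvPolynomial σ K) (i : ι) :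
    vecComponent K σ ι s f i = homogeneousComponent s (f i) := rfl

/-- The vectors of homogeneous polynomials of degree `s`. -/
noncomputable def homVec (K σ ι : Type*) [Field K] (s : ℕ) : Submodule K (ι → MvPolynomial σ K) :=
  Submodule.pi Set.univ fun _ => homogeneousSubmodule σ K s

theorem mem_homVec {s : ℕ} {f : ι → MvPolynomial σ K} :
    f ∈ homVec K σ ι s ↔ ∀ i, (f i).IsHomogeneous s := by
  simp [homVec, Submodule.mem_pi]

theorem vecComponent_mem_homVec (s : ℕ) (f : ι → MvPolynomial σ K) :
    vecComponent K σ ι s f ∈ homVec K σ ι s :=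
  mem_homVec.2 fun i => homogeneousComponent_isHomogeneous s (f i)

theorem vecComponent_of_mem {s t : ℕ} {f : ι → MvPolynomial σ K} (hf : f ∈ homVec K σ ι s) :
    vecComponent K σ ι t f = if t = s then f else 0 := by
  funext i
  rw [vecComponent_apply, homogeneousComponent_of_mem (mem_homVec.1 hf i)]
  split_ifs <;> rfl

theorem vecComponent_ext {f g : ι → MvPolynomial σ K}
    (h : ∀ s, vecComponent K σ ι s f = vecComponent K σ ι s g) : f = g :=
  funext fun i => homogeneousComponent_ext fun s => congrFun (h s) i

/-- The vectors of polynomials of degree less than `N`. -/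
noncomputable def ltVec (K σ ι : Type*) [Field K] (N : ℕ) : Submodule K (ι → MvPolynomial σ K) :=
  Submodule.pi Set.univ fun _ => ltDegree K σ N

theorem mem_ltVec {N : ℕ} {f : ι → MvPolynomial σ K} :
    f ∈ ltVec K σ ι N ↔ ∀ s, N ≤ s → vecComponent K σ ι s f = 0 := by
  simp only [ltVec, Submodule.mem_pi, Set.mem_univ, forall_true_left, mem_ltDegree]
  exact ⟨fun h s hs => funext fun i => h i s hs, fun h i s hs => congrFun (h s hs) i⟩

instance finite_homVec [Finite σ] [Fintype ι] (N : ℕ) : Module.Finite K (homVec K σ ι N) :=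
  Module.Finite.equiv (submodulePiEquiv fun _ => homogeneousSubmodule σ K N).symm

instance finite_ltVec [Finite σ] [Fintype ι] (N : ℕ) : Module.Finite K (ltVec K σ ι N) :=
  Module.Finite.equiv (submodulePiEquiv fun _ => ltDegree K σ N).symm

/-- A space of vectors of polynomials that contains the homogeneous components of its members. -/
def IsGraded (L : Submodule K (ι → MvPolynomial σ K)) : Prop :=
  ∀ f ∈ L, ∀ s, vecComponent K σ ι s f ∈ L

instance finite_inf_homVec [Finite σ] [Fintype ι] (L : Submodule K (ι → MvPolynomial σ K)) (N : ℕ) :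
    Module.Finite K (L ⊓ homVec K σ ι N : Submodule K (ι → MvPolynomial σ K)) :=
  Submodule.finiteDimensional_of_le inf_le_right

instance finite_inf_ltVec [Finite σ] [Fintype ι] (L : Submodule K (ι → MvPolynomial σ K)) (N : ℕ) :
    Module.Finite K (L ⊓ ltVec K σ ι N : Submodule K (ι → MvPolynomial σ K)) :=
  Submodule.finiteDimensional_of_le inf_le_right

theorem finrank_inf_ltVec_zero (L : Submodule K (ι → MvPolynomial σ K)) :
    Module.finrank K (L ⊓ ltVec K σ ι 0 : Submodule K (ι → MvPolynomial σ K)) = 0 := by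
  have : L ⊓ ltVec K σ ι 0 = ⊥ := by
    rw [eq_bot_iff]
    rintro f ⟨-, hf⟩
    exact vecComponent_ext fun s => by simpa using mem_ltVec.1 hf s (Nat.zero_le s)
  rw [this, finrank_bot]

theorem IsGraded.finrank_inf_ltVec_succ [Finite σ] [Fintype ι] {L : Submodule K (ι → MvPolynomial σ K)} (hL : IsGraded L)
    (N : ℕ) :
    Module.finrank K (L ⊓ ltVec K σ ι (N + 1) : Submodule K (ι → MvPolynomial σ K))
      = Module.finrank K (L ⊓ ltVec K σ ι N : Submodule K (ι → MvPolynomial σ K))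
        + Module.finrank K (L ⊓ homVec K σ ι N : Submodule K (ι → MvPolynomial σ K)) := by
  have h1 : L ⊓ ltVec K σ ι (N + 1) ⊓ LinearMap.ker (vecComponent K σ ι N)
      = L ⊓ ltVec K σ ι N := by
    ext f
    simp only [Submodule.mem_inf, mem_ltVec, LinearMap.mem_ker]
    constructor
    · rintro ⟨⟨h0, h1⟩, h2⟩
      refine ⟨h0, fun s hs => ?_⟩
      rcases hs.eq_or_lt with rfl | h
      · exact h2
      · exact h1 s h
    · exact fun ⟨h0, h⟩ => ⟨⟨h0, fun s hs => h s (by omega)⟩, h N le_rfl⟩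
  have h2 : (L ⊓ ltVec K σ ι (N + 1)).map (vecComponent K σ ι N) = L ⊓ homVec K σ ι N := by
    apply le_antisymm
    · rintro _ ⟨f, ⟨hf, -⟩, rfl⟩
      exact ⟨hL f hf N, vecComponent_mem_homVec N f⟩
    · rintro f ⟨hf, hN⟩
      refine ⟨f, ⟨hf, mem_ltVec.2 fun s hs => ?_⟩, ?_⟩
      · rw [vecComponent_of_mem hN, if_neg (by omega)]
      · rw [vecComponent_of_mem hN, if_pos rfl]
  rw [← finrank_map_add_finrank_inf_ker (vecComponent K σ ι N) (L ⊓ ltVec K σ ι (N + 1)), h1, h2,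
    add_comm]

theorem exists_mem_ltVec [Fintype ι] (f : ι → MvPolynomial σ K) : ∃ N, f ∈ ltVec K σ ι N := by
  refine ⟨Finset.univ.sup (fun i => (f i).totalDegree) + 1, mem_ltVec.2 fun s hs => ?_⟩
  funext i
  apply homogeneousComponent_eq_zero
  have := Finset.le_sup (f := fun i => (f i).totalDegree) (Finset.mem_univ i)
  change (f i).totalDegree < s
  omega

theorem sum_vecComponent {N : ℕ} {f : ι → MvPolynomial σ K} (hf : f ∈ ltVec K σ ι N) :
    ∑ s ∈ Finset.range N, vecComponent K σ ι s f = f := by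
  refine vecComponent_ext fun t => ?_
  rw [map_sum]
  simp only [vecComponent_of_mem (vecComponent_mem_homVec _ f), Finset.sum_ite_eq,
    Finset.mem_range]
  split_ifs with h
  · rfl
  · exact (mem_ltVec.1 hf t (by omega)).symm

/-- If two graded spaces `M ≤ W` agree in all degrees at least `N`, then `W / M` is finite
dimensional, and its dimension can be computed in degrees less than `N`. -/
theorem finrank_quotient_of_isGraded [Finite σ] [Fintype ι] {W M : Submodule K (ι → MvPolynomial σ K)}
    (hW : IsGraded W) (hMW : M ≤ W) (N : ℕ)
    (h : ∀ s, N ≤ s → Module.finrank K (M ⊓ homVec K σ ι s : Submodule K (ι → MvPolynomial σ K))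
      = Module.finrank K (W ⊓ homVec K σ ι s : Submodule K (ι → MvPolynomial σ K))) :
    Module.Finite K (W ⧸ M.submoduleOf W) ∧
    Module.finrank K (W ⧸ M.submoduleOf W)
      + Module.finrank K (M ⊓ ltVec K σ ι N : Submodule K (ι → MvPolynomial σ K))
      = Module.finrank K (W ⊓ ltVec K σ ι N : Submodule K (ι → MvPolynomial σ K)) := by
  -- In degrees at least `N` every form in `W` already lies in `M`. Truncating below degree `N`
  -- therefore preserves classes modulo `M`: the map `φ` is onto, and its kernel is the low-degree
  -- part of `M`.
  have heq : ∀ s, N ≤ s → W ⊓ homVec K σ ι s ≤ M := fun s hs =>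
    (Submodule.eq_of_le_of_finrank_eq (inf_le_inf_right _ hMW) (h s hs)).symm.le.trans inf_le_left
  let L : Submodule K (ι → MvPolynomial σ K) := W ⊓ ltVec K σ ι N
  let φ : L →ₗ[K] W ⧸ M.submoduleOf W :=
    (M.submoduleOf W).mkQ ∘ₗ Submodule.inclusion (inf_le_left : L ≤ W)
  have hφ : Function.Surjective φ := by
    intro x
    obtain ⟨⟨w, hw⟩, rfl⟩ := Submodule.mkQ_surjective _ x
    obtain ⟨B, hB⟩ := exists_mem_ltVec w
    let t := ∑ s ∈ Finset.range N, vecComponent K σ ι s w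
    have htW : t ∈ W := Submodule.sum_mem _ fun s _ => hW w hw s
    have htN : t ∈ ltVec K σ ι N := by
      refine mem_ltVec.2 fun s hs => ?_
      rw [map_sum]
      refine Finset.sum_eq_zero fun u hu => ?_
      rw [Finset.mem_range] at hu
      rw [vecComponent_of_mem (vecComponent_mem_homVec u w), if_neg (by omega)]
    refine ⟨⟨t, htW, htN⟩, ?_⟩
    refine (Submodule.Quotient.eq _).2 ?_
    change t - w ∈ M
    rw [← neg_sub, Submodule.neg_mem_iff]
    have hB' : w ∈ ltVec K σ ι (N + B) := mem_ltVec.2 fun s hs => mem_ltVec.1 hB s (by omega)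
    have : w - t = ∑ s ∈ Finset.range B, vecComponent K σ ι (N + s) w := by
      rw [sub_eq_iff_eq_add']
      conv_lhs => rw [← sum_vecComponent hB', Finset.sum_range_add]
    rw [this]
    exact Submodule.sum_mem _ fun s _ =>
      heq _ (Nat.le_add_right N s) ⟨hW w hw _, vecComponent_mem_homVec _ w⟩
  refine ⟨Module.Finite.of_surjective φ hφ, ?_⟩
  rw [← LinearMap.finrank_range_add_finrank_ker φ, LinearMap.range_eq_top.2 hφ, finrank_top]
  have hker : (LinearMap.ker φ).map L.subtype = M ⊓ ltVec K σ ι N := by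
    ext x
    constructor
    · rintro ⟨⟨y, hy⟩, h1, rfl⟩
      exact ⟨(Submodule.Quotient.mk_eq_zero (M.submoduleOf W)).1 h1, hy.2⟩
    · rintro ⟨h1, h2⟩
      exact ⟨⟨x, hMW h1, h2⟩, (Submodule.Quotient.mk_eq_zero (M.submoduleOf W)).2 h1, rfl⟩
  rw [← hker, finrank_map_of_injective L.injective_subtype]

end GradedSubspaces

/-! ### Pairs of polynomials with prescribed divisibility of contractions -/

section ContactModule

variable {K σ κ : Type*} [Field K]

/-- The pairs `g` of polynomials such that the contraction `a_X 0 * g 1 - a_X 1 * g 0` is divisible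
by `l_X` for all `X ∈ B`. -/
noncomputable def contactModule (B : Finset κ) (l : κ → MvPolynomial σ K) (a : κ → Fin 2 → K) :
    Submodule (MvPolynomial σ K) (Fin 2 → MvPolynomial σ K) where
  carrier := {g | ∀ X ∈ B, l X ∣ C (a X 0) * g 1 - C (a X 1) * g 0}
  zero_mem' := fun X _ => by simp
  add_mem' := fun {g h} hg hh X hX => by
    have := dvd_add (hg X hX) (hh X hX)
    simp only [Pi.add_apply]
    convert this using 1
    ring
  smul_mem' := fun c g hg X hX => by
    have := (hg X hX).mul_left c
    simp only [Pi.smul_apply, smul_eq_mul]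
    convert this using 1
    ring

theorem dvd_homogeneousComponent {f l : MvPolynomial σ K} {d : ℕ} (hl : l.IsHomogeneous d)
    (h : l ∣ f) (s : ℕ) : l ∣ homogeneousComponent s f := by
  obtain ⟨q, rfl⟩ := h
  rw [mul_comm]
  rcases lt_or_ge s d with hs | hs
  · rw [homogeneousComponent_mul_right_of_lt hl hs]
    exact dvd_zero l
  · obtain ⟨u, rfl⟩ := Nat.exists_eq_add_of_le' hs
    rw [homogeneousComponent_mul_right hl]
    exact dvd_mul_left _ _

theorem isGraded_contactModule (B : Finset κ) (l : κ → MvPolynomial σ K) (a : κ → Fin 2 → K)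
    (hl : ∀ X ∈ B, ∃ d, (l X).IsHomogeneous d) :
    IsGraded ((contactModule B l a).restrictScalars K) := by
  intro g hg s X hX
  obtain ⟨d, hd⟩ := hl X hX
  have := dvd_homogeneousComponent hd (hg X hX) s
  rwa [map_sub, homogeneousComponent_C_mul, homogeneousComponent_C_mul] at this

end ContactModule

/-! ### Freeness of logarithmic modules in the plane -/

section PlaneMulti

variable {K κ : Type*} [Field K]

/-- The numerators of the logarithmic forms of a multiarrangement in the plane: its lines are
`c_X 0 * z_0 + c_X 1 * z_1 = 0` with multiplicities `k_X`. -/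
noncomputable abbrev planeForms (B : Finset κ) (c : κ → Fin 2 → K) (k : κ → ℕ) :
    Submodule (MvPolynomial (Fin 2) K) (Fin 2 → MvPolynomial (Fin 2) K) :=
  contactModule B (fun X => lin (c X) ^ k X) c

theorem isHomogeneous_lin_pow {n : ℕ} (a : Fin n → K) (k : ℕ) : (lin a ^ k).IsHomogeneous k := by
  simpa using (isHomogeneous_lin a).pow k

variable {B : Finset κ} {c : κ → Fin 2 → K} {k : κ → ℕ}

theorem isGraded_planeForms : IsGraded ((planeForms B c k).restrictScalars K) :=
  isGraded_contactModule _ _ _ fun X _ => ⟨k X, isHomogeneous_lin_pow _ _⟩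

theorem isHomogeneous_prod_lin_pow {n : ℕ} (B : Finset κ) (c : κ → Fin n → K) (k : κ → ℕ) :
    (∏ X ∈ B, lin (c X) ^ k X).IsHomogeneous (∑ X ∈ B, k X) :=
  IsHomogeneous.prod _ _ _ fun _ _ => isHomogeneous_lin_pow _ _

theorem smul_mem_contactModule_of_prod {σ : Type*} {l : κ → MvPolynomial σ K}
    {a : κ → Fin 2 → K} (g : Fin 2 → MvPolynomial σ K) :
    (∏ X ∈ B, l X) • g ∈ contactModule B l a := by
  intro X hX
  have : C (a X 0) * ((∏ X ∈ B, l X) • g) 1 - C (a X 1) * ((∏ X ∈ B, l X) • g) 0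
      = (∏ X ∈ B, l X) * (C (a X 0) * g 1 - C (a X 1) * g 0) := by
    simp only [Pi.smul_apply, smul_eq_mul]
    ring
  rw [this]
  exact (Finset.dvd_prod_of_mem _ hX).mul_right _

/-- Over an infinite field a nonzero polynomial has a nonzero value. The factor `X 0` keeps the
point away from the origin, which matters when `B` is empty. -/
theorem exists_eval_lin_ne_zero [Infinite K] (hc : ∀ X ∈ B, c X ≠ 0) :
    ∃ p : Fin 2 → K, p ≠ 0 ∧ ∀ X ∈ B, eval p (lin (c X)) ≠ 0 := by
  have h : X 0 * ∏ X ∈ B, lin (c X) ≠ (0 : MvPolynomial (Fin 2) K) :=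
    mul_ne_zero (X_ne_zero 0) (Finset.prod_ne_zero_iff.2 fun X hX => lin_ne_zero (hc X hX))
  by_contra! hcon
  apply h
  refine MvPolynomial.funext fun p => ?_
  rw [map_zero, map_mul, eval_X, map_prod]
  by_cases hp : p = 0
  · rw [hp, Pi.zero_apply, zero_mul]
  · obtain ⟨X, hX, h0⟩ := hcon p hp
    rw [Finset.prod_eq_zero hX h0, mul_zero]

/-- Since `p` lies on none of the lines, the form vanishing at `p` is coprime to every `lin (c X)`
and cancels from each divisibility. -/
theorem planeForms_of_smul_lin {p : Fin 2 → K} (hp : p ≠ 0) (hc : ∀ X ∈ B, eval p (lin (c X)) ≠ 0)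
    {g : Fin 2 → MvPolynomial (Fin 2) K} (hg : lin ![p 1, -p 0] • g ∈ planeForms B c k) :
    g ∈ planeForms B c k := by
  intro X hX
  have h := hg X hX
  have e : C (c X 0) * (lin ![p 1, -p 0] • g) 1 - C (c X 1) * (lin ![p 1, -p 0] • g) 0
      = lin ![p 1, -p 0] * (C (c X 0) * g 1 - C (c X 1) * g 0) := by
    simp only [Pi.smul_apply, smul_eq_mul]
    ring
  rw [e] at h
  refine IsRelPrime.dvd_of_dvd_mul_left (IsRelPrime.pow_left ?_) h
  have hcX : c X ≠ 0 := fun h0 => hc X hX (by simp [h0, eval_lin])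
  refine isRelPrime_lin hcX fun r hr => hp ?_
  have h1 := congrFun hr 0
  have h2 := congrFun hr 1
  simp only [Matrix.cons_val_zero, Matrix.cons_val_one, Pi.smul_apply, smul_eq_mul] at h1 h2
  have hne := hc X hX
  rw [eval_lin, Fin.sum_univ_two] at hne
  have hr0 : r = 0 := by
    have : r * (c X 0 * p 0 + c X 1 * p 1) = 0 := by linear_combination -p 0 * h1 - p 1 * h2
    exact (mul_eq_zero.1 this).resolve_right hne
  funext i
  fin_cases i
  · simpa [hr0] using h2
  · simpa [hr0] using h1

/-- Logarithmic modules of multiarrangements in the plane are free, with a homogeneous basis. -/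
theorem exists_basis_planeForms [Infinite K] (hc : ∀ X ∈ B, c X ≠ 0) :
    ∃ (d : Fin 2 → ℕ) (θ : Module.Basis (Fin 2) (MvPolynomial (Fin 2) K) (planeForms B c k)),
      ∀ i, (θ i).1 ∈ homVec K (Fin 2) (Fin 2) (d i) := by
  classical
  obtain ⟨p, hp, hpc⟩ := exists_eval_lin_ne_zero hc
  set Q : MvPolynomial (Fin 2) K := ∏ X ∈ B, lin (c X) ^ k X with hQ
  set D := ∑ X ∈ B, k X
  have hQh : Q.IsHomogeneous D := isHomogeneous_prod_lin_pow B c k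
  have hQp : eval p Q ≠ 0 := by
    rw [hQ, map_prod, Finset.prod_ne_zero_iff]
    intro X hX
    rw [map_pow]
    exact pow_ne_zero _ (hpc X hX)
  have hQmem : ∀ r : Fin 2 → K, Q • (fun i => C (r i)) ∈ planeForms B c k := fun r =>
    smul_mem_contactModule_of_prod _
  have hQhom : ∀ r : Fin 2 → K, Q • (fun i => C (r i)) ∈ homVec K (Fin 2) (Fin 2) D := by
    intro r
    rw [mem_homVec]
    intro i
    simpa using hQh.mul (isHomogeneous_C (Fin 2) (r i))
  -- The basis: `θ` is a homogeneous member of least degree that does not vanish at `p`, and `η` one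
  -- of least degree whose value at `p` is independent of that of `θ`. Multiples of constant vectors
  -- by `Q` show that both exist.
  have ex1 : ∃ d, ∃ g ∈ planeForms B c k, g ∈ homVec K (Fin 2) (Fin 2) d ∧
      (eval p (g 0) ≠ 0 ∨ eval p (g 1) ≠ 0) :=
    ⟨D, _, hQmem ![1, 0], hQhom _, Or.inl (by simpa using hQp)⟩
  obtain ⟨θ, hθ, hθh, hθp⟩ := Nat.find_spec ex1
  have min1 : ∀ d g, g ∈ planeForms B c k → g ∈ homVec K (Fin 2) (Fin 2) d →
      d < Nat.find ex1 → eval p (g 0) = 0 ∧ eval p (g 1) = 0 := by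
    intro d g hg hgd hd
    by_contra hcon
    exact Nat.find_min ex1 hd ⟨g, hg, hgd, by tauto⟩
  set d1 := Nat.find ex1
  have ex2 : ∃ d, ∃ g ∈ planeForms B c k, g ∈ homVec K (Fin 2) (Fin 2) d ∧
      eval p (θ 0) * eval p (g 1) - eval p (θ 1) * eval p (g 0) ≠ 0 := by
    rcases hθp with h | h
    · exact ⟨D, _, hQmem ![0, 1], hQhom _, by simpa using ⟨h, hQp⟩⟩
    · exact ⟨D, _, hQmem ![1, 0], hQhom _, by simpa using ⟨h, hQp⟩⟩
  obtain ⟨η, hη, hηh, hΔ⟩ := Nat.find_spec ex2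
  have min2 : ∀ d g, g ∈ planeForms B c k → g ∈ homVec K (Fin 2) (Fin 2) d →
      d < Nat.find ex2 → eval p (θ 0) * eval p (g 1) - eval p (θ 1) * eval p (g 0) = 0 := by
    intro d g hg hgd hd
    by_contra hcon
    exact Nat.find_min ex2 hd ⟨g, hg, hgd, hcon⟩
  set d2 := Nat.find ex2
  have hd12 : d1 ≤ d2 := by
    by_contra hlt
    obtain ⟨h0, h1⟩ := min1 d2 η hη hηh (by omega)
    exact hΔ (by rw [h0, h1]; ring)
  set Δ := eval p (θ 0) * eval p (η 1) - eval p (θ 1) * eval p (η 0) with hΔdef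
  obtain ⟨q, hq⟩ := exists_pairing_eq_one hp
  have hqp : eval p (lin q) = 1 := by
    rw [eval_lin, ← hq]
    exact Finset.sum_congr rfl fun i _ => mul_comm _ _
  -- Induction on the degree. The combination `u • θ + v • η` has the same value at `p` as `g`,
  -- because `lin q` is 1 there; the difference is divisible by the linear form vanishing at `p`,
  -- and the quotient lies in the module one degree lower. When `d - d1` or `d - d2` is truncated,
  -- minimality forces the coefficient `a` or `b` to be 0.
  have span_hom : ∀ d g, g ∈ planeForms B c k → g ∈ homVec K (Fin 2) (Fin 2) d →
      g ∈ Submodule.span (MvPolynomial (Fin 2) K) {θ, η} := by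
    intro d
    induction d using Nat.strong_induction_on with
    | _ d ih =>
    intro g hg hgd
    set a := (eval p (g 0) * eval p (η 1) - eval p (g 1) * eval p (η 0)) / Δ with ha
    set b := (eval p (θ 0) * eval p (g 1) - eval p (θ 1) * eval p (g 0)) / Δ with hb
    have hb0 : d < d2 → b = 0 := fun h => by rw [hb, min2 d g hg hgd h, zero_div]
    have ha0 : d < d1 → a = 0 := fun h => by
      obtain ⟨h0, h1⟩ := min1 d g hg hgd h
      rw [ha, h0, h1]
      simp
    set u : MvPolynomial (Fin 2) K := C a * lin q ^ (d - d1)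
    set v : MvPolynomial (Fin 2) K := C b * lin q ^ (d - d2)
    have hspan : u • θ + v • η ∈ Submodule.span (MvPolynomial (Fin 2) K) {θ, η} :=
      add_mem (Submodule.smul_mem _ _ (Submodule.subset_span (by simp)))
        (Submodule.smul_mem _ _ (Submodule.subset_span (by simp)))
    have hmem : g - (u • θ + v • η) ∈ planeForms B c k :=
      sub_mem hg (add_mem (Submodule.smul_mem _ _ hθ) (Submodule.smul_mem _ _ hη))
    have hu : u • θ ∈ homVec K (Fin 2) (Fin 2) d := by
      rcases lt_or_ge d d1 with h | h
      · simp [u, ha0 h]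
      · rw [mem_homVec]
        intro i
        have := ((isHomogeneous_lin_pow q (d - d1)).C_mul a).mul (mem_homVec.1 hθh i)
        rwa [Nat.sub_add_cancel h] at this
    have hv : v • η ∈ homVec K (Fin 2) (Fin 2) d := by
      rcases lt_or_ge d d2 with h | h
      · simp [v, hb0 h]
      · rw [mem_homVec]
        intro i
        have := ((isHomogeneous_lin_pow q (d - d2)).C_mul b).mul (mem_homVec.1 hηh i)
        rwa [Nat.sub_add_cancel h] at this
    have hhom : g - (u • θ + v • η) ∈ homVec K (Fin 2) (Fin 2) d := sub_mem hgd (add_mem hu hv)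
    have hev : ∀ i, eval p ((g - (u • θ + v • η)) i) = 0 := by
      intro i
      simp only [Pi.sub_apply, Pi.add_apply, Pi.smul_apply, smul_eq_mul, map_sub, map_add, map_mul,
        map_pow, hqp, one_pow, mul_one, u, v, eval_C, ha, hb]
      fin_cases i
      · simp only [Fin.zero_eta]
        field_simp
        rw [hΔdef]
        ring
      · simp only [Fin.mk_one]
        field_simp
        rw [hΔdef]
        ring
    have hdvd := fun i => IsHomogeneous.lin_dvd_of_eval_eq_zero (mem_homVec.1 hhom i) hp (hev i)
    choose w hw using hdvd
    have hw' : g - (u • θ + v • η) = lin ![p 1, -p 0] • w := funext hw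
    have hl0 : lin ![p 1, -p 0] ≠ 0 := by
      refine lin_ne_zero fun h => hp ?_
      funext i
      have h0 := congrFun h 0
      have h1 := congrFun h 1
      fin_cases i
      · simpa using h1
      · simpa using h0
    have hmain : g - (u • θ + v • η) ∈ Submodule.span (MvPolynomial (Fin 2) K) {θ, η} := by
      rcases Nat.eq_zero_or_pos d with hd | hd
      · have : g - (u • θ + v • η) = 0 := by
          funext i
          have h := mem_homVec.1 hhom i
          rw [hw i, mul_comm] at h ⊢
          exact IsHomogeneous.eq_zero_of_mul_right (isHomogeneous_lin _) h (by omega)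
        rw [this]
        exact zero_mem _
      · rw [hw']
        refine Submodule.smul_mem _ _ (ih (d - 1) (by omega) w ?_ ?_)
        · exact planeForms_of_smul_lin hp hpc (hw' ▸ hmem)
        · rw [mem_homVec]
          intro i
          have h := mem_homVec.1 hhom i
          rw [hw i, mul_comm, ← Nat.sub_add_cancel hd] at h
          exact IsHomogeneous.of_mul_right (isHomogeneous_lin _) hl0 h
    simpa using add_mem hmain hspan
  have span_all : ∀ g ∈ planeForms B c k, g ∈ Submodule.span (MvPolynomial (Fin 2) K) {θ, η} := by
    intro g hg
    obtain ⟨N, hN⟩ := exists_mem_ltVec g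
    rw [← sum_vecComponent hN]
    exact Submodule.sum_mem _ fun s _ => span_hom s _ (isGraded_planeForms g hg s)
      (vecComponent_mem_homVec s g)
  have hdet : θ 0 * η 1 - θ 1 * η 0 ≠ 0 := by
    intro h
    have := congrArg (eval p) h
    rw [map_sub, map_mul, map_mul, map_zero] at this
    exact hΔ this
  let vv : Fin 2 → planeForms B c k := ![⟨θ, hθ⟩, ⟨η, hη⟩]
  have hli : LinearIndependent (MvPolynomial (Fin 2) K) vv := by
    rw [LinearIndependent.pair_iff]
    intro s t hst
    have h0 := congrFun (congrArg Subtype.val hst) 0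
    have h1 := congrFun (congrArg Subtype.val hst) 1
    change s * θ 0 + t * η 0 = 0 at h0
    change s * θ 1 + t * η 1 = 0 at h1
    constructor
    · have : s * (θ 0 * η 1 - θ 1 * η 0) = 0 := by linear_combination η 1 * h0 - η 0 * h1
      exact (mul_eq_zero.1 this).resolve_right hdet
    · have : t * (θ 0 * η 1 - θ 1 * η 0) = 0 := by linear_combination θ 0 * h1 - θ 1 * h0
      exact (mul_eq_zero.1 this).resolve_right hdet
  have hsp : ⊤ ≤ Submodule.span (MvPolynomial (Fin 2) K) (Set.range vv) := by
    rintro ⟨g, hg⟩ -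
    obtain ⟨s, t, hst⟩ := Submodule.mem_span_pair.1 (span_all g hg)
    have : (⟨g, hg⟩ : planeForms B c k) = s • vv 0 + t • vv 1 := Subtype.ext hst.symm
    rw [this]
    exact add_mem (Submodule.smul_mem _ _ (Submodule.subset_span ⟨0, rfl⟩))
      (Submodule.smul_mem _ _ (Submodule.subset_span ⟨1, rfl⟩))
  refine ⟨![d1, d2], Module.Basis.mk hli hsp, fun i => ?_⟩
  rw [Module.Basis.mk_apply]
  fin_cases i
  · exact hθh
  · exact hηh

end PlaneMulti

/-! ### Degrees of a basis and the Hilbert function in the plane -/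

section PlaneMultiDimensions

variable {K κ : Type*} [Field K] {B : Finset κ} {c : κ → Fin 2 → K} {k : κ → ℕ}

theorem isRelPrime_lin_pow_of_pairwise {n : ℕ} {c : κ → Fin n → K} {k : κ → ℕ}
    (hc : ∀ X ∈ B, c X ≠ 0) (hB : ∀ X ∈ B, ∀ Y ∈ B, X ≠ Y → ∀ r : K, c Y ≠ r • c X) :
    (B : Set κ).Pairwise (Function.onFun IsRelPrime fun X => lin (c X) ^ k X) :=
  fun X hX Y hY h => (isRelPrime_lin (hc X hX) (hB X hX Y hY h)).pow_left.pow_right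

/-- A nonzero coordinate of `c X` times the determinant is a combination of the contractions of `f`
and `g`, both divisible by `lin (c X) ^ k X`. The powers belonging to different lines are coprime.
-/
theorem prod_lin_pow_dvd_det (hc : ∀ X ∈ B, c X ≠ 0)
    (hB : ∀ X ∈ B, ∀ Y ∈ B, X ≠ Y → ∀ r : K, c Y ≠ r • c X)
    {f g : Fin 2 → MvPolynomial (Fin 2) K} (hf : f ∈ planeForms B c k)
    (hg : g ∈ planeForms B c k) :
    ∏ X ∈ B, lin (c X) ^ k X ∣ f 0 * g 1 - f 1 * g 0 := by
  refine Finset.prod_dvd_of_isRelPrime (isRelPrime_lin_pow_of_pairwise hc hB) fun X hX => ?_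
  have h1 := hf X hX
  have h2 := hg X hX
  by_cases h0 : c X 0 = 0
  · have h10 : c X 1 ≠ 0 := fun h => hc X hX (by funext i; fin_cases i <;> simpa)
    have hu : IsUnit (C (c X 1) : MvPolynomial (Fin 2) K) := (isUnit_iff_ne_zero.2 h10).map C
    rw [← hu.dvd_mul_left]
    have := dvd_sub (h2.mul_left (f 1)) (h1.mul_left (g 1))
    rw [h0, C_0] at this
    convert this using 1
    ring
  · have hu : IsUnit (C (c X 0) : MvPolynomial (Fin 2) K) := (isUnit_iff_ne_zero.2 h0).map C
    rw [← hu.dvd_mul_left]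
    have := dvd_sub (h2.mul_left (f 0)) (h1.mul_left (g 0))
    convert this using 1
    ring

variable (θ : Module.Basis (Fin 2) (MvPolynomial (Fin 2) K) (planeForms B c k)) {d : Fin 2 → ℕ}

/-- A vanishing determinant yields the relations `(θ 1) j • θ 0 = (θ 0) j • θ 1`; by independence
all entries of both basis vectors would be zero. -/
theorem det_basis_planeForms_ne_zero :
    (θ 0).1 0 * (θ 1).1 1 - (θ 0).1 1 * (θ 1).1 0 ≠ 0 := by
  intro h
  have hli := θ.linearIndependent
  rw [Fintype.linearIndependent_iff] at hli
  have key : ∀ j, (θ 1).1 j = 0 ∧ (θ 0).1 j = 0 := by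
    intro j
    have := hli ![(θ 1).1 j, -(θ 0).1 j] (by
      rw [Fin.sum_univ_two]
      refine Subtype.ext (funext fun i => ?_)
      change (θ 1).1 j * (θ 0).1 i + -(θ 0).1 j * (θ 1).1 i = 0
      fin_cases i <;> fin_cases j <;> simp only [Fin.zero_eta, Fin.mk_one]
      · ring
      · linear_combination h
      · linear_combination -h
      · ring)
    have h0 := this 0
    have h1 := this 1
    simp only [Matrix.cons_val_zero, Matrix.cons_val_one] at h0 h1
    exact ⟨h0, neg_eq_zero.1 h1⟩
  exact θ.ne_zero 0 (Subtype.ext (funext fun j => (key j).2))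

variable (hθ : ∀ i, (θ i).1 ∈ homVec K (Fin 2) (Fin 2) (d i))

include hθ

/-- The determinant of the basis is nonzero of degree `d 0 + d 1` and divisible by a form of degree
`∑ k X`. The opposite inequality is obtained later, for restricted multiarrangements, from Hilbert
functions. -/
theorem sum_mult_le_of_basis_planeForms (hc : ∀ X ∈ B, c X ≠ 0)
    (hB : ∀ X ∈ B, ∀ Y ∈ B, X ≠ Y → ∀ r : K, c Y ≠ r • c X) :
    ∑ X ∈ B, k X ≤ d 0 + d 1 := by
  have hne := det_basis_planeForms_ne_zero θ
  obtain ⟨q, hq⟩ := prod_lin_pow_dvd_det hc hB (θ 0).2 (θ 1).2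
  have hh : ((θ 0).1 0 * (θ 1).1 1 - (θ 0).1 1 * (θ 1).1 0).IsHomogeneous (d 0 + d 1) :=
    ((mem_homVec.1 (hθ 0) 0).mul (mem_homVec.1 (hθ 1) 1)).sub
      ((mem_homVec.1 (hθ 0) 1).mul (mem_homVec.1 (hθ 1) 0))
  by_contra! hlt
  apply hne
  rw [hq, mul_comm] at hh ⊢
  exact IsHomogeneous.eq_zero_of_mul_right (isHomogeneous_prod_lin_pow B c k) hh hlt

/-- A linear combination of the basis has degree less than `N` iff its coefficients have degrees
less than `N - d i`. -/
theorem map_ltDegree_basis_planeForms (N : ℕ) :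
    (Submodule.pi Set.univ fun i => ltDegree K (Fin 2) (N - d i)).map
        (((planeForms B c k).subtype ∘ₗ θ.equivFun.symm.toLinearMap).restrictScalars K)
      = (planeForms B c k).restrictScalars K ⊓ ltVec K (Fin 2) (Fin 2) N := by
  have happ : ∀ u : Fin 2 → MvPolynomial (Fin 2) K, ∀ j,
      (θ.equivFun.symm u).1 j = ∑ i, u i * (θ i).1 j := by
    intro u j
    rw [Module.Basis.equivFun_symm_apply]
    simp
  -- Components are taken coefficientwise with a shift by `d i`. The subtraction `s - d i` is
  -- truncated, so the case `s < d i` must be set to zero separately.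
  have hcomp : ∀ (u : Fin 2 → MvPolynomial (Fin 2) K) (s : ℕ),
      vecComponent K (Fin 2) (Fin 2) s (θ.equivFun.symm u).1 = (θ.equivFun.symm
        (fun i => if d i ≤ s then homogeneousComponent (s - d i) (u i) else 0)).1 := by
    intro u s
    funext j
    rw [vecComponent_apply, happ, happ, map_sum]
    refine Finset.sum_congr rfl fun i _ => ?_
    split_ifs with h
    · rw [← homogeneousComponent_mul_right (mem_homVec.1 (hθ i) j), Nat.sub_add_cancel h]
    · rw [homogeneousComponent_mul_right_of_lt (mem_homVec.1 (hθ i) j) (by omega), zero_mul]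
  apply le_antisymm
  · rintro _ ⟨u, hu, rfl⟩
    refine ⟨(θ.equivFun.symm u).2, mem_ltVec.2 fun s hs => ?_⟩
    change vecComponent K (Fin 2) (Fin 2) s (θ.equivFun.symm u).1 = 0
    rw [hcomp]
    have : (fun i => if d i ≤ s then homogeneousComponent (s - d i) (u i) else 0) = 0 := by
      funext i
      split_ifs with h
      · exact mem_ltDegree.1 (hu i trivial) _ (by omega)
      · rfl
    rw [this, map_zero]
    rfl
  · rintro g ⟨hg, hN⟩
    refine ⟨θ.equivFun ⟨g, hg⟩, fun i _ => mem_ltDegree.2 fun s hs => ?_, ?_⟩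
    · have h0 := hcomp (θ.equivFun ⟨g, hg⟩) (s + d i)
      rw [LinearEquiv.symm_apply_apply, mem_ltVec.1 hN _ (by omega)] at h0
      have h1 := (LinearEquiv.map_eq_zero_iff _).1 (Subtype.ext h0.symm :
        θ.equivFun.symm (fun j => if d j ≤ s + d i then homogeneousComponent (s + d i - d j)
          (θ.equivFun ⟨g, hg⟩ j) else 0) = 0)
      have h2 := congrFun h1 i
      simpa using h2
    · simp

theorem two_mul_finrank_planeForms (N : ℕ) :
    2 * Module.finrank K ((planeForms B c k).restrictScalars K ⊓ ltVec K (Fin 2) (Fin 2) N :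
        Submodule K (Fin 2 → MvPolynomial (Fin 2) K))
      = (N - d 0) * (N - d 0 + 1) + (N - d 1) * (N - d 1 + 1) := by
  rw [← map_ltDegree_basis_planeForms θ hθ N, finrank_map_of_injective, finrank_submodulePi,
    Fin.sum_univ_two, mul_add, two_mul_finrank_ltDegree, two_mul_finrank_ltDegree]
  exact (planeForms B c k).injective_subtype.comp θ.equivFun.symm.injective

end PlaneMultiDimensions

/-! ### Interpolation by binary forms -/

section Interpolation

variable {K : Type*} [Field K]

/-- The binary linear form vanishing at `(1, y)`. -/
noncomputable def pointForm (y : K) : MvPolynomial (Fin 2) K := lin ![-y, 1]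

theorem pointForm_ne_zero (y : K) : pointForm y ≠ 0 :=
  lin_ne_zero fun h => one_ne_zero (congrFun h 1)

theorem pointForm_dvd_of_eval_eq_zero {f : MvPolynomial (Fin 2) K} {d : ℕ}
    (hf : f.IsHomogeneous d) {y : K} (h0 : eval ![1, y] f = 0) : pointForm y ∣ f := by
  have h := IsHomogeneous.lin_dvd_of_eval_eq_zero hf (p := ![1, y])
    (fun h => one_ne_zero (congrFun h 0)) h0
  have e : pointForm y = -lin ![(![1, y] : Fin 2 → K) 1, -(![1, y] : Fin 2 → K) 0] := by
    simp [pointForm, lin, Fin.sum_univ_two]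
    ring
  rwa [e, neg_dvd]

theorem eval_pointForm (x y : K) : eval ![1, x] (pointForm y) = x - y := by
  simp [pointForm, eval_lin, Fin.sum_univ_two]
  ring

theorem isHomogeneous_prod_pointForm (Y : Finset K) :
    (∏ y ∈ Y, pointForm y).IsHomogeneous Y.card := by
  simpa using IsHomogeneous.prod Y pointForm (fun _ => 1) fun y _ => isHomogeneous_lin _

/-- Lagrange interpolation, by induction on the points. A multiple of the product over `Y` is
subtracted from `f` so that the rest vanishes at the new point `x`; the rest is then divisible by
`pointForm x`, and the quotient is handled by the induction hypothesis for the colon ideal of `J` by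
`pointForm x`. This is why `J` is arbitrary. -/
theorem mem_of_prod_pointForm_mem [DecidableEq K] (Y : Finset K) :
    ∀ (J : Ideal (MvPolynomial (Fin 2) K)), ∏ y ∈ Y, pointForm y ∈ J →
      (∀ y ∈ Y, ∏ z ∈ Y.erase y, pointForm z ∈ J) →
      ∀ (d : ℕ) (f : MvPolynomial (Fin 2) K), f.IsHomogeneous d → Y.card ≤ d + 1 → f ∈ J := by
  induction Y using Finset.induction_on with
  | empty =>
    intro J h1 _ d f _ _
    rw [Finset.prod_empty] at h1
    rw [(Ideal.eq_top_iff_one J).2 h1]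
    trivial
  | insert x Y hx ih =>
    intro J h1 h2 d f hf hd
    rw [Finset.card_insert_of_notMem hx] at hd
    have hYd : Y.card ≤ d := by omega
    have hP : ∏ y ∈ Y, pointForm y ∈ J := by
      have := h2 x (Finset.mem_insert_self x Y)
      rwa [Finset.erase_insert hx] at this
    have hPe : eval ![1, x] (∏ y ∈ Y, pointForm y) ≠ 0 := by
      rw [map_prod, Finset.prod_ne_zero_iff]
      intro y hy
      rw [eval_pointForm, sub_ne_zero]
      rintro rfl
      exact hx hy
    set P := ∏ y ∈ Y, pointForm y with hPdef
    set u : MvPolynomial (Fin 2) K := C (eval ![1, x] f / eval ![1, x] P) * X 0 ^ (d - Y.card)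
    have hsub : (f - u * P).IsHomogeneous d := by
      refine hf.sub ?_
      have := (isHomogeneous_C_mul_X_pow (eval ![1, x] f / eval ![1, x] P) (0 : Fin 2)
        (d - Y.card)).mul (isHomogeneous_prod_pointForm Y)
      rwa [Nat.sub_add_cancel hYd] at this
    have hev : eval ![1, x] (f - u * P) = 0 := by
      simp only [u, map_sub, map_mul, eval_C, map_pow, eval_X, Matrix.cons_val_zero, one_pow,
        mul_one]
      rw [div_mul_cancel₀ _ hPe, sub_self]
    obtain ⟨w, hw⟩ := pointForm_dvd_of_eval_eq_zero hsub hev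
    have hmain : pointForm x * w ∈ J := by
      rw [← hw]
      rcases Nat.eq_zero_or_pos d with rfl | hdpos
      · have : f - u * P = 0 := by
          rw [hw, mul_comm] at hsub ⊢
          exact IsHomogeneous.eq_zero_of_mul_right (isHomogeneous_lin _) hsub Nat.zero_lt_one
        rw [this]
        exact zero_mem J
      · have hwh : w.IsHomogeneous (d - 1) := by
          rw [hw, mul_comm, ← Nat.sub_add_cancel hdpos] at hsub
          exact IsHomogeneous.of_mul_right (isHomogeneous_lin _) (pointForm_ne_zero x) hsub
        have := ih (Submodule.comap (LinearMap.mulLeft (MvPolynomial (Fin 2) K) (pointForm x)) J)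
          (J.mul_mem_left _ hP) (fun y hy => ?_) (d - 1) w hwh (by omega)
        · rw [hw]
          exact this
        · have hyx : x ≠ y := by rintro rfl; exact hx hy
          have := h2 y (Finset.mem_insert_of_mem hy)
          rw [Finset.erase_insert_of_ne hyx, Finset.prod_insert (by simp [hx])] at this
          exact this
    have : f = pointForm x * w + u * P := by rw [← hw]; ring
    rw [this]
    exact add_mem hmain (J.mul_mem_left u hP)

end Interpolation

/-! ### Forms logarithmic along affine lines, and restriction to one line -/

section LineForms

variable {K κ : Type*} [Field K] (a : κ → Fin 3 → K)

/-- The pairs `(g_0, g_1)` such that `g_0 dz_1 + g_1 dz_2` is, away from `z_0 = 0`, the numerator of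
a logarithmic form for the hyperplanes `a_t 0 * z_0 + a_t 1 * z_1 + a_t 2 * z_2 = 0`. -/
noncomputable abbrev lineForms (T : Finset κ) :
    Submodule (MvPolynomial (Fin 3) K) (Fin 2 → MvPolynomial (Fin 3) K) :=
  contactModule T (fun t => lin (a t)) fun t => ![a t 1, a t 2]

theorem mem_lineForms {T : Finset κ} {g : Fin 2 → MvPolynomial (Fin 3) K} :
    g ∈ lineForms a T ↔ ∀ t ∈ T, lin (a t) ∣ C (a t 1) * g 1 - C (a t 2) * g 0 := Iff.rfl

theorem isGraded_lineForms (T : Finset κ) : IsGraded ((lineForms a T).restrictScalars K) :=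
  isGraded_contactModule _ _ _ fun _ _ => ⟨1, isHomogeneous_lin _⟩

theorem lin_three (u : Fin 3 → K) :
    lin u = C (u 0) * X 0 + C (u 1) * X 1 + C (u 2) * X 2 := by
  rw [lin, Fin.sum_univ_three]

variable (t : κ) (D : Fin 3 → K)

/-- Restriction of polynomials to the plane of `a t`, parametrised by a point `D` on it and its
direction `(0, -a_t 2, a_t 1)` at infinity. -/
noncomputable def lineRestrict : MvPolynomial (Fin 3) K →ₐ[K] MvPolynomial (Fin 2) K :=
  aeval ![lin ![D 0, 0], lin ![D 1, -a t 2], lin ![D 2, a t 1]]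

theorem lin_two (u v : K) : lin ![u, v] = C u * X 0 + C v * X 1 := by
  rw [lin, Fin.sum_univ_two]
  rfl

/-- The slope of `a s` along the line of `a t`. -/
def slope (s : κ) : K := a t 1 * a s 2 - a t 2 * a s 1

theorem lineRestrict_lin (s : κ) :
    lineRestrict a t D (lin (a s)) = lin ![∑ i, a s i * D i, slope a t s] := by
  rw [lineRestrict, aeval_lin, Fin.sum_univ_three, Fin.sum_univ_three]
  simp only [lin_two, Matrix.cons_val_zero, Matrix.cons_val_one, Matrix.cons_val, slope,
    smul_eq_C_mul, map_add, map_sub, map_mul, map_neg, map_zero]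
  ring

theorem homogeneousComponent_lineRestrict (s : ℕ) (f : MvPolynomial (Fin 3) K) :
    homogeneousComponent s (lineRestrict a t D f)
      = lineRestrict a t D (homogeneousComponent s f) := by
  refine homogeneousComponent_aeval _ (fun i => ?_) s f
  fin_cases i <;> exact isHomogeneous_lin _

/-- The restriction to the line of `a t` of the contraction of a form with its direction. -/
noncomputable def lineContract :
    (Fin 2 → MvPolynomial (Fin 3) K) →ₗ[K] MvPolynomial (Fin 2) K :=
  (lineRestrict a t D).toLinearMap ∘ₗ
    (a t 1 • LinearMap.proj 1 - a t 2 • LinearMap.proj 0)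

theorem lineContract_apply (g : Fin 2 → MvPolynomial (Fin 3) K) :
    lineContract a t D g = lineRestrict a t D (C (a t 1) * g 1 - C (a t 2) * g 0) := by
  simp [lineContract, smul_eq_C_mul]

theorem lineContract_smul (f : MvPolynomial (Fin 3) K) (g : Fin 2 → MvPolynomial (Fin 3) K) :
    lineContract a t D (f • g) = lineRestrict a t D f * lineContract a t D g := by
  rw [lineContract_apply, lineContract_apply, ← map_mul]
  congr 1
  simp only [Pi.smul_apply, smul_eq_mul]
  ring

theorem homogeneousComponent_lineContract (s : ℕ) (g : Fin 2 → MvPolynomial (Fin 3) K) :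
    homogeneousComponent s (lineContract a t D g)
      = lineContract a t D (vecComponent K (Fin 3) (Fin 2) s g) := by
  rw [lineContract_apply, lineContract_apply, homogeneousComponent_lineRestrict, map_sub,
    homogeneousComponent_C_mul, homogeneousComponent_C_mul]
  rfl

variable {a t D} (hD0 : D 0 = 1) (hD : ∑ i, a t i * D i = 0)

include hD0 hD

/-- As `γ` is dual to the direction of the line, the linear form `μ = γ 0 * (z_1 - D 1 * z_0) + γ 1
* (z_2 - D 2 * z_0)` restricts to the second parameter, and `X 1 ↦ μ` gives the section. The second
property shows that the kernel of restriction is generated by `lin (a t)`. -/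
theorem exists_lineRestrict_section {γ : Fin 2 → K} (hγ : a t 1 * γ 1 - a t 2 * γ 0 = 1) :
    ∃ σ : MvPolynomial (Fin 2) K →ₐ[K] MvPolynomial (Fin 3) K,
      (∀ f, lineRestrict a t D (σ f) = f) ∧ ∀ f, lin (a t) ∣ f - σ (lineRestrict a t D f) := by
  rw [Fin.sum_univ_three, hD0, mul_one] at hD
  have h1 : (C (a t 1) * C (γ 1) - C (a t 2) * C (γ 0) : MvPolynomial (Fin 3) K) = 1 := by
    rw [← C_mul, ← C_mul, ← C_sub, hγ, C_1]
  have h1' : (C (a t 1) * C (γ 1) - C (a t 2) * C (γ 0) : MvPolynomial (Fin 2) K) = 1 := by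
    rw [← C_mul, ← C_mul, ← C_sub, hγ, C_1]
  have h2 : (C (a t 0) + C (a t 1) * C (D 1) + C (a t 2) * C (D 2) : MvPolynomial (Fin 3) K)
      = 0 := by
    rw [← C_mul, ← C_mul, ← C_add, ← C_add, hD, C_0]
  let μ : MvPolynomial (Fin 3) K :=
    C (γ 0) * (X 1 - C (D 1) * X 0) + C (γ 1) * (X 2 - C (D 2) * X 0)
  let σ : MvPolynomial (Fin 2) K →ₐ[K] MvPolynomial (Fin 3) K := aeval ![X 0, μ]
  have hσ : ∀ u v : K, σ (lin ![u, v]) = C u * X 0 + C v * μ := by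
    intro u v
    rw [lin_two]
    simp [σ, ← algebraMap_eq]
  have hX : ∀ i, lineRestrict a t D (X i)
      = ![lin ![D 0, 0], lin ![D 1, -a t 2], lin ![D 2, a t 1]] i := fun i => aeval_X _ i
  refine ⟨σ, fun f => ?_, dvd_sub_algHom _ (σ.comp (lineRestrict a t D)) fun i => ?_⟩
  · change ((lineRestrict a t D).comp σ) f = AlgHom.id K _ f
    congr 1
    refine algHom_ext fun i => ?_
    have hC : ∀ x : K, lineRestrict a t D (C x) = C x := fun x => by
      simp [← algebraMap_eq]
    fin_cases i
    · simp [σ, hX, lin_two, hD0]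
    · simp only [Fin.mk_one, AlgHom.comp_apply, σ, aeval_X, Matrix.cons_val_one, μ, map_add,
        map_sub, map_mul, hX, hC, lin_two, Matrix.cons_val_zero, Matrix.cons_val, hD0, map_one,
        map_zero, map_neg, AlgHom.id_apply, Matrix.cons_val_fin_one]
      linear_combination X 1 * h1'
  · rw [AlgHom.comp_apply, hX, lin_three]
    fin_cases i
    · simp [hσ, hD0]
    · refine ⟨C (γ 1), ?_⟩
      simp only [Fin.mk_one, Matrix.cons_val_one, Matrix.cons_val_zero, hσ, μ, map_neg]
      linear_combination (-X 1 + C (D 1) * X 0) * h1 - C (γ 1) * X 0 * h2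
    · refine ⟨-C (γ 0), ?_⟩
      simp only [Fin.reduceFinMk, Matrix.cons_val, hσ, μ]
      linear_combination (-X 2 + C (D 2) * X 0) * h1 + C (γ 0) * X 0 * h2

end LineForms

/-! ### Adding a line: the image of the contraction -/

section Deletion

variable {K κ : Type*} [Field K]

/-- Zero slope means that the lines are parallel in the chart z_0 = 1, that is, they meet on H. -/
theorem exists_smul_of_slope_eq_zero {a : κ → Fin 3 → K} {t s : κ}
    (ht : a t 1 ≠ 0 ∨ a t 2 ≠ 0) (h : slope a t s = 0) :
    ∃ r : K, a s 1 = r * a t 1 ∧ a s 2 = r * a t 2 := by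
  rw [slope] at h
  rcases ht with h1 | h2
  · refine ⟨a s 1 / a t 1, by field_simp, ?_⟩
    field_simp
    linear_combination h
  · refine ⟨a s 2 / a t 2, ?_, by field_simp⟩
    field_simp
    linear_combination -h

theorem exists_dual_direction {a : κ → Fin 3 → K} {t : κ} (ht : a t 1 ≠ 0 ∨ a t 2 ≠ 0) :
    ∃ γ : Fin 2 → K, a t 1 * γ 1 - a t 2 * γ 0 = 1 := by
  rcases ht with h1 | h2
  · exact ⟨![0, (a t 1)⁻¹], by simp [h1]⟩
  · exact ⟨![-(a t 2)⁻¹, 0], by simp [h2]⟩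

theorem isUnit_C_iff {σ : Type*} {r : K} : IsUnit (C r : MvPolynomial σ K) ↔ r ≠ 0 := by
  refine ⟨?_, fun h => (isUnit_iff_ne_zero.2 h).map C⟩
  rintro h rfl
  rw [C_0] at h
  exact not_isUnit_zero h

theorem prod_lin_dvd_of_forall_dvd {a : κ → Fin 3 → K} {T U : Finset κ}
    (htail : ∀ s ∈ T, a s 1 ≠ 0 ∨ a s 2 ≠ 0)
    (hpair : ∀ s ∈ T, ∀ s' ∈ T, s ≠ s' → ∀ r : K, a s' ≠ r • a s) (hU : U ⊆ T) {f : MvPolynomial (Fin 3) K}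
    (h : ∀ s ∈ U, lin (a s) ∣ f) : ∏ s ∈ U, lin (a s) ∣ f := by
  refine Finset.prod_dvd_of_isRelPrime (fun s hs s' hs' hne => ?_) h
  refine isRelPrime_lin ?_ (hpair s (hU hs) s' (hU hs') hne)
  intro h0
  rcases htail s (hU hs) with h | h
  · exact h (congrFun h0 1)
  · exact h (congrFun h0 2)

theorem isRelPrime_pointForm {x y : K} (h : x ≠ y) : IsRelPrime (pointForm x) (pointForm y) := by
  refine isRelPrime_lin (fun h => one_ne_zero (congrFun h 1)) fun r hr => h ?_
  have h0 := congrFun hr 0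
  have h1 := congrFun hr 1
  simp only [Matrix.cons_val_zero, Matrix.cons_val_one, Pi.smul_apply, smul_eq_mul,
    mul_one] at h0 h1
  rw [← h1, one_mul] at h0
  exact (neg_injective h0).symm

theorem isRelPrime_X_pointForm (y : K) : IsRelPrime (X 0) (pointForm y) := by
  have : (X 0 : MvPolynomial (Fin 2) K) = lin ![1, 0] := by simp [lin_two]
  rw [this]
  refine isRelPrime_lin (fun h => one_ne_zero (congrFun h 0)) fun r hr => ?_
  have h1 := congrFun hr 1
  simp at h1

variable (a : κ → Fin 3 → K) (t : κ) (D : Fin 3 → K)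

/-- The coordinate on the line of `a t` of its intersection with the line of `a s`. -/
def slopePoint (s : κ) : K := -(∑ i, a s i * D i) / slope a t s

theorem lineRestrict_lin_of_slope_ne_zero {s : κ} (hs : slope a t s ≠ 0) :
    lineRestrict a t D (lin (a s)) = C (slope a t s) * pointForm (slopePoint a t D s) := by
  rw [lineRestrict_lin, pointForm, ← lin_smul]
  congr 1
  funext i
  fin_cases i
  · simp only [Fin.zero_eta, Matrix.cons_val_zero, Pi.smul_apply, slopePoint, smul_eq_mul]
    field_simp
  · simp

theorem lineRestrict_lin_of_slope_eq_zero {s : κ} (hs : slope a t s = 0) :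
    lineRestrict a t D (lin (a s)) = C (∑ i, a s i * D i) * X 0 := by
  rw [lineRestrict_lin, hs, lin_two, C_0, zero_mul, add_zero]

theorem lineRestrict_prod_of_slope_eq_zero {U : Finset κ} (hU : ∀ s ∈ U, slope a t s = 0)
    (hU' : ∀ s ∈ U, ∑ i, a s i * D i ≠ 0) :
    ∃ u : K, u ≠ 0 ∧ lineRestrict a t D (∏ s ∈ U, lin (a s)) = C u * X 0 ^ U.card := by
  refine ⟨∏ s ∈ U, ∑ i, a s i * D i, Finset.prod_ne_zero_iff.2 hU', ?_⟩
  rw [map_prod, Finset.prod_congr rfl fun s hs =>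
    lineRestrict_lin_of_slope_eq_zero a t D (hU s hs), Finset.prod_mul_distrib, map_prod,
    Finset.prod_const]

theorem lineRestrict_prod_of_slopePoint_eq {U : Finset κ} {y : K}
    (hU : ∀ s ∈ U, slope a t s ≠ 0) (hy : ∀ s ∈ U, slopePoint a t D s = y) :
    ∃ u : K, u ≠ 0 ∧ lineRestrict a t D (∏ s ∈ U, lin (a s)) = C u * pointForm y ^ U.card := by
  refine ⟨∏ s ∈ U, slope a t s, Finset.prod_ne_zero_iff.2 hU, ?_⟩
  rw [map_prod, Finset.prod_congr rfl fun s hs =>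
    (lineRestrict_lin_of_slope_ne_zero a t D (hU s hs)).trans (by rw [hy s hs]),
    Finset.prod_mul_distrib, map_prod, Finset.prod_const]

/-- A parallel to the line of `a t` through its point `D` would coincide with it, which `hpair'`
excludes. -/
theorem eval_ne_zero_of_slope_eq_zero {a : κ → Fin 3 → K} {t : κ} {D : Fin 3 → K}
    {T : Finset κ} (hD0 : D 0 = 1) (hD : ∑ i, a t i * D i = 0) (ht : a t 1 ≠ 0 ∨ a t 2 ≠ 0)
    (hpair' : ∀ s ∈ T, ∀ r : K, a s ≠ r • a t) {s : κ} (hs : s ∈ T) (h : slope a t s = 0) :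
    ∑ i, a s i * D i ≠ 0 := by
  obtain ⟨r, h1, h2⟩ := exists_smul_of_slope_eq_zero ht h
  intro h0
  apply hpair' s hs r
  rw [Fin.sum_univ_three, hD0] at hD h0
  funext i
  fin_cases i
  · simp only [Fin.zero_eta, Pi.smul_apply, smul_eq_mul]
    rw [h1, h2] at h0
    linear_combination h0 - r * hD
  · exact h1
  · exact h2

variable [DecidableEq K] (T : Finset κ)

/-- The coordinates of the intersection points of the line of `a t` with the lines of `T`. -/
def slopePoints : Finset K := (T.filter fun s => slope a t s ≠ 0).image (slopePoint a t D)

/-- The lines of `T` meeting the line of `a t` at the point with coordinate `y`. -/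
def linesThrough (y : K) : Finset κ :=
  (T.filter fun s => slope a t s ≠ 0).filter fun s => slopePoint a t D s = y

/-- The greatest common divisor of the contractions `lineContract` of the forms in `lineForms`. -/
noncomputable def lineContent : MvPolynomial (Fin 2) K :=
  X 0 ^ (T.filter fun s => slope a t s = 0).card *
    ∏ y ∈ slopePoints a t D T, pointForm y ^ ((linesThrough a t D T y).card - 1)

variable {a t D T}

theorem one_le_card_linesThrough {y : K} (hy : y ∈ slopePoints a t D T) :
    1 ≤ (linesThrough a t D T y).card := by
  obtain ⟨s, hs, rfl⟩ := Finset.mem_image.1 hy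
  exact Finset.card_pos.2 ⟨s, Finset.mem_filter.2 ⟨hs, rfl⟩⟩

theorem lineContent_ne_zero : lineContent a t D T ≠ 0 :=
  mul_ne_zero (pow_ne_zero _ (X_ne_zero 0))
    (Finset.prod_ne_zero_iff.2 fun y _ => pow_ne_zero _ (pointForm_ne_zero y))

/-- Each line of `T` is either parallel to the line of `a t` or passes through exactly one of the
intersection points, and the exponents of `lineContent` omit one line for each point. -/
theorem exists_isHomogeneous_lineContent :
    ∃ δ, (lineContent a t D T).IsHomogeneous δ ∧ δ + (slopePoints a t D T).card = T.card := by
  refine ⟨_, (isHomogeneous_X_pow (0 : Fin 2) _).mul (IsHomogeneous.prod _ _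
    (fun y => (linesThrough a t D T y).card - 1) fun y _ => isHomogeneous_lin_pow _ _), ?_⟩
  have h1 := Finset.card_eq_sum_card_fiberwise (f := slopePoint a t D)
    (s := T.filter fun s => slope a t s ≠ 0) (t := slopePoints a t D T)
    fun s hs => Finset.mem_image_of_mem _ hs
  have h2 := Finset.card_filter_add_card_filter_not (s := T) (fun s => slope a t s = 0)
  have h3 : ∑ y ∈ slopePoints a t D T, ((linesThrough a t D T y).card - 1)
      + (slopePoints a t D T).card = ∑ y ∈ slopePoints a t D T, (linesThrough a t D T y).card := by
    rw [Finset.card_eq_sum_ones, ← Finset.sum_add_distrib]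
    exact Finset.sum_congr rfl fun y hy => Nat.sub_add_cancel (one_le_card_linesThrough hy)
  rw [add_assoc, h3, ← h2]
  exact congrArg _ h1.symm

variable (hD0 : D 0 = 1) (hD : ∑ i, a t i * D i = 0)
  (htail : ∀ s ∈ T, a s 1 ≠ 0 ∨ a s 2 ≠ 0) (ht : a t 1 ≠ 0 ∨ a t 2 ≠ 0)
  (hpair : ∀ s ∈ T, ∀ s' ∈ T, s ≠ s' → ∀ r : K, a s' ≠ r • a s)
  (hpair' : ∀ s ∈ T, ∀ r : K, a s ≠ r • a t)

include hD0 hD ht hpair' in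
-- Parallel lines restrict to multiples of `X 0`, the others to multiples of the `pointForm` of
-- their intersection point. The exponents in `lineContent` are one short at each point, which the
-- last product restores.
theorem exists_lineRestrict_prod :
    ∃ u : K, u ≠ 0 ∧ lineRestrict a t D (∏ s ∈ T, lin (a s))
      = C u * (lineContent a t D T * ∏ y ∈ slopePoints a t D T, pointForm y) := by
  obtain ⟨u, hu, h1⟩ := lineRestrict_prod_of_slope_eq_zero a t D
    (U := T.filter fun s => slope a t s = 0) (fun s hs => (Finset.mem_filter.1 hs).2)
    (fun s hs => eval_ne_zero_of_slope_eq_zero hD0 hD ht hpair' (Finset.mem_filter.1 hs).1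
      (Finset.mem_filter.1 hs).2)
  have h2 : ∀ y, ∃ u : K, u ≠ 0 ∧ lineRestrict a t D (∏ s ∈ linesThrough a t D T y, lin (a s))
      = C u * pointForm y ^ (linesThrough a t D T y).card := fun y =>
    lineRestrict_prod_of_slopePoint_eq a t D
      (fun s hs => (Finset.mem_filter.1 (Finset.mem_filter.1 hs).1).2)
      (fun s hs => (Finset.mem_filter.1 hs).2)
  choose v hv h2 using h2
  refine ⟨u * ∏ y ∈ slopePoints a t D T, v y,
    mul_ne_zero hu (Finset.prod_ne_zero_iff.2 fun y _ => hv y), ?_⟩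
  have h3 : ∏ s ∈ T with ¬ slope a t s = 0, lin (a s)
      = ∏ y ∈ slopePoints a t D T, ∏ s ∈ linesThrough a t D T y, lin (a s) :=
    (Finset.prod_fiberwise_of_maps_to (fun s hs => Finset.mem_image_of_mem _ hs) _).symm
  rw [← Finset.prod_filter_mul_prod_filter_not T (fun s => slope a t s = 0), map_mul, h1, h3,
    map_prod, Finset.prod_congr rfl fun y _ => h2 y, Finset.prod_mul_distrib, C_mul, map_prod,
    lineContent, mul_assoc (X 0 ^ _)]
  have h4 : ∏ y ∈ slopePoints a t D T,
      (pointForm y ^ ((linesThrough a t D T y).card - 1) * pointForm y)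
      = ∏ y ∈ slopePoints a t D T, pointForm y ^ (linesThrough a t D T y).card :=
    Finset.prod_congr rfl fun y hy => by
      rw [← pow_succ, Nat.sub_add_cancel (one_le_card_linesThrough hy)]
  rw [Finset.prod_mul_distrib] at h4
  rw [h4]
  ring

include hD0 hD ht htail hpair hpair' in
-- For a line parallel to that of `a t`, contracting with the direction of `a t` is the same, up to
-- a nonzero constant, as contracting with its own direction. Hence all forms of parallel lines
-- divide the contraction before restriction, and each restricts to a multiple of `X 0`.
theorem X_pow_dvd_lineContract {g : Fin 2 → MvPolynomial (Fin 3) K} (hg : g ∈ lineForms a T) :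
    X 0 ^ (T.filter fun s => slope a t s = 0).card ∣ lineContract a t D g := by
  obtain ⟨u, hu, h1⟩ := lineRestrict_prod_of_slope_eq_zero a t D
    (U := T.filter fun s => slope a t s = 0) (fun s hs => (Finset.mem_filter.1 hs).2)
    (fun s hs => eval_ne_zero_of_slope_eq_zero hD0 hD ht hpair' (Finset.mem_filter.1 hs).1
      (Finset.mem_filter.1 hs).2)
  rw [← (isUnit_C_iff.2 hu).mul_left_dvd, ← h1, lineContract_apply]
  refine map_dvd _ (prod_lin_dvd_of_forall_dvd htail hpair (Finset.filter_subset _ _) ?_)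
  intro s hs
  obtain ⟨hsT, hs0⟩ := Finset.mem_filter.1 hs
  obtain ⟨r, hr1, hr2⟩ := exists_smul_of_slope_eq_zero ht hs0
  have hr : r ≠ 0 := by
    rintro rfl
    rcases htail s hsT with h | h
    · exact h (by rw [hr1, zero_mul])
    · exact h (by rw [hr2, zero_mul])
  have := hg s hsT
  simp only [Matrix.cons_val_zero, Matrix.cons_val_one] at this
  rw [← (isUnit_C_iff.2 hr).dvd_mul_left]
  rw [hr1, hr2, C_mul, C_mul] at this
  convert this using 1
  ring

include hD0 htail hpair in
-- `Ψ` is the contraction of `g` with the radial field centred at the intersection point `(1, P1,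
-- P2)`. This field is tangent to all lines through the point, so their forms divide `Ψ`. Along the
-- line of `a t` it is `pointForm y` times the direction, whence the extra factor on the right and
-- the exponent reduced by one in `lineContent`.
theorem pointForm_pow_dvd_lineContract {g : Fin 2 → MvPolynomial (Fin 3) K}
    (hg : g ∈ lineForms a T) (y : K) :
    pointForm y ^ (linesThrough a t D T y).card ∣ pointForm y * lineContract a t D g := by
  have hlt : ∀ s ∈ linesThrough a t D T y,
      s ∈ T ∧ slope a t s ≠ 0 ∧ slopePoint a t D s = y := fun s hs => by
    obtain ⟨h1, h2⟩ := Finset.mem_filter.1 hs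
    obtain ⟨h3, h4⟩ := Finset.mem_filter.1 h1
    exact ⟨h3, h4, h2⟩
  obtain ⟨u, hu, h1⟩ := lineRestrict_prod_of_slopePoint_eq a t D (y := y)
    (fun s hs => (hlt s hs).2.1) (fun s hs => (hlt s hs).2.2)
  set P1 := D 1 - y * a t 2 with hP1
  set P2 := D 2 + y * a t 1 with hP2
  set Ψ : MvPolynomial (Fin 3) K := g 0 * (X 1 - C P1 * X 0) + g 1 * (X 2 - C P2 * X 0) with hΨ
  have hΨd : ∏ s ∈ linesThrough a t D T y, lin (a s) ∣ Ψ := by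
    refine prod_lin_dvd_of_forall_dvd htail hpair
      ((Finset.filter_subset _ _).trans (Finset.filter_subset _ _)) fun s hs => ?_
    obtain ⟨hsT, hs0, hsy⟩ := hlt s hs
    have hP : a s 0 + a s 1 * P1 + a s 2 * P2 = 0 := by
      rw [slopePoint, div_eq_iff hs0, Fin.sum_univ_three, hD0, slope] at hsy
      rw [hP1, hP2]
      linear_combination -hsy
    have hPC : (C (a s 0) + C (a s 1) * C P1 + C (a s 2) * C P2 : MvPolynomial (Fin 3) K) = 0 := by
      rw [← C_mul, ← C_mul, ← C_add, ← C_add, hP, C_0]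
    have hl := lin_three (a s)
    have := hg s hsT
    simp only [Matrix.cons_val_zero, Matrix.cons_val_one] at this
    rcases htail s hsT with h | h
    · rw [← (isUnit_C_iff.2 h).dvd_mul_left]
      have e : C (a s 1) * Ψ = g 0 * lin (a s)
          + (C (a s 1) * g 1 - C (a s 2) * g 0) * (X 2 - C P2 * X 0) := by
        rw [hΨ, hl]
        linear_combination -g 0 * X 0 * hPC
      rw [e]
      exact dvd_add (dvd_mul_left _ _) (this.mul_right _)
    · rw [← (isUnit_C_iff.2 h).dvd_mul_left]
      have e : C (a s 2) * Ψ = g 1 * lin (a s)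
          - (C (a s 1) * g 1 - C (a s 2) * g 0) * (X 1 - C P1 * X 0) := by
        rw [hΨ, hl]
        linear_combination -g 1 * X 0 * hPC
      rw [e]
      exact dvd_sub (dvd_mul_left _ _) (this.mul_right _)
  rw [← (isUnit_C_iff.2 hu).mul_left_dvd, ← h1]
  have hX : ∀ i, lineRestrict a t D (X i)
      = ![lin ![D 0, 0], lin ![D 1, -a t 2], lin ![D 2, a t 1]] i := fun i => aeval_X _ i
  have hC : ∀ x : K, lineRestrict a t D (C x) = C x := fun x => by
    simp [← algebraMap_eq]
  have : pointForm y * lineContract a t D g = lineRestrict a t D Ψ := by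
    rw [lineContract_apply, hΨ, pointForm, lin_two]
    simp only [map_add, map_sub, map_mul, hX, hC, lin_two, Matrix.cons_val_zero,
      Matrix.cons_val_one, Matrix.cons_val, hD0, hP1, hP2, map_neg, map_one, map_zero]
    ring
  rw [this]
  exact map_dvd _ hΨd

include hD0 hD ht htail hpair hpair' in
theorem lineContent_dvd_lineContract {g : Fin 2 → MvPolynomial (Fin 3) K}
    (hg : g ∈ lineForms a T) : lineContent a t D T ∣ lineContract a t D g := by
  refine IsRelPrime.mul_dvd ?_ (X_pow_dvd_lineContract hD0 hD htail ht hpair hpair' hg)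
    (Finset.prod_dvd_of_isRelPrime (fun x _ y _ hne => ?_) fun y hy => ?_)
  · exact IsRelPrime.prod_right fun y _ => (isRelPrime_X_pointForm y).pow_left.pow_right
  · exact (isRelPrime_pointForm hne).pow_left.pow_right
  · have := pointForm_pow_dvd_lineContract (t := t) hD0 htail hpair hg y
    rw [← Nat.sub_add_cancel (one_le_card_linesThrough hy), pow_succ',
      mul_dvd_mul_iff_left (pointForm_ne_zero y)] at this
    exact this

variable [DecidableEq κ]

include hD0 hD ht hpair' in
-- The realisable cofactors `f` form an ideal `J`, as restriction has a section. With `P` the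
-- product of the forms of `T`, the pair `P • γ` puts the product of all `pointForm`s in `J`, and
-- the numerator `(P / α_s) dα_s` puts there the product omitting the point of `s`. Interpolation
-- yields the rest.
theorem exists_lineContract_eq {d : ℕ} {f : MvPolynomial (Fin 2) K} (hf : f.IsHomogeneous d)
    (hd : (slopePoints a t D T).card ≤ d + 1) :
    ∃ g ∈ lineForms a T, lineContract a t D g = lineContent a t D T * f := by
  obtain ⟨γ, hγ⟩ := exists_dual_direction ht
  obtain ⟨σ, hσ, -⟩ := exists_lineRestrict_section hD0 hD hγ
  obtain ⟨u, hu, hQ⟩ := exists_lineRestrict_prod hD0 hD ht hpair'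
  let J : Ideal (MvPolynomial (Fin 2) K) :=
    { carrier := {f | ∃ g ∈ lineForms a T, lineContract a t D g = lineContent a t D T * f}
      zero_mem' := ⟨0, zero_mem _, by simp⟩
      add_mem' := by
        rintro f f' ⟨g, hg, h⟩ ⟨g', hg', h'⟩
        exact ⟨g + g', add_mem hg hg', by rw [map_add, h, h', mul_add]⟩
      smul_mem' := by
        rintro c f ⟨g, hg, h⟩
        exact ⟨σ c • g, Submodule.smul_mem _ _ hg, by
          rw [lineContract_smul, hσ, h, smul_eq_mul]; ring⟩ }
  have hunit : ∀ f, C u * f ∈ J → f ∈ J := by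
    intro f hf
    have := J.mul_mem_left (C u⁻¹) hf
    rwa [← mul_assoc, ← C_mul, inv_mul_cancel₀ hu, C_1, one_mul] at this
  refine mem_of_prod_pointForm_mem (slopePoints a t D T) J (hunit _ ?_) (fun y hy => ?_) d f hf hd
  · refine ⟨(∏ s ∈ T, lin (a s)) • fun i => C (γ i), smul_mem_contactModule_of_prod _, ?_⟩
    rw [lineContract_smul, hQ, lineContract_apply, ← C_mul, ← C_mul, ← C_sub, hγ, C_1, map_one]
    ring
  · obtain ⟨s, hs, rfl⟩ := Finset.mem_image.1 hy
    obtain ⟨hsT, hs0⟩ := Finset.mem_filter.1 hs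
    refine hunit _ ⟨(∏ s' ∈ T.erase s, lin (a s')) • ![C (a s 1), C (a s 2)], ?_, ?_⟩
    · intro s' hs'
      by_cases hss : s' = s
      · subst hss
        simp only [Pi.smul_apply, smul_eq_mul, Matrix.cons_val_zero, Matrix.cons_val_one]
        refine ⟨0, ?_⟩
        ring
      · have h := Finset.dvd_prod_of_mem (fun s' => lin (a s')) (Finset.mem_erase.2 ⟨hss, hs'⟩)
        exact dvd_sub ((h.mul_right _).mul_left _) ((h.mul_right _).mul_left _)
    · have h1 : lineRestrict a t D (∏ s' ∈ T.erase s, lin (a s')) *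
          (C (slope a t s) * pointForm (slopePoint a t D s))
          = C u * (lineContent a t D T * ∏ y ∈ slopePoints a t D T, pointForm y) := by
        rw [← lineRestrict_lin_of_slope_ne_zero a t D hs0, ← map_mul, mul_comm,
          Finset.mul_prod_erase _ (fun s' => lin (a s')) hsT, hQ]
      rw [← Finset.mul_prod_erase _ _ hy] at h1
      refine mul_right_cancel₀ (pointForm_ne_zero (slopePoint a t D s)) ?_
      rw [lineContract_smul, lineContract_apply]
      simp only [Matrix.cons_val_zero, Matrix.cons_val_one]
      rw [← C_mul, ← C_mul, ← C_sub, ← slope, ← algebraMap_eq, AlgHom.commutes, algebraMap_eq]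
      linear_combination h1

include hD0 hD ht htail hpair hpair' in
/-- The Hilbert function of `lineForms` drops, on adding a line to `T`, by the number of forms of
the right degree on that line. -/
theorem finrank_lineForms_insert {e : ℕ} (he : T.card ≤ e) :
    Module.finrank K ((lineForms a T).restrictScalars K ⊓ homVec K (Fin 3) (Fin 2) e :
        Submodule K (Fin 2 → MvPolynomial (Fin 3) K))
      = (e - T.card + (slopePoints a t D T).card + 1)
        + Module.finrank K ((lineForms a (insert t T)).restrictScalars K ⊓
          homVec K (Fin 3) (Fin 2) e : Submodule K (Fin 2 → MvPolynomial (Fin 3) K)) := by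
  obtain ⟨δ, hδ, hδT⟩ := exists_isHomogeneous_lineContent (a := a) (t := t) (D := D) (T := T)
  -- The degree `e - T.card + p`, with `p` the number of intersection points, is `e` minus the
  -- degree of `lineContent`; the hypothesis `T.card ≤ e` places it in the range of interpolation.
  have hrange : ((lineForms a T).restrictScalars K ⊓ homVec K (Fin 3) (Fin 2) e).map
      (lineContract a t D) = (homogeneousSubmodule (Fin 2) K
        (e - T.card + (slopePoints a t D T).card)).map
          (LinearMap.mulLeft K (lineContent a t D T)) := by
    apply le_antisymm
    · rintro _ ⟨g, ⟨hg, hge⟩, rfl⟩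
      obtain ⟨q, hq⟩ := lineContent_dvd_lineContract hD0 hD htail ht hpair hpair' hg
      refine ⟨q, ?_, hq.symm⟩
      have hh : (lineContract a t D g).IsHomogeneous e := by
        have := homogeneousComponent_lineContract a t D e g
        rw [vecComponent_of_mem hge, if_pos rfl] at this
        rw [← this]
        exact homogeneousComponent_isHomogeneous e _
      rw [hq, mul_comm] at hh
      refine IsHomogeneous.of_mul_right hδ lineContent_ne_zero ?_
      convert hh using 1
      omega
    · rintro _ ⟨q, hq, rfl⟩
      obtain ⟨g, hg, hgq⟩ := exists_lineContract_eq hD0 hD ht hpair' (T := T) hq (by omega)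
      -- The preimage found need not be homogeneous; its component of degree `e` has the same image.
      refine ⟨_, ⟨isGraded_lineForms a T g hg e, vecComponent_mem_homVec e g⟩, ?_⟩
      rw [← homogeneousComponent_lineContract, hgq]
      have := hδ.mul hq
      rw [show δ + (e - T.card + (slopePoints a t D T).card) = e by omega] at this
      exact homogeneousComponent_eq_self this
  -- By the section, the restricted contraction vanishes exactly when `lin (a t)` divides the
  -- contraction, which is the condition at `t`.
  have hker : (lineForms a T).restrictScalars K ⊓ homVec K (Fin 3) (Fin 2) e ⊓
      LinearMap.ker (lineContract a t D)
      = (lineForms a (insert t T)).restrictScalars K ⊓ homVec K (Fin 3) (Fin 2) e := by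
    obtain ⟨γ, hγ⟩ := exists_dual_direction ht
    obtain ⟨σ, -, hσ⟩ := exists_lineRestrict_section hD0 hD hγ
    ext g
    simp only [Submodule.mem_inf, Submodule.restrictScalars_mem, mem_lineForms,
      Finset.forall_mem_insert, LinearMap.mem_ker, lineContract_apply]
    constructor
    · rintro ⟨⟨h1, h2⟩, h3⟩
      refine ⟨⟨?_, h1⟩, h2⟩
      have := hσ (C (a t 1) * g 1 - C (a t 2) * g 0)
      rwa [h3, map_zero, sub_zero] at this
    · rintro ⟨⟨⟨q, hq⟩, h1⟩, h2⟩
      refine ⟨⟨h1, h2⟩, ?_⟩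
      rw [hq, map_mul, lineRestrict_lin, hD, slope, mul_comm (a t 2), sub_self]
      simp [lin_two]
  rw [← finrank_map_add_finrank_inf_ker (lineContract a t D), hker, hrange,
    finrank_map_of_injective, finrank_homogeneousSubmodule_two]
  exact fun x y hxy => mul_left_cancel₀ lineContent_ne_zero hxy

end Deletion

/-! ### Hyperplanes and their intersections -/

section Coatoms

variable {K V : Type*} [Field K] [AddCommGroup V] [Module K V]

theorem isCoatom_of_finrank_quotient {H : Submodule K V} (hH : Module.finrank K (V ⧸ H) = 1) :
    IsCoatom H := by
  rw [← isSimpleModule_iff_isCoatom]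
  exact isSimpleModule_iff_finrank_eq_one.2 hH

theorem eq_of_le_of_finrank_quotient {H H' : Submodule K V} (hH : Module.finrank K (V ⧸ H) = 1)
    (hH' : Module.finrank K (V ⧸ H') = 1) (h : H ≤ H') : H = H' :=
  ((isCoatom_of_finrank_quotient hH).le_iff_eq (isCoatom_of_finrank_quotient hH').1).1 h |>.symm

theorem finrank_add_one_of_finrank_quotient [Module.Finite K V] {H : Submodule K V}
    (hH : Module.finrank K (V ⧸ H) = 1) : Module.finrank K H + 1 = Module.finrank K V := by
  rw [← hH, add_comm, Submodule.finrank_quotient_add_finrank]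

theorem finrank_inf_add_two [Module.Finite K V] {H H' : Submodule K V}
    (hH : Module.finrank K (V ⧸ H) = 1) (hH' : Module.finrank K (V ⧸ H') = 1) (hne : H ≠ H') :
    Module.finrank K (H ⊓ H' : Submodule K V) + 2 = Module.finrank K V := by
  have h1 := Submodule.finrank_sup_add_finrank_inf_eq H H'
  have h2 : H ⊔ H' = ⊤ := by
    refine (isCoatom_of_finrank_quotient hH).2 _ (lt_of_le_of_ne le_sup_left fun h => hne ?_)
    exact (eq_of_le_of_finrank_quotient hH' hH (h ▸ le_sup_right)).symm
  rw [h2, finrank_top] at h1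
  have := finrank_add_one_of_finrank_quotient hH
  have := finrank_add_one_of_finrank_quotient hH'
  omega

theorem eq_inf_of_le_of_finrank [Module.Finite K V] (hV : Module.finrank K V = 3)
    {X H H' : Submodule K V} (hX : Module.finrank K X = 1)
    (hH : Module.finrank K (V ⧸ H) = 1) (hH' : Module.finrank K (V ⧸ H') = 1) (hne : H ≠ H')
    (h : X ≤ H) (h' : X ≤ H') : X = H ⊓ H' := by
  refine Submodule.eq_of_le_of_finrank_eq (le_inf h h') ?_
  have := finrank_inf_add_two hH hH' hne
  omega

end Coatoms

/-! ### Counting intersections off H -/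

section Counting

variable {K V : Type*} [Field K] [AddCommGroup V] [Module K V] (H : Submodule K V)

open Classical in
/-- The intersections of two members of `T` that are not contained in `H`. -/
noncomputable def affineFlats (T : Finset (Submodule K V)) : Finset (Submodule K V) :=
  (T.offDiag.image fun p => p.1 ⊓ p.2).filter fun X => ¬ X ≤ H

theorem mem_affineFlats {T : Finset (Submodule K V)} {X : Submodule K V} :
    X ∈ affineFlats H T ↔ (∃ s ∈ T, ∃ s' ∈ T, s ≠ s' ∧ s ⊓ s' = X) ∧ ¬ X ≤ H := by
  simp only [affineFlats, Finset.mem_filter, Finset.mem_image, Finset.mem_offDiag, Prod.exists]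
  constructor
  · rintro ⟨⟨s, s', ⟨h1, h2, h3⟩, h4⟩, h5⟩
    exact ⟨⟨s, h1, s', h2, h3, h4⟩, h5⟩
  · rintro ⟨⟨s, h1, s', h2, h3, h4⟩, h5⟩
    exact ⟨⟨s, s', ⟨h1, h2, h3⟩, h4⟩, h5⟩

open Classical in
/-- The number of intersections of members of `T` outside `H`, counted with multiplicity. -/
noncomputable def affineCount (T : Finset (Submodule K V)) : ℕ :=
  ∑ X ∈ affineFlats H T, ((T.filter fun s => X ≤ s).card - 1)

variable {H} [Module.Finite K V] (hV : Module.finrank K V = 3)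
  {T : Finset (Submodule K V)} {t : Submodule K V}

include hV in
theorem finrank_of_mem_affineFlats (hT : ∀ s ∈ T, Module.finrank K (V ⧸ s) = 1)
    {X : Submodule K V} (hX : X ∈ affineFlats H T) : Module.finrank K X = 1 := by
  obtain ⟨⟨s, h1, s', h2, h3, rfl⟩, -⟩ := (mem_affineFlats H).1 hX
  have := finrank_inf_add_two (hT s h1) (hT s' h2) h3
  omega

open Classical in
include hV in
-- A flat that is new for `insert t T` lies on only one member of `T`, so its term for `T` is zero
-- and both counts may be summed over the larger set of flats. There, each flat contained in `t`
-- gains one.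
theorem affineCount_insert (hT : ∀ s ∈ insert t T, Module.finrank K (V ⧸ s) = 1) (ht : t ∉ T) :
    affineCount H (insert t T) = affineCount H T
      + ((affineFlats H (insert t T)).filter fun X => X ≤ t).card := by
  have hsub : affineFlats H T ⊆ affineFlats H (insert t T) := by
    intro X hX
    rw [mem_affineFlats] at hX ⊢
    obtain ⟨⟨s, h1, s', h2, h3⟩, h4⟩ := hX
    exact ⟨⟨s, Finset.mem_insert_of_mem h1, s', Finset.mem_insert_of_mem h2, h3⟩, h4⟩
  have h0 : affineCount H T
      = ∑ X ∈ affineFlats H (insert t T), ((T.filter fun s => X ≤ s).card - 1) := by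
    refine Finset.sum_subset hsub fun X hX hX' => ?_
    have : (T.filter fun s => X ≤ s).card ≤ 1 := by
      rw [Finset.card_le_one]
      intro s hs s' hs'
      by_contra hne
      rw [Finset.mem_filter] at hs hs'
      apply hX'
      rw [mem_affineFlats]
      exact ⟨⟨s, hs.1, s', hs'.1, hne, (eq_inf_of_le_of_finrank hV
        (finrank_of_mem_affineFlats hV hT hX) (hT s (Finset.mem_insert_of_mem hs.1))
        (hT s' (Finset.mem_insert_of_mem hs'.1)) hne hs.2 hs'.2).symm⟩,
        ((mem_affineFlats H).1 hX).2⟩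
    omega
  rw [h0, affineCount, Finset.card_filter, ← Finset.sum_add_distrib]
  refine Finset.sum_congr rfl fun X hX => ?_
  rw [Finset.filter_insert]
  split_ifs with hXt
  · rw [Finset.card_insert_of_notMem fun h => ht (Finset.mem_filter.1 h).1]
    have : 0 < (T.filter fun s => X ≤ s).card := by
      obtain ⟨⟨s, h1, s', h2, h3, rfl⟩, -⟩ := (mem_affineFlats H).1 hX
      by_cases hs : s = t
      · refine Finset.card_pos.2 ⟨s', Finset.mem_filter.2 ⟨?_, inf_le_right⟩⟩
        exact (Finset.mem_insert.1 h2).resolve_left fun h => h3 (hs.trans h.symm)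
      · exact Finset.card_pos.2
          ⟨s, Finset.mem_filter.2 ⟨(Finset.mem_insert.1 h1).resolve_left hs, inf_le_left⟩⟩
    omega
  · rfl

end Counting

/-! ### Coefficients of defining forms -/

section DefCoeff

variable {K V ι : Type*} [Field K] [AddCommGroup V] [Module K V]

/-- The coefficients of the defining form of a hyperplane. -/
noncomputable def defCoeff (b : Module.Basis ι K V) (s : Submodule K V) : ι → K :=
  fun i => defForm s (b i)

variable [Fintype ι] (b : Module.Basis ι K V)

theorem sum_defCoeff {s : Submodule K V} (x : ι → K) :
    ∑ i, defCoeff b s i * x i = defForm s (∑ i, x i • b i) := by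
  rw [map_sum]
  exact Finset.sum_congr rfl fun i _ => by rw [map_smul, smul_eq_mul, mul_comm]; rfl

theorem mem_iff_sum_defCoeff {s : Submodule K V} (hs : Module.finrank K (V ⧸ s) = 1)
    (x : ι → K) : ∑ i, x i • b i ∈ s ↔ ∑ i, defCoeff b s i * x i = 0 := by
  conv_lhs => rw [← ker_defForm hs]
  rw [LinearMap.mem_ker, sum_defCoeff]

theorem defCoeff_ne_zero {s : Submodule K V} (hs : Module.finrank K (V ⧸ s) = 1) :
    defCoeff b s ≠ 0 := by
  intro h
  refine (isCoatom_of_finrank_quotient hs).1 (eq_top_iff.2 fun x _ => ?_)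
  rw [← b.sum_repr x, mem_iff_sum_defCoeff b hs, h]
  simp

theorem defCoeff_ne_smul {b : Module.Basis ι K V} {s s' : Submodule K V} (hs : Module.finrank K (V ⧸ s) = 1)
    (hs' : Module.finrank K (V ⧸ s') = 1) (hne : s ≠ s') (r : K) :
    defCoeff b s' ≠ r • defCoeff b s := by
  intro h
  refine hne (eq_of_le_of_finrank_quotient hs hs' fun x hx => ?_)
  rw [← b.sum_repr x] at hx ⊢
  rw [mem_iff_sum_defCoeff b hs] at hx
  rw [mem_iff_sum_defCoeff b hs', h]
  simp only [Pi.smul_apply, smul_eq_mul, mul_assoc]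
  rw [← Finset.mul_sum, hx, mul_zero]

end DefCoeff

/-! ### The Hilbert function of the forms logarithmic along lines -/

section HilbertFunction

variable {K V : Type*} [Field K] [AddCommGroup V] [Module K V] {b : Module.Basis (Fin 3) K V}

variable {H : Submodule K V} (hH : Module.finrank K (V ⧸ H) = 1)
  (hb : ∀ x : Fin 3 → K, ∑ i, x i • b i ∈ H ↔ x 0 = 0)

include hH hb in
theorem defCoeff_tail {s : Submodule K V} (hs : Module.finrank K (V ⧸ s) = 1) (hne : s ≠ H) :
    defCoeff b s 1 ≠ 0 ∨ defCoeff b s 2 ≠ 0 := by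
  by_contra! h
  refine hne (eq_of_le_of_finrank_quotient hH hs fun x hx => ?_).symm
  rw [← b.sum_repr x] at hx ⊢
  rw [hb] at hx
  rw [mem_iff_sum_defCoeff b hs, Fin.sum_univ_three, h.1, h.2, hx]
  ring

theorem exists_affine_point {u : Fin 3 → K} (hu : u 1 ≠ 0 ∨ u 2 ≠ 0) :
    ∃ D : Fin 3 → K, D 0 = 1 ∧ ∑ i, u i * D i = 0 := by
  rcases hu with h | h
  · refine ⟨![1, -u 0 / u 1, 0], rfl, ?_⟩
    simp [Fin.sum_univ_three]
    field_simp
    ring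
  · refine ⟨![1, 0, -u 0 / u 2], rfl, ?_⟩
    simp [Fin.sum_univ_three]
    field_simp
    ring

open Classical in
include hH hb in
-- The parameter `y` corresponds to the flat spanned by the point `P y`, which lies off `H`. For a
-- line `s` not parallel to `t` this flat is `s ⊓ t` when `y` is its `slopePoint`, while parallels
-- meet `t` inside `H` and contribute no affine flat.
theorem card_slopePoints {T : Finset (Submodule K V)} {t : Submodule K V}
    (hT : ∀ s ∈ insert t T, Module.finrank K (V ⧸ s) = 1) (hTH : ∀ s ∈ insert t T, s ≠ H)
    (ht : t ∉ T) {D : Fin 3 → K} (hD0 : D 0 = 1) (hD : ∑ i, defCoeff b t i * D i = 0) :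
    (slopePoints (defCoeff b) t D T).card
      = ((affineFlats H (insert t T)).filter fun X => X ≤ t).card := by
  have hfin : Module.Finite K V := Module.Finite.of_basis b
  have hV : Module.finrank K V = 3 := by rw [Module.finrank_eq_card_basis b, Fintype.card_fin]
  have htc := hT t (Finset.mem_insert_self t T)
  have htail := defCoeff_tail hH hb htc (hTH t (Finset.mem_insert_self t T))
  let v : Fin 3 → K := ![0, -defCoeff b t 2, defCoeff b t 1]
  let P : K → V := fun y => ∑ i, (D i + y * v i) • b i
  have hcoord : ∀ (x x' : Fin 3 → K), ∑ i, x i • b i = ∑ i, x' i • b i → x = x' := by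
    intro x x' h
    have := congrArg b.equivFun h
    simpa [← Module.Basis.equivFun_symm_apply] using this
  have hinj : Function.Injective fun y => Submodule.span K {P y} := by
    intro y y' h
    have hmem : P y' ∈ Submodule.span K {P y} := by
      rw [show Submodule.span K {P y} = Submodule.span K {P y'} from h]
      exact Submodule.mem_span_singleton_self _
    obtain ⟨r, hr⟩ := Submodule.mem_span_singleton.1 hmem
    simp only [P, Finset.smul_sum, smul_smul] at hr
    have hc := hcoord _ _ hr
    have h0 := congrFun hc 0
    have h1 := congrFun hc 1
    have h2 := congrFun hc 2
    simp only [v, hD0, Matrix.cons_val_zero, mul_zero, add_zero, mul_one, Matrix.cons_val_one,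
      Matrix.cons_val] at h0 h1 h2
    subst h0
    rcases htail with h | h
    · exact mul_right_cancel₀ h (by linear_combination h2)
    · exact mul_right_cancel₀ h (by linear_combination -h1)
  have hmeet : ∀ s ∈ T, slope (defCoeff b) t s ≠ 0 →
      s ⊓ t = Submodule.span K {P (slopePoint (defCoeff b) t D s)} := by
    intro s hs hsl
    have hsc := hT s (Finset.mem_insert_of_mem hs)
    set y := slopePoint (defCoeff b) t D s with hy
    have hyeq : ∑ i, defCoeff b s i * D i + y * slope (defCoeff b) t s = 0 := by
      rw [hy, slopePoint]
      field_simp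
      ring
    refine (eq_inf_of_le_of_finrank hV ?_ hsc htc (by rintro rfl; exact ht hs) ?_ ?_).symm
    · refine finrank_span_singleton fun h0 => ?_
      have h00 : ∑ i, (D i + y * v i) • b i = ∑ i, (0 : Fin 3 → K) i • b i := by
        simpa using h0
      have := congrFun (hcoord _ _ h00) 0
      simp [v, hD0] at this
    · rw [Submodule.span_singleton_le_iff_mem, mem_iff_sum_defCoeff b hsc, ← hyeq, slope]
      simp only [Fin.sum_univ_three, v, Matrix.cons_val_zero, Matrix.cons_val_one,
        Matrix.cons_val]
      ring
    · rw [Submodule.span_singleton_le_iff_mem, mem_iff_sum_defCoeff b htc, ← hD]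
      simp only [Fin.sum_univ_three, v, Matrix.cons_val_zero, Matrix.cons_val_one,
        Matrix.cons_val]
      ring
  have hPH : ∀ y, P y ∉ H := by
    intro y h
    rw [hb] at h
    simp [v, hD0] at h
  have hpar : ∀ s ∈ T, slope (defCoeff b) t s = 0 → s ⊓ t ≤ H := by
    rintro s hs hsl x ⟨hxs, hxt⟩
    have hsc := hT s (Finset.mem_insert_of_mem hs)
    rw [← b.sum_repr x] at hxs hxt ⊢
    change _ ∈ s at hxs
    change _ ∈ t at hxt
    rw [mem_iff_sum_defCoeff b hsc, Fin.sum_univ_three] at hxs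
    rw [mem_iff_sum_defCoeff b htc, Fin.sum_univ_three] at hxt
    rw [hb]
    obtain ⟨r, h1, h2⟩ := exists_smul_of_slope_eq_zero htail hsl
    have h0 : (defCoeff b s 0 - r * defCoeff b t 0) * b.repr x 0 = 0 := by
      rw [h1, h2] at hxs
      linear_combination hxs - r * hxt
    refine (mul_eq_zero.1 h0).resolve_left fun h => ?_
    refine defCoeff_ne_smul (b := b) htc hsc (by rintro rfl; exact ht hs) r ?_
    funext i
    fin_cases i
    · exact sub_eq_zero.1 h
    · exact h1
    · exact h2
  rw [← Finset.card_image_of_injective _ hinj]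
  congr 1
  ext X
  simp only [Finset.mem_image, Finset.mem_filter, mem_affineFlats]
  constructor
  · rintro ⟨y, hy, rfl⟩
    obtain ⟨s, hs, rfl⟩ := Finset.mem_image.1 hy
    obtain ⟨hsT, hsl⟩ := Finset.mem_filter.1 hs
    rw [← hmeet s hsT hsl]
    refine ⟨⟨⟨s, Finset.mem_insert_of_mem hsT, t, Finset.mem_insert_self t T, ?_, rfl⟩, ?_⟩,
      inf_le_right⟩
    · rintro rfl
      exact ht hsT
    · rw [hmeet s hsT hsl, Submodule.span_singleton_le_iff_mem]
      exact hPH _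
  · rintro ⟨hX, hXt⟩
    have hX1 := finrank_of_mem_affineFlats hV hT ((mem_affineFlats H).2 hX)
    obtain ⟨⟨s, h1, s', h2, h3, rfl⟩, hXH⟩ := hX
    have key : ∃ u ∈ T, s ⊓ s' = u ⊓ t := by
      by_cases hs : s = t
      · have hs' : s' ≠ t := fun h => h3 (hs.trans h.symm)
        refine ⟨s', (Finset.mem_insert.1 h2).resolve_left hs', ?_⟩
        exact eq_inf_of_le_of_finrank hV hX1 (hT s' h2) htc hs' inf_le_right hXt
      · refine ⟨s, (Finset.mem_insert.1 h1).resolve_left hs, ?_⟩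
        exact eq_inf_of_le_of_finrank hV hX1 (hT s h1) htc hs inf_le_left hXt
    obtain ⟨u, hu, hX⟩ := key
    have hsl : slope (defCoeff b) t u ≠ 0 := fun h => hXH (hX ▸ hpar u hu h)
    exact ⟨_, Finset.mem_image_of_mem _ (Finset.mem_filter.2 ⟨hu, hsl⟩), by
      rw [hX, hmeet u hu hsl]⟩

include hH hb in
/-- The Hilbert function of `lineForms` in degrees at least the number of lines. -/
theorem finrank_lineForms {T : Finset (Submodule K V)}
    (hT : ∀ s ∈ T, Module.finrank K (V ⧸ s) = 1) (hTH : ∀ s ∈ T, s ≠ H) {e : ℕ}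
    (he : T.card ≤ e) :
    2 * (Module.finrank K ((lineForms (defCoeff b) T).restrictScalars K ⊓
        homVec K (Fin 3) (Fin 2) e : Submodule K (Fin 2 → MvPolynomial (Fin 3) K)) : ℤ)
      = 2 * (e + 1) * (e + 2) - 2 * T.card * (e + 1) + T.card * (T.card - 1)
        - 2 * affineCount H T := by
  classical
  have hfin : Module.Finite K V := Module.Finite.of_basis b
  have hV : Module.finrank K V = 3 := by rw [Module.finrank_eq_card_basis b, Fintype.card_fin]
  induction T using Finset.induction_on with
  | empty =>
    have h0 : (lineForms (defCoeff b) ∅).restrictScalars K ⊓ homVec K (Fin 3) (Fin 2) e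
        = Submodule.pi Set.univ fun _ => homogeneousSubmodule (Fin 3) K e :=
      inf_eq_right.2 fun g _ s hs => absurd hs (Finset.notMem_empty s)
    have h1 := finrank_homogeneousSubmodule_three (K := K) e
    rw [h0, finrank_submodulePi, Fin.sum_univ_two]
    have h2 : affineCount H (∅ : Finset (Submodule K V)) = 0 := by
      simp [affineCount, affineFlats]
    rw [h2]
    zify at h1
    push_cast
    rw [Finset.card_empty]
    push_cast
    linear_combination 2 * h1
  | insert t T ht ih =>
    rw [Finset.card_insert_of_notMem ht] at he ⊢
    have htc := hT t (Finset.mem_insert_self t T)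
    have htail := defCoeff_tail hH hb htc (hTH t (Finset.mem_insert_self t T))
    obtain ⟨D, hD0, hD⟩ := exists_affine_point htail
    have hT' : ∀ s ∈ T, Module.finrank K (V ⧸ s) = 1 := fun s hs =>
      hT s (Finset.mem_insert_of_mem hs)
    have hTH' : ∀ s ∈ T, s ≠ H := fun s hs => hTH s (Finset.mem_insert_of_mem hs)
    have ih' := ih hT' hTH' (by omega)
    have hdel := finrank_lineForms_insert (a := defCoeff b) hD0 hD
      (fun s hs => defCoeff_tail hH hb (hT' s hs) (hTH' s hs)) htail
      (fun s hs s' hs' hne r => defCoeff_ne_smul (hT' s hs) (hT' s' hs') hne r)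
      (fun s hs r => defCoeff_ne_smul htc (hT' s hs) (by rintro rfl; exact ht hs) r)
      (T := T) (e := e) (by omega)
    -- The number of intersection points on `t` governs both the growth of `affineCount` and the
    -- drop of the Hilbert function.
    rw [affineCount_insert hV hT ht, ← card_slopePoints hH hb hT hTH ht hD0 hD]
    obtain ⟨f, rfl⟩ := Nat.exists_eq_add_of_le he
    rw [show T.card + 1 + f - T.card = f + 1 by omega] at hdel
    zify at hdel
    rw [hdel] at ih'
    push_cast at ih' ⊢
    linear_combination ih'

end HilbertFunction


/-! ### The reduced characteristic polynomial at zero -/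

section CharPoly

variable {K V : Type*} [Field K] [AddCommGroup V] [Module K V] (A : Arrangement K V)

theorem Arrangement.top_mem_flats : ⊤ ∈ A.flats := by
  classical
  exact Finset.mem_image.2 ⟨∅, by simp, by simp⟩

theorem Arrangement.mem_flats_of_mem {s : Submodule K V} (hs : s ∈ A.hyperplanes) :
    s ∈ A.flats := by
  classical
  exact Finset.mem_image.2 ⟨{s}, by simpa using hs, by simp⟩

theorem Arrangement.inf_mem_flats {s s' : Submodule K V} (hs : s ∈ A.hyperplanes)
    (hs' : s' ∈ A.hyperplanes) : s ⊓ s' ∈ A.flats := by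
  classical
  refine Finset.mem_image.2 ⟨{s, s'}, ?_, by simp⟩
  rw [Finset.mem_powerset, Finset.insert_subset_iff, Finset.singleton_subset_iff]
  exact ⟨hs, hs'⟩

theorem Arrangement.eq_or_le_inf_of_mem_flats {X : Submodule K V} (hX : X ∈ A.flats) :
    X = ⊤ ∨ X ∈ A.hyperplanes ∨
      ∃ s ∈ A.hyperplanes, ∃ s' ∈ A.hyperplanes, s ≠ s' ∧ X ≤ s ⊓ s' := by
  classical
  obtain ⟨S, hS, rfl⟩ := Finset.mem_image.1 hX
  rw [Finset.mem_powerset] at hS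
  rcases S.eq_empty_or_nonempty with rfl | ⟨s, hs⟩
  · left; simp
  · right
    by_cases h : ∃ s' ∈ S, s ≠ s'
    · obtain ⟨s', hs', hne⟩ := h
      exact Or.inr ⟨s, hS hs, s', hS hs', hne,
        le_inf (Finset.inf_le (f := id) hs) (Finset.inf_le (f := id) hs')⟩
    · push Not at h
      left
      have : S = {s} := Finset.eq_singleton_iff_unique_mem.2 ⟨hs, fun x hx => (h x hx).symm⟩
      rw [this, Finset.inf_singleton]
      exact hS hs

theorem Arrangement.moebius_top : A.moebius ⊤ = 1 := by
  rw [Arrangement.moebius, if_pos rfl]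

open Classical in
theorem Arrangement.moebius_eq_neg_sum {X : Submodule K V} (hX : X ≠ ⊤) :
    A.moebius X = -∑ Y ∈ A.flats.filter (fun Y => X < Y), A.moebius Y := by
  rw [Arrangement.moebius, if_neg hX]
  congr 1
  exact Finset.sum_coe_sort (A.flats.filter (fun Y => X < Y)) A.moebius

theorem Arrangement.moebius_of_mem {s : Submodule K V} (hs : s ∈ A.hyperplanes) :
    A.moebius s = -1 := by
  classical
  have hco := isCoatom_of_finrank_quotient (A.codim_one s hs)
  have : A.flats.filter (fun Y => s < Y) = {⊤} := by
    ext Y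
    rw [Finset.mem_filter, Finset.mem_singleton]
    exact ⟨fun h => hco.2 Y h.2, fun h => h ▸ ⟨A.top_mem_flats, hco.lt_top⟩⟩
  rw [A.moebius_eq_neg_sum hco.1, this, Finset.sum_singleton, A.moebius_top]

variable [Module.Finite K V] (hV : Module.finrank K V = 3)

include hV

theorem Arrangement.exists_eq_inf_of_mem_flats {X : Submodule K V} (hX : X ∈ A.flats)
    (h1 : Module.finrank K X = 1) :
    ∃ s ∈ A.hyperplanes, ∃ s' ∈ A.hyperplanes, s ≠ s' ∧ s ⊓ s' = X := by
  rcases A.eq_or_le_inf_of_mem_flats hX with rfl | h | ⟨s, hs, s', hs', hne, hle⟩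
  · rw [finrank_top] at h1
    omega
  · have := finrank_add_one_of_finrank_quotient (A.codim_one X h)
    omega
  · exact ⟨s, hs, s', hs', hne, (eq_inf_of_le_of_finrank hV h1 (A.codim_one s hs)
      (A.codim_one s' hs') hne (hle.trans inf_le_left) (hle.trans inf_le_right)).symm⟩

open Classical in
-- The flats strictly containing `X` are `⊤`, of Möbius value 1, and the planes through `X`, each of
-- value -1.
theorem Arrangement.moebius_of_finrank_one {X : Submodule K V} (h1 : Module.finrank K X = 1) :
    A.moebius X = ((A.hyperplanes.filter fun s => X ≤ s).card : ℤ) - 1 := by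
  have hXtop : X ≠ ⊤ := by
    rintro rfl
    rw [finrank_top] at h1
    omega
  have hfil : A.flats.filter (fun Y => X < Y)
      = insert ⊤ (A.hyperplanes.filter fun s => X ≤ s) := by
    ext Y
    rw [Finset.mem_filter, Finset.mem_insert, Finset.mem_filter]
    constructor
    · rintro ⟨hY, hXY⟩
      rcases A.eq_or_le_inf_of_mem_flats hY with rfl | h | ⟨s, hs, s', hs', hne, hle⟩
      · exact Or.inl rfl
      · exact Or.inr ⟨h, hXY.le⟩
      · have := eq_inf_of_le_of_finrank hV h1 (A.codim_one s hs) (A.codim_one s' hs') hne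
          ((hXY.le.trans hle).trans inf_le_left) ((hXY.le.trans hle).trans inf_le_right)
        exact absurd (this ▸ hle) hXY.not_ge
    · rintro (rfl | ⟨h, hle⟩)
      · exact ⟨A.top_mem_flats, lt_top_iff_ne_top.2 hXtop⟩
      · refine ⟨A.mem_flats_of_mem h, lt_of_le_of_ne hle ?_⟩
        rintro rfl
        have := finrank_add_one_of_finrank_quotient (A.codim_one X h)
        omega
  rw [A.moebius_eq_neg_sum hXtop, hfil, Finset.sum_insert, A.moebius_top,
    Finset.sum_congr rfl fun s hs => A.moebius_of_mem (Finset.mem_filter.1 hs).1]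
  · rw [Finset.sum_const, smul_neg, nsmul_eq_mul, mul_one]
    ring
  · intro h
    exact A.ne_top (Finset.mem_filter.1 h).1 rfl

open Classical in
-- Since χ = (t - 1) χ₀, the value χ₀(0) is -χ(0), minus the Möbius value of the zero flat; by χ(1)
-- = 0 this is the sum of the Möbius values of all other flats. If the origin is not a flat, the
-- argument holds with an empty sum.
theorem Arrangement.reducedCharPoly_eval_zero {H : Submodule K V} (hH : H ∈ A.hyperplanes) :
    A.reducedCharPoly.eval 0 = 1 - A.hyperplanes.card
      + ∑ X ∈ A.flats.filter (fun X : Submodule K V => Module.finrank K X = 1),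
        (((A.hyperplanes.filter fun s => X ≤ s).card : ℤ) - 1) := by
  have hmul := A.mul_reducedCharPoly hH
  have e0 := congrArg (Polynomial.eval 0) hmul
  have e1 := congrArg (Polynomial.eval 1) hmul
  simp only [Polynomial.eval_mul, Polynomial.eval_sub, Polynomial.eval_X, Polynomial.eval_C,
    sub_self, zero_mul, Arrangement.charPoly, Polynomial.eval_finsetSum, Polynomial.eval_pow,
    one_pow, mul_one] at e0 e1
  have hz : ∑ X ∈ A.flats, A.moebius X * 0 ^ Module.finrank K X
      = ∑ X ∈ A.flats.filter (fun X : Submodule K V => Module.finrank K X = 0), A.moebius X := by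
    rw [Finset.sum_filter]
    refine Finset.sum_congr rfl fun X _ => ?_
    split_ifs with h
    · rw [h, pow_zero, mul_one]
    · rw [zero_pow h, mul_zero]
  rw [hz] at e0
  rw [← Finset.sum_filter_add_sum_filter_not A.flats (fun X : Submodule K V => Module.finrank K X = 0)] at e1
  have hset : A.flats.filter (fun X : Submodule K V => ¬ Module.finrank K X = 0)
      = insert ⊤ (A.hyperplanes ∪ A.flats.filter (fun X : Submodule K V => Module.finrank K X = 1)) := by
    ext X
    rw [Finset.mem_filter, Finset.mem_insert, Finset.mem_union, Finset.mem_filter]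
    constructor
    · rintro ⟨hX, h0⟩
      rcases A.eq_or_le_inf_of_mem_flats hX with rfl | h | ⟨s, hs, s', hs', hne, hle⟩
      · exact Or.inl rfl
      · exact Or.inr (Or.inl h)
      · have h1 := finrank_inf_add_two (A.codim_one s hs) (A.codim_one s' hs') hne
        have h2 := Submodule.finrank_mono hle
        exact Or.inr (Or.inr ⟨hX, by omega⟩)
    · rintro (rfl | h | ⟨h, h1⟩)
      · exact ⟨A.top_mem_flats, by rw [finrank_top]; omega⟩
      · have := finrank_add_one_of_finrank_quotient (A.codim_one X h)
        exact ⟨A.mem_flats_of_mem h, by omega⟩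
      · exact ⟨h, by omega⟩
  have hnot : ⊤ ∉ A.hyperplanes ∪ A.flats.filter (fun X : Submodule K V => Module.finrank K X = 1) := by
    rw [Finset.mem_union, Finset.mem_filter, finrank_top]
    rintro (h | ⟨-, h⟩)
    · exact A.ne_top h rfl
    · omega
  have hdisj : Disjoint A.hyperplanes (A.flats.filter (fun X : Submodule K V => Module.finrank K X = 1)) := by
    rw [Finset.disjoint_left]
    intro X hX hX'
    have := finrank_add_one_of_finrank_quotient (A.codim_one X hX)
    have := (Finset.mem_filter.1 hX').2
    omega
  rw [hset, Finset.sum_insert hnot, Finset.sum_union hdisj, A.moebius_top,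
    Finset.sum_congr (s₁ := A.hyperplanes) rfl fun s hs => A.moebius_of_mem hs,
    Finset.sum_congr (s₁ := A.flats.filter (fun X : Submodule K V => Module.finrank K X = 1)) rfl fun X hX =>
      A.moebius_of_finrank_one hV (Finset.mem_filter.1 hX).2] at e1
  simp only [Finset.sum_const, smul_neg, nsmul_eq_mul, mul_one] at e1
  linear_combination -e0 + e1

open Classical in
/-- The constant term of the reduced characteristic polynomial counts intersections outside `H`. -/
theorem Arrangement.reducedCharPoly_eval_zero_eq_affineCount {H : Submodule K V}
    (hH : H ∈ A.hyperplanes) :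
    A.reducedCharPoly.eval 0 = affineCount H (A.hyperplanes.erase H) := by
  set F := A.flats.filter (fun X : Submodule K V => Module.finrank K X = 1) with hF
  have hcard := Finset.card_erase_add_one hH
  -- Every plane other than `H` meets `H` in exactly one of these flats, so together they contribute
  -- the number of other planes and cancel the term `1 - card`.
  have hin : ∑ X ∈ F with X ≤ H, (((A.hyperplanes.filter fun s => X ≤ s).card : ℤ) - 1)
      = (A.hyperplanes.erase H).card := by
    have hmaps : Set.MapsTo (fun s => s ⊓ H) (A.hyperplanes.erase H : Set (Submodule K V))
        (F.filter fun X => X ≤ H : Finset (Submodule K V)) := by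
      intro s hs
      obtain ⟨hne, hs⟩ := Finset.mem_erase.1 hs
      have := finrank_inf_add_two (A.codim_one s hs) (A.codim_one H hH) hne
      refine Finset.mem_filter.2 ⟨Finset.mem_filter.2 ⟨A.inf_mem_flats hs hH, ?_⟩, inf_le_right⟩
      change Module.finrank K (s ⊓ H : Submodule K V) = 1
      omega
    rw [Finset.card_eq_sum_card_fiberwise hmaps]
    push_cast
    refine Finset.sum_congr rfl fun X hX => ?_
    obtain ⟨hXF, hXH⟩ := Finset.mem_filter.1 hX
    have hX1 := (Finset.mem_filter.1 hXF).2
    have : A.hyperplanes.filter (fun s => X ≤ s)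
        = insert H ((A.hyperplanes.erase H).filter fun s => s ⊓ H = X) := by
      ext s
      simp only [Finset.mem_filter, Finset.mem_insert, Finset.mem_erase]
      constructor
      · rintro ⟨hs, hle⟩
        by_cases h : s = H
        · exact Or.inl h
        · exact Or.inr ⟨⟨h, hs⟩, (eq_inf_of_le_of_finrank hV hX1 (A.codim_one s hs)
            (A.codim_one H hH) h hle hXH).symm⟩
      · rintro (rfl | ⟨⟨-, hs⟩, rfl⟩)
        · exact ⟨hH, hXH⟩
        · exact ⟨hs, inf_le_left⟩
    rw [this, Finset.card_insert_of_notMem (by simp)]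
    push_cast
    ring
  have hout : ∑ X ∈ F with ¬ X ≤ H, (((A.hyperplanes.filter fun s => X ≤ s).card : ℤ) - 1)
      = affineCount H (A.hyperplanes.erase H) := by
    have hset : F.filter (fun X => ¬ X ≤ H) = affineFlats H (A.hyperplanes.erase H) := by
      ext X
      rw [Finset.mem_filter, Finset.mem_filter, mem_affineFlats]
      refine and_congr_left fun hXH => ⟨?_, ?_⟩
      · rintro ⟨hX, h1⟩
        obtain ⟨s, hs, s', hs', hne, rfl⟩ := A.exists_eq_inf_of_mem_flats hV hX h1
        exact ⟨s, Finset.mem_erase.2 ⟨by rintro rfl; exact hXH inf_le_left, hs⟩, s',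
          Finset.mem_erase.2 ⟨by rintro rfl; exact hXH inf_le_right, hs'⟩, hne, rfl⟩
      · rintro ⟨s, hs, s', hs', hne, rfl⟩
        have hs := Finset.mem_of_mem_erase hs
        have hs' := Finset.mem_of_mem_erase hs'
        have := finrank_inf_add_two (A.codim_one s hs) (A.codim_one s' hs') hne
        exact ⟨A.inf_mem_flats hs hs', by omega⟩
    rw [hset, affineCount]
    push_cast
    refine Finset.sum_congr rfl fun X hX => ?_
    obtain ⟨⟨s, hs, s', hs', hne, rfl⟩, hXH⟩ := (mem_affineFlats H).1 hX
    have hfil : A.hyperplanes.filter (fun u => s ⊓ s' ≤ u)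
        = (A.hyperplanes.erase H).filter fun u => s ⊓ s' ≤ u := by
      ext u
      simp only [Finset.mem_filter, Finset.mem_erase]
      constructor
      · rintro ⟨hu, hle⟩
        exact ⟨⟨by rintro rfl; exact hXH hle, hu⟩, hle⟩
      · rintro ⟨⟨-, hu⟩, hle⟩
        exact ⟨hu, hle⟩
    have hpos : 1 ≤ ((A.hyperplanes.erase H).filter fun u => s ⊓ s' ≤ u).card :=
      Finset.card_pos.2 ⟨s, Finset.mem_filter.2 ⟨hs, inf_le_left⟩⟩
    rw [hfil, Nat.cast_sub hpos, Nat.cast_one]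
  rw [A.reducedCharPoly_eval_zero hV hH, ← hF,
    ← Finset.sum_filter_add_sum_filter_not F (fun X => X ≤ H), hin, hout, ← hcard]
  push_cast
  ring

end CharPoly

/-! ### Restriction of numerators to H -/

section RestrictedForms

variable {K κ : Type*} [Field K]

theorem homogeneousComponent_polyRestrict {n : ℕ} (s : ℕ) (f : MvPolynomial (Fin (n + 1)) K) :
    homogeneousComponent s (polyRestrict f) = polyRestrict (homogeneousComponent s f) := by
  refine homogeneousComponent_aeval _ (fun i => ?_) s f
  refine Fin.cases ?_ (fun i => ?_) i
  · exact isHomogeneous_zero _ _ _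
  · exact isHomogeneous_X _ _

theorem polyRestrict_X_zero {n : ℕ} :
    polyRestrict (X 0 : MvPolynomial (Fin (n + 1)) K) = 0 := by
  rw [polyRestrict, aeval_X, Fin.cons_zero]

theorem polyRestrict_X_succ {n : ℕ} (i : Fin n) :
    polyRestrict (X i.succ : MvPolynomial (Fin (n + 1)) K) = X i := by
  rw [polyRestrict, aeval_X, Fin.cons_succ]

theorem polyRestrict_C {n : ℕ} (r : K) :
    polyRestrict (C r : MvPolynomial (Fin (n + 1)) K) = C r := by
  rw [← algebraMap_eq, AlgHom.commutes, algebraMap_eq]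

theorem X_zero_dvd_iff {n : ℕ} {f : MvPolynomial (Fin (n + 1)) K} :
    X 0 ∣ f ↔ polyRestrict f = 0 := by
  constructor
  · rintro ⟨q, rfl⟩
    rw [map_mul, polyRestrict_X_zero, zero_mul]
  · intro h
    have := dvd_sub_algHom (X 0) ((rename Fin.succ).comp (polyRestrict (K := K) (n := n)))
      (fun i => ?_) f
    · rwa [AlgHom.comp_apply, h, map_zero, sub_zero] at this
    · refine Fin.cases ?_ (fun i => ?_) i
      · rw [AlgHom.comp_apply, polyRestrict_X_zero, map_zero, sub_zero]
      · rw [AlgHom.comp_apply, polyRestrict_X_succ, rename_X, sub_self]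
        exact dvd_zero _

/-- Restriction of vectors of polynomials to `z_0 = 0`. -/
noncomputable def vecRestrict (K : Type*) [Field K] (n : ℕ) :
    (Fin 2 → MvPolynomial (Fin (n + 1)) K) →ₗ[K] (Fin 2 → MvPolynomial (Fin n) K) :=
  (polyRestrict (K := K) (n := n)).toLinearMap.compLeft (Fin 2)

theorem vecRestrict_apply {n : ℕ} (g : Fin 2 → MvPolynomial (Fin (n + 1)) K) (i : Fin 2) :
    vecRestrict K n g i = polyRestrict (g i) := rfl

theorem vecComponent_vecRestrict {n : ℕ} (s : ℕ) (g : Fin 2 → MvPolynomial (Fin (n + 1)) K) :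
    vecComponent K (Fin n) (Fin 2) s (vecRestrict K n g)
      = vecRestrict K n (vecComponent K (Fin (n + 1)) (Fin 2) s g) :=
  funext fun i => homogeneousComponent_polyRestrict s (g i)

variable (a : κ → Fin 3 → K) (T : Finset κ)

/-- The restrictions to `z_0 = 0` of the members of `lineForms`. -/
noncomputable def restrictedForms : Submodule K (Fin 2 → MvPolynomial (Fin 2) K) :=
  ((lineForms a T).restrictScalars K).map (vecRestrict K 2)

theorem isGraded_restrictedForms : IsGraded (restrictedForms a T) := by
  rintro _ ⟨g, hg, rfl⟩ s
  rw [vecComponent_vecRestrict]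
  exact ⟨_, isGraded_lineForms a T g hg s, rfl⟩

theorem map_vecRestrict_inf_homVec (s : ℕ) :
    ((lineForms a T).restrictScalars K ⊓ homVec K (Fin 3) (Fin 2) s).map (vecRestrict K 2)
      = restrictedForms a T ⊓ homVec K (Fin 2) (Fin 2) s := by
  apply le_antisymm
  · rintro _ ⟨g, ⟨hg, hs⟩, rfl⟩
    refine ⟨⟨g, hg, rfl⟩, ?_⟩
    have := vecComponent_vecRestrict s g
    rw [vecComponent_of_mem hs, if_pos rfl] at this
    rw [← this]
    exact vecComponent_mem_homVec _ _
  · rintro _ ⟨⟨g, hg, rfl⟩, hs⟩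
    refine ⟨_, ⟨isGraded_lineForms a T g hg s, vecComponent_mem_homVec s g⟩, ?_⟩
    rw [← vecComponent_vecRestrict, vecComponent_of_mem hs, if_pos rfl]

/-- Multiplication of vectors of polynomials by `z_0`. -/
noncomputable def mulXZero (K : Type*) [Field K] :
    (Fin 2 → MvPolynomial (Fin 3) K) →ₗ[K] (Fin 2 → MvPolynomial (Fin 3) K) :=
  (LinearMap.mulLeft K (X 0)).compLeft (Fin 2)

theorem mulXZero_apply (g : Fin 2 → MvPolynomial (Fin 3) K) (i : Fin 2) :
    mulXZero K g i = X 0 * g i := rfl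

theorem mulXZero_injective : Function.Injective (mulXZero K) := by
  intro g h hgh
  funext i
  have := congrFun hgh i
  rw [mulXZero_apply, mulXZero_apply] at this
  exact mul_left_cancel₀ (X_ne_zero 0) this

theorem mem_ker_vecRestrict {g : Fin 2 → MvPolynomial (Fin 3) K} :
    g ∈ LinearMap.ker (vecRestrict K 2) ↔ ∃ q, mulXZero K q = g := by
  rw [LinearMap.mem_ker]
  constructor
  · intro h
    choose q hq using fun i => X_zero_dvd_iff.2 (congrFun h i)
    exact ⟨q, funext fun i => (hq i).symm⟩
  · rintro ⟨q, rfl⟩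
    funext i
    rw [vecRestrict_apply, mulXZero_apply, map_mul, polyRestrict_X_zero, zero_mul]
    rfl

variable {a T}

/-- No form of `T` is proportional to z_0, so the prime `lin (a t)` never divides the factor `X 0`.
Hence the members killed by restriction are z_0 times members. -/
theorem mulXZero_mem_lineForms_iff (htail : ∀ s ∈ T, a s 1 ≠ 0 ∨ a s 2 ≠ 0)
    {g : Fin 2 → MvPolynomial (Fin 3) K} : mulXZero K g ∈ lineForms a T ↔ g ∈ lineForms a T := by
  rw [mem_lineForms, mem_lineForms]
  refine forall₂_congr fun t ht => ?_
  have e : C (a t 1) * mulXZero K g 1 - C (a t 2) * mulXZero K g 0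
      = X 0 * (C (a t 1) * g 1 - C (a t 2) * g 0) := by
    simp only [mulXZero_apply]
    ring
  rw [e]
  refine ⟨fun h => ?_, fun h => h.mul_left _⟩
  have ha : a t ≠ 0 := by
    intro h0
    rcases htail t ht with h | h <;> exact h (by rw [h0]; rfl)
  refine ((prime_lin ha).dvd_mul.1 h).resolve_left fun hX => ?_
  have hX' : (X 0 : MvPolynomial (Fin 3) K) = lin ![1, 0, 0] := by simp [lin_three]
  rw [hX'] at hX
  obtain ⟨r, hr⟩ := lin_dvd_lin ha hX
  have h0 := congrFun hr 0
  have h1 := congrFun hr 1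
  have h2 := congrFun hr 2
  simp only [Matrix.cons_val_zero, Matrix.cons_val_one, Matrix.cons_val, Pi.smul_apply,
    smul_eq_mul] at h0 h1 h2
  have hr0 : r ≠ 0 := by
    rintro rfl
    simp at h0
  rcases htail t ht with h | h
  · exact h ((mul_eq_zero.1 h1.symm).resolve_left hr0)
  · exact h ((mul_eq_zero.1 h2.symm).resolve_left hr0)

theorem lineForms_inf_ker_vecRestrict_zero :
    (lineForms a T).restrictScalars K ⊓ homVec K (Fin 3) (Fin 2) 0 ⊓
      LinearMap.ker (vecRestrict K 2) = ⊥ := by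
  rw [eq_bot_iff]
  rintro g ⟨⟨-, hs⟩, hk⟩
  obtain ⟨q, rfl⟩ := mem_ker_vecRestrict.1 hk
  refine (Submodule.mem_bot K).2 (funext fun i => ?_)
  have h := mem_homVec.1 hs i
  rw [mulXZero_apply, mul_comm] at h ⊢
  exact IsHomogeneous.eq_zero_of_mul_right (isHomogeneous_X K 0) h Nat.zero_lt_one

theorem lineForms_inf_ker_vecRestrict_succ (htail : ∀ s ∈ T, a s 1 ≠ 0 ∨ a s 2 ≠ 0) (s : ℕ) :
    (lineForms a T).restrictScalars K ⊓ homVec K (Fin 3) (Fin 2) (s + 1) ⊓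
      LinearMap.ker (vecRestrict K 2)
      = ((lineForms a T).restrictScalars K ⊓ homVec K (Fin 3) (Fin 2) s).map (mulXZero K) := by
  apply le_antisymm
  · rintro g ⟨⟨hg, hs⟩, hk⟩
    obtain ⟨q, rfl⟩ := mem_ker_vecRestrict.1 hk
    refine ⟨q, ⟨(mulXZero_mem_lineForms_iff htail).1 hg, mem_homVec.2 fun i => ?_⟩, rfl⟩
    have h := mem_homVec.1 hs i
    rw [mulXZero_apply, mul_comm] at h
    exact IsHomogeneous.of_mul_right (isHomogeneous_X K 0) (X_ne_zero 0) h
  · rintro _ ⟨q, ⟨hq, hs⟩, rfl⟩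
    refine ⟨⟨(mulXZero_mem_lineForms_iff htail).2 hq, mem_homVec.2 fun i => ?_⟩,
      mem_ker_vecRestrict.2 ⟨q, rfl⟩⟩
    rw [mulXZero_apply, mul_comm]
    exact (mem_homVec.1 hs i).mul (isHomogeneous_X K 0)

/-- The restricted forms of degree at most `N` are as many as the forms of degree `N`. -/
theorem finrank_restrictedForms (htail : ∀ s ∈ T, a s 1 ≠ 0 ∨ a s 2 ≠ 0) (N : ℕ) :
    Module.finrank K (restrictedForms a T ⊓ ltVec K (Fin 2) (Fin 2) (N + 1) :
        Submodule K (Fin 2 → MvPolynomial (Fin 2) K))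
      = Module.finrank K ((lineForms a T).restrictScalars K ⊓ homVec K (Fin 3) (Fin 2) N :
        Submodule K (Fin 2 → MvPolynomial (Fin 3) K)) := by
  -- The kernel of restriction in degree `N + 1` is a copy of degree `N`, so the restricted forms of
  -- degree `N + 1` have as dimension the increment of the Hilbert function, and the sum telescopes.
  -- In degree 0 the kernel is zero.
  induction N with
  | zero =>
    rw [(isGraded_restrictedForms a T).finrank_inf_ltVec_succ, finrank_inf_ltVec_zero, zero_add,
      ← map_vecRestrict_inf_homVec, ← finrank_map_add_finrank_inf_ker (vecRestrict K 2)
        ((lineForms a T).restrictScalars K ⊓ homVec K (Fin 3) (Fin 2) 0),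
      lineForms_inf_ker_vecRestrict_zero, finrank_bot, add_zero]
  | succ N ih =>
    rw [(isGraded_restrictedForms a T).finrank_inf_ltVec_succ, ih, ← map_vecRestrict_inf_homVec,
      ← finrank_map_add_finrank_inf_ker (vecRestrict K 2)
        ((lineForms a T).restrictScalars K ⊓ homVec K (Fin 3) (Fin 2) (N + 1)),
      lineForms_inf_ker_vecRestrict_succ htail, finrank_map_of_injective mulXZero_injective,
      add_comm]

end RestrictedForms

/-! ### Comparison of the two Hilbert functions -/

section Numerics

variable {K κ κ' : Type*} [Field K] {a : κ → Fin 3 → K} {T : Finset κ}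
  {B : Finset κ'} {c : κ' → Fin 2 → K} {k : κ' → ℕ}

/-- The codimension of the restricted forms, from the Hilbert functions. -/
theorem finrank_quotient_restrictedForms (htail : ∀ s ∈ T, a s 1 ≠ 0 ∨ a s 2 ≠ 0)
    (hle : restrictedForms a T ≤ (planeForms B c k).restrictScalars K)
    (hc : ∀ X ∈ B, c X ≠ 0) (hB : ∀ X ∈ B, ∀ Y ∈ B, X ≠ Y → ∀ r : K, c Y ≠ r • c X)
    (hcard : ∑ X ∈ B, k X = T.card) {β : ℕ}
    (hdim : ∀ e, T.card ≤ e → 2 * (Module.finrank K ((lineForms a T).restrictScalars K ⊓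
        homVec K (Fin 3) (Fin 2) e : Submodule K (Fin 2 → MvPolynomial (Fin 3) K)) : ℤ)
      = 2 * (e + 1) * (e + 2) - 2 * T.card * (e + 1) + T.card * (T.card - 1) - 2 * β)
    (θ : Module.Basis (Fin 2) (MvPolynomial (Fin 2) K) (planeForms B c k)) {d : Fin 2 → ℕ}
    (hθ : ∀ i, (θ i).1 ∈ homVec K (Fin 2) (Fin 2) (d i)) :
    Module.Finite K ((planeForms B c k).restrictScalars K ⧸
      (restrictedForms a T).submoduleOf ((planeForms B c k).restrictScalars K)) ∧
    (Module.finrank K ((planeForms B c k).restrictScalars K ⧸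
      (restrictedForms a T).submoduleOf ((planeForms B c k).restrictScalars K)) : ℤ)
      = β - d 0 * d 1 := by
  set m := T.card with hm
  let w : ℕ → ℕ := fun N => Module.finrank K ((planeForms B c k).restrictScalars K ⊓
    ltVec K (Fin 2) (Fin 2) N : Submodule K (Fin 2 → MvPolynomial (Fin 2) K))
  let r : ℕ → ℕ := fun N => Module.finrank K (restrictedForms a T ⊓
    ltVec K (Fin 2) (Fin 2) N : Submodule K (Fin 2 → MvPolynomial (Fin 2) K))
  have hrw : ∀ N, r N ≤ w N := fun N => Submodule.finrank_mono (inf_le_inf_right _ hle)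
  have hw : ∀ N, d 0 ≤ N → d 1 ≤ N → 2 * (w N : ℤ)
      = (N - d 0) * (N - d 0 + 1) + (N - d 1) * (N - d 1 + 1) := by
    intro N h0 h1
    have := two_mul_finrank_planeForms θ hθ N
    zify [h0, h1] at this
    exact this
  -- Restricted forms of degree less than `N` are counted by the Hilbert function in degree `N - 1`,
  -- whose formula requires `m ≤ N - 1`.
  have hr : ∀ N : ℕ, m + 1 ≤ N →
      2 * (r N : ℤ) = 2 * N * (N + 1) - 2 * m * N + m * (m - 1) - 2 * β := by
    intro N hN
    obtain ⟨e, rfl⟩ := Nat.exists_eq_add_of_le hN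
    have h1 := hdim (m + e) (Nat.le_add_right m e)
    rw [← finrank_restrictedForms htail] at h1
    have h2 : r (m + 1 + e) = Module.finrank K (restrictedForms a T ⊓
        ltVec K (Fin 2) (Fin 2) (m + e + 1) : Submodule K (Fin 2 → MvPolynomial (Fin 2) K)) := by
      rw [show m + e + 1 = m + 1 + e by ring]
    rw [h2, h1]
    push_cast
    ring
  have hm1 : m ≤ d 0 + d 1 := hcard ▸ sum_mult_le_of_basis_planeForms θ hθ hc hB
  -- If `d 0 + d 1 > m`, the linear term of `w N - r N` has negative coefficient `m - d 0 - d 1`;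
  -- the chosen `N` is large enough for it to outweigh the constant term, contradicting `r N ≤ w N`.
  have hm2 : d 0 + d 1 ≤ m := by
    by_contra! hlt
    set N : ℕ := m + 1 + d 0 + d 1 + d 0 ^ 2 + d 1 ^ 2 + 2 * β + m with hN
    have h1 := hw N (by omega) (by omega)
    have h2 := hr N (by omega)
    have h3 : (r N : ℤ) ≤ w N := by exact_mod_cast hrw N
    have h4 : (m : ℤ) + 1 ≤ d 0 + d 1 := by exact_mod_cast hlt
    have h5 : (N : ℤ) * (m + 1) ≤ N * (d 0 + d 1) := by gcongr
    have h6 : (N : ℤ) = m + 1 + d 0 + d 1 + d 0 ^ 2 + d 1 ^ 2 + 2 * β + m := by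
      rw [hN]; push_cast; ring
    have h7 : (0 : ℤ) ≤ m := Int.natCast_nonneg m
    have h8 : (0 : ℤ) ≤ β := Int.natCast_nonneg β
    have h9 : (0 : ℤ) ≤ d 0 := Int.natCast_nonneg _
    have h10 : (0 : ℤ) ≤ d 1 := Int.natCast_nonneg _
    nlinarith [sq_nonneg (m : ℤ), sq_nonneg (d 0 : ℤ), sq_nonneg (d 1 : ℤ)]
  have hmd : (m : ℤ) = d 0 + d 1 := by exact_mod_cast le_antisymm hm1 hm2
  set N := m + 1 + d 0 + d 1 with hN
  -- With `m = d 0 + d 1` only the constant terms differ. A constant difference makes the graded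
  -- pieces agree in all large degrees, which is `hslice`.
  have hdiff : ∀ s, N ≤ s → (w s : ℤ) - r s = β - d 0 * d 1 := by
    intro s hs
    have h1 := hw s (by omega) (by omega)
    have h2 := hr s (by omega)
    rw [hmd] at h2
    have : 2 * ((w s : ℤ) - r s) = 2 * (β - d 0 * d 1) := by linear_combination h1 - h2
    linarith
  have hslice : ∀ s, N ≤ s →
      Module.finrank K (restrictedForms a T ⊓ homVec K (Fin 2) (Fin 2) s :
        Submodule K (Fin 2 → MvPolynomial (Fin 2) K))
      = Module.finrank K ((planeForms B c k).restrictScalars K ⊓ homVec K (Fin 2) (Fin 2) s :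
        Submodule K (Fin 2 → MvPolynomial (Fin 2) K)) := by
    intro s hs
    have h1 : w (s + 1) = w s + _ :=
      (isGraded_planeForms (B := B) (c := c) (k := k)).finrank_inf_ltVec_succ s
    have h2 : r (s + 1) = r s + _ := (isGraded_restrictedForms a T).finrank_inf_ltVec_succ s
    have h3 := hdiff s hs
    have h4 := hdiff (s + 1) (by omega)
    omega
  obtain ⟨hfin, hq⟩ := finrank_quotient_of_isGraded isGraded_planeForms hle N hslice
  refine ⟨hfin, ?_⟩
  rw [← hdiff N le_rfl, eq_sub_iff_add_eq]
  exact_mod_cast hq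

end Numerics

/-! ### The restricted multiarrangement and its defining polynomial -/

section RestrictionOfLines

variable {K V : Type*} [Field K] [AddCommGroup V] [Module K V] (A : Arrangement K V)
  {H : Submodule K V} (hH : H ∈ A.hyperplanes)

open Classical in
theorem Arrangement.mem_restriction {X : Submodule K H} :
    X ∈ (A.restriction H hH).hyperplanes ↔
      ∃ s ∈ A.hyperplanes.erase H, s.submoduleOf H = X := by
  simp only [Arrangement.restriction, Finset.mem_image]

open Classical in
-- The trace of `H` on itself is `⊤`, which is not of codimension one, so leaving out `H` does not
-- change the count.
theorem Arrangement.mult_restriction {X : Submodule K H}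
    (hX : X ∈ (A.restriction H hH).hyperplanes) :
    (A.restriction H hH).mult X
      = ((A.hyperplanes.erase H).filter fun s => s.submoduleOf H = X).card := by
  have hX1 := (A.restriction H hH).codim_one X hX
  have : A.hyperplanes.filter (fun s => s.submoduleOf H = X)
      = (A.hyperplanes.erase H).filter fun s => s.submoduleOf H = X := by
    ext s
    simp only [Finset.mem_filter, Finset.mem_erase]
    refine ⟨fun h => ⟨⟨?_, h.1⟩, h.2⟩, fun h => ⟨h.1.2, h.2⟩⟩
    rintro rfl
    apply (isCoatom_of_finrank_quotient hX1).1
    rw [← h.2]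
    exact Submodule.submoduleOf_self s
  rw [← this]
  rfl

open Classical in
theorem Arrangement.sum_mult_restriction :
    ∑ X ∈ (A.restriction H hH).hyperplanes, (A.restriction H hH).mult X
      = (A.hyperplanes.erase H).card := by
  rw [Finset.sum_congr rfl fun X hX => A.mult_restriction hH hX]
  exact (Finset.card_eq_sum_card_fiberwise (f := fun s => s.submoduleOf H)
    fun s hs => (A.mem_restriction hH).2 ⟨s, hs, rfl⟩).symm

variable {n : ℕ} {b : Module.Basis (Fin (n + 1)) K V} {bH : Module.Basis (Fin n) K H}
  (hb : ∀ i, (bH i : V) = b i.succ)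

include hH hb

open Classical in
-- The form of `s`, restricted to `H`, vanishes on the kernel of the form chosen for the trace of
-- `s`, so the two are proportional; the factor is nonzero because `s ≠ H`. Defining forms being
-- arbitrary choices, such constants persist below.
theorem Arrangement.exists_defCoeff_eq {s : Submodule K V} (hs : s ∈ A.hyperplanes.erase H) :
    ∃ r : K, r ≠ 0 ∧ ∀ i, defCoeff b s i.succ = r * defCoeff bH (s.submoduleOf H) i := by
  obtain ⟨hne, hsA⟩ := Finset.mem_erase.1 hs
  have hsc := A.codim_one s hsA
  have hX1 := (A.restriction H hH).codim_one _ ((A.mem_restriction hH).2 ⟨s, hs, rfl⟩)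
  have hker : ⨅ _ : Unit, LinearMap.ker (defForm (s.submoduleOf H))
      ≤ LinearMap.ker (defForm s ∘ₗ H.subtype) := by
    rw [ciInf_const, ker_defForm hX1, LinearMap.ker_comp, ker_defForm hsc]
    exact le_rfl
  obtain ⟨r, hr⟩ := (Submodule.mem_span_range_iff_exists_fun K).1 (mem_span_of_iInf_ker_le_ker hker)
  rw [Fintype.sum_unique] at hr
  refine ⟨r default, fun h0 => ?_, fun i => ?_⟩
  · rw [h0, zero_smul] at hr
    refine hne (eq_of_le_of_finrank_quotient (A.codim_one H hH) hsc fun x hx => ?_).symm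
    rw [← ker_defForm hsc, LinearMap.mem_ker]
    exact (LinearMap.congr_fun hr ⟨x, hx⟩).symm
  · have := LinearMap.congr_fun hr (bH i)
    rw [defCoeff, ← hb]
    exact this.symm

open Classical in
theorem Arrangement.exists_polyRestrict_prod {X : Submodule K H} {U : Finset (Submodule K V)}
    (hU : U ⊆ A.hyperplanes.erase H) (hX : ∀ s ∈ U, s.submoduleOf H = X) :
    ∃ u : K, u ≠ 0 ∧ polyRestrict (∏ s ∈ U, lin (defCoeff b s))
      = C u * lin (defCoeff bH X) ^ U.card := by
  have key : ∀ s : U, ∃ r : K, r ≠ 0 ∧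
      polyRestrict (lin (defCoeff b s.1)) = C r * lin (defCoeff bH X) := by
    rintro ⟨s, hs⟩
    obtain ⟨r, hr, h⟩ := A.exists_defCoeff_eq hH hb (hU hs)
    refine ⟨r, hr, ?_⟩
    have h1 := polyRestrict_linPoly b bH hb (defForm s)
    rw [linPoly_eq_lin, linPoly_eq_lin] at h1
    refine h1.trans ?_
    rw [← lin_smul]
    congr 1
    funext i
    rw [Pi.smul_apply, smul_eq_mul, ← hX s hs, ← h i, defCoeff, ← hb]
    rfl
  choose r hr hr' using key
  refine ⟨∏ s, r s, Finset.prod_ne_zero_iff.2 fun s _ => hr s, ?_⟩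
  rw [← Finset.prod_coe_sort, map_prod, Finset.prod_congr rfl fun s _ => hr' s,
    Finset.prod_mul_distrib, map_prod, Finset.prod_const, Finset.card_univ, Fintype.card_coe]

open Classical in
theorem Arrangement.exists_polyRestrict_prod_erase :
    ∃ u : K, u ≠ 0 ∧ polyRestrict (∏ s ∈ A.hyperplanes.erase H, lin (defCoeff b s))
      = C u * (A.restriction H hH).Q bH := by
  have key : ∀ X ∈ (A.restriction H hH).hyperplanes, ∃ u : K, u ≠ 0 ∧ polyRestrict
      (∏ s ∈ A.hyperplanes.erase H with s.submoduleOf H = X, lin (defCoeff b s))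
      = C u * lin (defCoeff bH X) ^ (A.restriction H hH).mult X := by
    intro X hX
    rw [A.mult_restriction hH hX]
    exact A.exists_polyRestrict_prod hH hb (Finset.filter_subset _ _)
      fun s hs => (Finset.mem_filter.1 hs).2
  choose! u hu hu' using key
  have hQ : (A.restriction H hH).Q bH = ∏ X ∈ (A.restriction H hH).hyperplanes,
      lin (defCoeff bH X) ^ (A.restriction H hH).mult X := rfl
  have hfib := Finset.prod_fiberwise_of_maps_to (t := (A.restriction H hH).hyperplanes)
    (g := fun s => s.submoduleOf H) (fun s hs => (A.mem_restriction hH).2 ⟨s, hs, rfl⟩)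
    fun s => lin (defCoeff b s)
  refine ⟨∏ X ∈ (A.restriction H hH).hyperplanes, u X, Finset.prod_ne_zero_iff.2 hu, ?_⟩
  rw [← hfib, map_prod, Finset.prod_congr rfl hu', Finset.prod_mul_distrib, hQ, map_prod]

end RestrictionOfLines

/-! ### The codimension of the restricted numerators -/

section RestrictedForms

variable {K V : Type*} [Field K] [AddCommGroup V] [Module K V] (A : Arrangement K V)
  {H : Submodule K V} (hH : H ∈ A.hyperplanes)
  {b : Module.Basis (Fin 3) K V} {bH : Module.Basis (Fin 2) K H}
  (hb : ∀ i, (bH i : V) = b i.succ)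

include hH hb

theorem Arrangement.sum_smul_basis_mem_iff (x : Fin 3 → K) :
    ∑ i, x i • b i ∈ H ↔ x 0 = 0 := by
  have hc := A.codim_one H hH
  have h1 : defCoeff b H 1 = 0 := by
    rw [defCoeff, ← LinearMap.mem_ker, ker_defForm hc]
    exact hb 0 ▸ (bH 0).2
  have h2 : defCoeff b H 2 = 0 := by
    rw [defCoeff, ← LinearMap.mem_ker, ker_defForm hc]
    exact hb 1 ▸ (bH 1).2
  have h0 : defCoeff b H 0 ≠ 0 := by
    intro h0
    apply defCoeff_ne_zero b hc
    funext i
    fin_cases i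
    · exact h0
    · exact h1
    · exact h2
  rw [mem_iff_sum_defCoeff b hc, Fin.sum_univ_three, h1, h2]
  simp [h0]

open Classical in
-- Planes with the same trace `X` on `H` have proportional dz_1, dz_2 coefficients, so a single
-- contraction is divisible by all of their coprime forms. On `H` the product of these becomes a
-- unit times the power of the form of `X` prescribed by the multiplicity.
theorem Arrangement.restrictedForms_le_planeForms :
    restrictedForms (defCoeff b) (A.hyperplanes.erase H) ≤
      (planeForms (A.restriction H hH).hyperplanes (defCoeff bH)
        (A.restriction H hH).mult).restrictScalars K := by
  rintro _ ⟨g, hg, rfl⟩ X hX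
  set U := (A.hyperplanes.erase H).filter fun s => s.submoduleOf H = X
  have hUsub : U ⊆ A.hyperplanes.erase H := Finset.filter_subset _ _
  have hmem := A.sum_smul_basis_mem_iff hH hb
  have hcod : ∀ s ∈ A.hyperplanes.erase H, Module.finrank K (V ⧸ s) = 1 := fun s hs =>
    A.codim_one s (Finset.mem_of_mem_erase hs)
  obtain ⟨u, hu, hU⟩ := A.exists_polyRestrict_prod hH hb hUsub
    fun s hs => (Finset.mem_filter.1 hs).2
  have hd : ∏ s ∈ U, lin (defCoeff b s) ∣
      C (defCoeff bH X 0) * g 1 - C (defCoeff bH X 1) * g 0 := by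
    refine prod_lin_dvd_of_forall_dvd (T := A.hyperplanes.erase H)
      (fun s hs => defCoeff_tail (A.codim_one H hH) hmem (hcod s hs) (Finset.ne_of_mem_erase hs))
      (fun s hs s' hs' hne r => defCoeff_ne_smul (hcod s hs) (hcod s' hs') hne r) hUsub ?_
    intro s hs
    obtain ⟨r, hr, h⟩ := A.exists_defCoeff_eq hH hb (hUsub hs)
    rw [(Finset.mem_filter.1 hs).2] at h
    rw [← (isUnit_C_iff.2 hr).dvd_mul_left]
    have h1 := hg s (hUsub hs)
    have e0 := h 0
    have e1 := h 1
    simp only [Matrix.cons_val_zero, Matrix.cons_val_one] at h1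
    rw [show (1 : Fin 3) = (0 : Fin 2).succ from rfl, e0,
      show (2 : Fin 3) = (1 : Fin 2).succ from rfl, e1, C_mul, C_mul] at h1
    convert h1 using 1
    ring
  have := map_dvd polyRestrict hd
  rw [hU, (isUnit_C_iff.2 hu).mul_left_dvd, ← A.mult_restriction hH hX, map_sub, map_mul, map_mul,
    polyRestrict_C, polyRestrict_C] at this
  exact this

open Classical in
/-- The codimension of the restricted forms in the numerators of the logarithmic forms of the
restricted multiarrangement. -/
theorem Arrangement.finrank_quotient_restrictedForms
    (θ : Module.Basis (Fin 2) (MvPolynomial (Fin 2) K) (planeForms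
      (A.restriction H hH).hyperplanes (defCoeff bH) (A.restriction H hH).mult)) {d : Fin 2 → ℕ}
    (hθ : ∀ i, (θ i).1 ∈ homVec K (Fin 2) (Fin 2) (d i)) :
    Module.Finite K ((planeForms (A.restriction H hH).hyperplanes (defCoeff bH)
      (A.restriction H hH).mult).restrictScalars K ⧸
        (restrictedForms (defCoeff b) (A.hyperplanes.erase H)).submoduleOf
          ((planeForms (A.restriction H hH).hyperplanes (defCoeff bH)
            (A.restriction H hH).mult).restrictScalars K)) ∧
    (Module.finrank K ((planeForms (A.restriction H hH).hyperplanes (defCoeff bH)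
      (A.restriction H hH).mult).restrictScalars K ⧸
        (restrictedForms (defCoeff b) (A.hyperplanes.erase H)).submoduleOf
          ((planeForms (A.restriction H hH).hyperplanes (defCoeff bH)
            (A.restriction H hH).mult).restrictScalars K)) : ℤ)
      = A.reducedCharPoly.eval 0 - d 0 * d 1 := by
  have hmem := A.sum_smul_basis_mem_iff hH hb
  have hfin : Module.Finite K V := Module.Finite.of_basis b
  have hV : Module.finrank K V = 3 := by rw [Module.finrank_eq_card_basis b, Fintype.card_fin]
  have hcod : ∀ s ∈ A.hyperplanes.erase H, Module.finrank K (V ⧸ s) = 1 := fun s hs =>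
    A.codim_one s (Finset.mem_of_mem_erase hs)
  have hne : ∀ s ∈ A.hyperplanes.erase H, s ≠ H := fun s hs => Finset.ne_of_mem_erase hs
  rw [A.reducedCharPoly_eval_zero_eq_affineCount hV hH]
  exact HypArr.finrank_quotient_restrictedForms
    (fun s hs => defCoeff_tail (A.codim_one H hH) hmem (hcod s hs) (hne s hs))
    (A.restrictedForms_le_planeForms hH hb)
    (fun X hX => defCoeff_ne_zero bH ((A.restriction H hH).codim_one X hX))
    (fun X hX Y hY h r => defCoeff_ne_smul ((A.restriction H hH).codim_one X hX)
      ((A.restriction H hH).codim_one Y hY) h r)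
    (A.sum_mult_restriction hH)
    (fun e he => finrank_lineForms (A.codim_one H hH) hmem hcod hne he) θ hθ

end RestrictedForms

/-! ### Quotients under injective maps -/

section QuotientMap

variable {K E F : Type*} [Field K] [AddCommGroup E] [Module K E] [AddCommGroup F] [Module K F]

/-- An injective linear map carries a quotient `W / M` onto the quotient of the images. -/
noncomputable def quotientMapEquiv {f : E →ₗ[K] F} (hf : Function.Injective f)
    (W M : Submodule K E) :
    (W ⧸ M.submoduleOf W) ≃ₗ[K] (W.map f ⧸ (M.map f).submoduleOf (W.map f)) :=
  Submodule.Quotient.equiv _ _ (Submodule.equivMapOfInjective f hf W) (by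
    ext x
    constructor
    · rintro ⟨y, hy, rfl⟩
      exact ⟨y, hy, rfl⟩
    · rintro ⟨y, hy, hyx⟩
      obtain ⟨z, hz, hzx⟩ := x.2
      have : y = z := hf (hyx.trans hzx.symm)
      subst this
      exact ⟨⟨y, hz⟩, hy, Subtype.ext hyx⟩)

end QuotientMap

/-! ### Vector fields and forms in the plane -/

section Derivations

variable {K V : Type*} [Field K] [AddCommGroup V] [Module K V] (B : MultiArrangement K V)
  (b : Module.Basis (Fin 2) K V)

theorem derivation_linPoly
    (δ : Derivation K (MvPolynomial (Fin 2) K) (MvPolynomial (Fin 2) K)) (α : Module.Dual K V) :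
    δ (linPoly b α) = C (α (b 0)) * δ (X 0) + C (α (b 1)) * δ (X 1) := by
  simp [linPoly, Fin.sum_univ_two, Derivation.leibniz]

/-- In the plane, logarithmic vector fields and numerators of logarithmic forms correspond to each
other by a rotation. -/
noncomputable def logDerEquiv :
    B.logDer b ≃ₗ[MvPolynomial (Fin 2) K] planeForms B.hyperplanes (defCoeff b) B.mult where
  toFun δ := ⟨![-δ.1 (X 1), δ.1 (X 0)], fun X hX => by
    have h := δ.2 X hX
    rw [derivation_linPoly] at h
    change _ ∣ C (defCoeff b X 0) * δ.1 (MvPolynomial.X 0)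
      - C (defCoeff b X 1) * -δ.1 (MvPolynomial.X 1)
    rw [mul_neg, sub_neg_eq_add]
    exact h⟩
  invFun ξ := ⟨mkDerivation K ![ξ.1 1, -ξ.1 0], fun X hX => by
    have h := ξ.2 X hX
    rw [derivation_linPoly, mkDerivation_X, mkDerivation_X]
    change _ ∣ C (defCoeff b X 0) * ξ.1 1 + C (defCoeff b X 1) * -ξ.1 0
    rw [mul_neg, ← sub_eq_add_neg]
    exact h⟩
  map_add' δ δ' := by
    refine Subtype.ext (funext fun i => ?_)
    fin_cases i
    · exact neg_add (δ.1 (MvPolynomial.X 1)) (δ'.1 (MvPolynomial.X 1))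
    · rfl
  map_smul' c δ := by
    refine Subtype.ext (funext fun i => ?_)
    fin_cases i
    · exact (mul_neg c (δ.1 (MvPolynomial.X 1))).symm
    · rfl
  left_inv δ := by
    refine Subtype.ext (derivation_ext fun i => (mkDerivation_X K _ i).trans ?_)
    fin_cases i
    · rfl
    · exact neg_neg (δ.1 (MvPolynomial.X 1))
  right_inv ξ := by
    refine Subtype.ext (funext fun i => ?_)
    fin_cases i
    · exact (congrArg Neg.neg (mkDerivation_X K ![ξ.1 1, -ξ.1 0] 1)).trans (neg_neg (ξ.1 0))
    · exact mkDerivation_X K ![ξ.1 1, -ξ.1 0] 0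

theorem logDerEquiv_mem_homVec_iff (δ : B.logDer b) (d : ℕ) :
    (logDerEquiv B b δ).1 ∈ homVec K (Fin 2) (Fin 2) d ↔ ∀ j, (δ.1 (X j)).IsHomogeneous d := by
  rw [mem_homVec, Fin.forall_fin_two, Fin.forall_fin_two]
  have h0 : (logDerEquiv B b δ).1 0 = -δ.1 (X 1) := rfl
  have h1 : (logDerEquiv B b δ).1 1 = δ.1 (X 0) := rfl
  rw [h0, h1, and_comm]
  refine and_congr_right fun _ => ⟨fun h => ?_, fun h => h.neg⟩
  simpa using h.neg

theorem isMultiexponents_iff {d : Fin 2 → ℕ} : B.IsMultiexponents b d ↔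
    ∃ θ : Module.Basis (Fin 2) (MvPolynomial (Fin 2) K)
      (planeForms B.hyperplanes (defCoeff b) B.mult),
      ∀ i, (θ i).1 ∈ homVec K (Fin 2) (Fin 2) (d i) := by
  constructor
  · rintro ⟨θ, hθ⟩
    refine ⟨θ.map (logDerEquiv B b), fun i => ?_⟩
    rw [Module.Basis.map_apply, logDerEquiv_mem_homVec_iff]
    exact hθ i
  · rintro ⟨θ, hθ⟩
    refine ⟨θ.map (logDerEquiv B b).symm, fun i => ?_⟩
    rw [Module.Basis.map_apply, ← logDerEquiv_mem_homVec_iff, LinearEquiv.apply_symm_apply]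
    exact hθ i

end Derivations

/-! ### Numerators of logarithmic forms -/

section LogForms

variable {K V ι : Type*} [Field K] [AddCommGroup V] [Module K V]

theorem mem_logForms_iff [Fintype ι] (B : MultiArrangement K V) (b : Module.Basis ι K V) (ω : RatForm ι K) :
    ω ∈ B.logForms b ↔ (∀ i, IsPoly (algebraMap _ _ (B.Q b) * ω i)) ∧
      ∀ H ∈ B.hyperplanes, ∀ i j, IsPoly (algebraMap _ _ (B.Q b) *
        ((algebraMap (MvPolynomial ι K) (FractionRing (MvPolynomial ι K))
          (lin (defCoeff b H) ^ B.mult H))⁻¹ *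
        (algebraMap (MvPolynomial ι K) _ (C (defCoeff b H i)) * ω j
          - algebraMap (MvPolynomial ι K) _ (C (defCoeff b H j)) * ω i))) := by
  have hC : ∀ r : K, algebraMap K (FractionRing (MvPolynomial ι K)) r
      = algebraMap (MvPolynomial ι K) _ (C r) := fun r =>
    IsScalarTower.algebraMap_apply K (MvPolynomial ι K) _ r
  refine and_congr_right fun _ => forall₂_congr fun H _ => forall₂_congr fun i j => ?_
  simp only [wedge, dForm, Pi.smul_apply, smul_eq_mul, hC, mul_sub, mul_assoc]
  rfl

theorem algebraMap_frac_ne_zero {f : MvPolynomial ι K} (hf : f ≠ 0) :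
    algebraMap (MvPolynomial ι K) (FractionRing (MvPolynomial ι K)) f ≠ 0 :=
  (map_ne_zero_iff _ (IsFractionRing.injective _ _)).2 hf

theorem MultiArrangement.Q_ne_zero [Fintype ι] (B : MultiArrangement K V) (b : Module.Basis ι K V) :
    B.Q b ≠ 0 :=
  Finset.prod_ne_zero_iff.2 fun X hX =>
    pow_ne_zero _ (lin_ne_zero (defCoeff_ne_zero b (B.codim_one X hX)))

/-- Division of vectors of polynomials by a polynomial. -/
noncomputable def divForm (Q : MvPolynomial ι K) :
    (ι → MvPolynomial ι K) →ₗ[K] RatForm ι K where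
  toFun ξ i := algebraMap _ _ (ξ i) / algebraMap _ _ Q
  map_add' ξ η := by
    funext i
    simp [add_div]
  map_smul' c ξ := by
    funext i
    simp only [Pi.smul_apply, RingHom.id_apply, algebraMap_smul_frac, smul_div_assoc]

theorem divForm_apply (Q : MvPolynomial ι K) (ξ : ι → MvPolynomial ι K) (i : ι) :
    divForm Q ξ i = algebraMap _ _ (ξ i) / algebraMap _ _ Q := rfl

theorem divForm_injective {Q : MvPolynomial ι K} (hQ : Q ≠ 0) :
    Function.Injective (divForm Q) := by
  intro ξ η h
  funext i
  have := congrFun h i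
  rw [divForm_apply, divForm_apply, div_left_inj' (algebraMap_frac_ne_zero hQ)] at this
  exact IsFractionRing.injective _ _ this

/-- In two variables dα ∧ ω has a single coefficient up to sign. Writing ω = ξ / Q, the factor `Q`
cancels and the logarithmic condition says that the power of α divides the contraction of ξ. -/
theorem map_divForm_planeForms (B : MultiArrangement K V) (b : Module.Basis (Fin 2) K V) :
    ((planeForms B.hyperplanes (defCoeff b) B.mult).restrictScalars K).map (divForm (B.Q b))
      = (B.logForms b).restrictScalars K := by
  have hQ := algebraMap_frac_ne_zero (B.Q_ne_zero b)
  ext ω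
  rw [Submodule.restrictScalars_mem, mem_logForms_iff]
  constructor
  · rintro ⟨ξ, hξ, rfl⟩
    refine ⟨fun i => ⟨ξ i, by rw [divForm_apply, mul_div_cancel₀ _ hQ]⟩, fun X hX i j => ?_⟩
    have hα := algebraMap_frac_ne_zero (pow_ne_zero (B.mult X)
      (lin_ne_zero (defCoeff_ne_zero b (B.codim_one X hX))))
    obtain ⟨q, hq⟩ := hξ X hX
    have hq' := congrArg (algebraMap (MvPolynomial (Fin 2) K)
      (FractionRing (MvPolynomial (Fin 2) K))) hq
    rw [map_sub, map_mul, map_mul, map_mul] at hq'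
    simp only [divForm_apply]
    fin_cases i <;> fin_cases j
    · exact ⟨0, by simp⟩
    · refine ⟨q, ?_⟩
      simp only [Fin.zero_eta, Fin.mk_one]
      field_simp
      linear_combination -hq'
    · refine ⟨-q, ?_⟩
      simp only [Fin.zero_eta, Fin.mk_one, map_neg]
      field_simp
      linear_combination hq'
    · exact ⟨0, by simp⟩
  · rintro ⟨h1, h2⟩
    choose ξ hξ using h1
    have hω : ∀ i, ω i = algebraMap _ _ (ξ i) / algebraMap _ _ (B.Q b) := fun i => by
      rw [hξ i, mul_div_cancel_left₀ _ hQ]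
    refine ⟨ξ, fun X hX => ?_, funext fun i => (hω i).symm⟩
    have hα := algebraMap_frac_ne_zero (pow_ne_zero (B.mult X)
      (lin_ne_zero (defCoeff_ne_zero b (B.codim_one X hX))))
    obtain ⟨q, hq⟩ := h2 X hX 0 1
    rw [hω, hω] at hq
    field_simp at hq
    refine ⟨q, IsFractionRing.injective (MvPolynomial (Fin 2) K)
      (FractionRing (MvPolynomial (Fin 2) K)) ?_⟩
    rw [map_sub, map_mul, map_mul, map_mul]
    linear_combination -hq

end LogForms

/-! ### The image of the restriction map -/

section RestrictionImage

variable {K V : Type*} [Field K] [AddCommGroup V] [Module K V] (A : Arrangement K V)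
  {H : Submodule K V} (hH : H ∈ A.hyperplanes)
  {b : Module.Basis (Fin 3) K V} {bH : Module.Basis (Fin 2) K H}
  (hb : ∀ i, (bH i : V) = b i.succ)

open Classical in
theorem Arrangement.toMulti_Q_eq {ι : Type*} [Fintype ι] (b : Module.Basis ι K V) {H : Submodule K V}
    (hH : H ∈ A.hyperplanes) : A.toMulti.Q b
      = lin (defCoeff b H) * ∏ s ∈ A.hyperplanes.erase H, lin (defCoeff b s) := by
  rw [Finset.mul_prod_erase _ (fun s => lin (defCoeff b s)) hH]
  simp [MultiArrangement.Q, Arrangement.toMulti, linPoly_eq_lin]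
  rfl

include hH hb

theorem Arrangement.defCoeff_adapted :
    defCoeff b H 0 ≠ 0 ∧ defCoeff b H 1 = 0 ∧ defCoeff b H 2 = 0 := by
  have hc := A.codim_one H hH
  have h1 : defCoeff b H 1 = 0 := by
    rw [defCoeff, ← LinearMap.mem_ker, ker_defForm hc]
    exact hb 0 ▸ (bH 0).2
  have h2 : defCoeff b H 2 = 0 := by
    rw [defCoeff, ← LinearMap.mem_ker, ker_defForm hc]
    exact hb 1 ▸ (bH 1).2
  refine ⟨fun h0 => defCoeff_ne_zero b hc (funext fun i => ?_), h1, h2⟩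
  fin_cases i
  · exact h0
  · exact h1
  · exact h2

open Classical in
-- The form of `H` is a multiple of z_0, so the condition at `H` removes z_0 from the denominators
-- of the dz_1, dz_2 coefficients. For another plane `s`, the coefficient of dz_1 ∧ dz_2 gives the
-- divisibility up to the factor `lin (defCoeff b H)`, which is not divisible by the prime form of
-- `s`.
theorem Arrangement.exists_lineForms_of_mem_logForms {ω : RatForm (Fin 3) K}
    (hω : ω ∈ A.toMulti.logForms b) :
    ∃ g ∈ lineForms (defCoeff b) (A.hyperplanes.erase H), ∀ j : Fin 2, ω j.succ
      = algebraMap _ _ (g j) /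
        algebraMap _ _ (∏ s ∈ A.hyperplanes.erase H, lin (defCoeff b s)) := by
  rw [mem_logForms_iff, A.toMulti_Q_eq b hH] at hω
  obtain ⟨-, hω⟩ := hω
  obtain ⟨h0, h1, h2⟩ := A.defCoeff_adapted hH hb
  have hne : ∀ s ∈ A.hyperplanes, lin (defCoeff b s) ≠ 0 := fun s hs =>
    lin_ne_zero (defCoeff_ne_zero b (A.codim_one s hs))
  set Q := ∏ s ∈ A.hyperplanes.erase H, lin (defCoeff b s) with hQdef
  have hQ0 : Q ≠ 0 := Finset.prod_ne_zero_iff.2 fun s hs => hne s (Finset.mem_of_mem_erase hs)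
  have hQ := algebraMap_frac_ne_zero hQ0
  have hα := algebraMap_frac_ne_zero (hne H hH)
  have hC0 : algebraMap (MvPolynomial (Fin 3) K) (FractionRing (MvPolynomial (Fin 3) K))
      (C (defCoeff b H 0)) ≠ 0 := algebraMap_frac_ne_zero ((map_ne_zero_iff _ (C_injective _ _)).2 h0)
  have hg : ∀ j : Fin 2, ∃ g : MvPolynomial (Fin 3) K,
      ω j.succ = algebraMap _ _ g / algebraMap _ _ Q := by
    intro j
    obtain ⟨p, hp⟩ := hω H hH 0 j.succ
    have hj : defCoeff b H j.succ = 0 := by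
      fin_cases j
      · exact h1
      · exact h2
    refine ⟨C (defCoeff b H 0)⁻¹ * p, ?_⟩
    have hinv : algebraMap (MvPolynomial (Fin 3) K) (FractionRing (MvPolynomial (Fin 3) K))
        (C (defCoeff b H 0)⁻¹) * algebraMap (MvPolynomial (Fin 3) K) _ (C (defCoeff b H 0)) = 1 := by
      rw [← map_mul, ← C_mul, inv_mul_cancel₀ h0, C_1, map_one]
    rw [map_mul, hp, hj, C_0, map_zero, zero_mul, sub_zero, map_mul]
    change _ = _ * (_ * ((algebraMap _ _ (lin (defCoeff b H) ^ 1))⁻¹ * _)) / _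
    rw [pow_one]
    generalize algebraMap (MvPolynomial (Fin 3) K) (FractionRing (MvPolynomial (Fin 3) K))
      (C (defCoeff b H 0)⁻¹) = x at hinv ⊢
    field_simp
    linear_combination -ω j.succ * hinv
  choose g hg using hg
  refine ⟨g, fun s hs => ?_, hg⟩
  have hsA := Finset.mem_of_mem_erase hs
  obtain ⟨q, hq⟩ := hω s hsA 1 2
  have g1 : ω 1 = _ := hg 0
  have g2 : ω 2 = _ := hg 1
  have hαs := algebraMap_frac_ne_zero (hne s hsA)
  have hpow : lin (defCoeff b s) ^ A.toMulti.mult s = lin (defCoeff b s) := pow_one _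
  rw [g1, g2, hpow, map_mul] at hq
  field_simp at hq
  have hq' : lin (defCoeff b s) ∣ lin (defCoeff b H) *
      (C (defCoeff b s 1) * g 1 - C (defCoeff b s 2) * g 0) := by
    refine ⟨q, IsFractionRing.injective (MvPolynomial (Fin 3) K)
      (FractionRing (MvPolynomial (Fin 3) K)) ?_⟩
    rw [map_mul, map_sub, map_mul, map_mul, map_mul]
    linear_combination -hq
  refine ((prime_lin (defCoeff_ne_zero b (A.codim_one s hsA))).dvd_mul.1 hq').resolve_left ?_
  intro hdvd
  obtain ⟨r, hr⟩ := lin_dvd_lin (defCoeff_ne_zero b (A.codim_one s hsA)) hdvd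
  exact defCoeff_ne_smul (A.codim_one s hsA) (A.codim_one H hH) (Finset.ne_of_mem_erase hs) r hr

open Classical in
-- The dz_0 coefficient is determined by requiring z_0 ω_0 + z_1 ω_1 + z_2 ω_2 = 0. The conditions
-- involving dz_0 then follow from the one on dz_1 ∧ dz_2.
theorem Arrangement.exists_mem_logForms_of_lineForms {g : Fin 2 → MvPolynomial (Fin 3) K}
    (hg : g ∈ lineForms (defCoeff b) (A.hyperplanes.erase H)) :
    ∃ ω ∈ A.toMulti.logForms b, ∀ j : Fin 2, ω j.succ
      = algebraMap _ _ (g j) /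
        algebraMap _ _ (∏ s ∈ A.hyperplanes.erase H, lin (defCoeff b s)) := by
  obtain ⟨h0, h1, h2⟩ := A.defCoeff_adapted hH hb
  have hne : ∀ s ∈ A.hyperplanes, lin (defCoeff b s) ≠ 0 := fun s hs =>
    lin_ne_zero (defCoeff_ne_zero b (A.codim_one s hs))
  have hlinH : lin (defCoeff b H) = C (defCoeff b H 0) * X 0 := by
    rw [lin_three, h1, h2]
    simp
  set Q := ∏ s ∈ A.hyperplanes.erase H, lin (defCoeff b s) with hQdef
  have hQ0 : Q ≠ 0 := Finset.prod_ne_zero_iff.2 fun s hs => hne s (Finset.mem_of_mem_erase hs)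
  let f := algebraMap (MvPolynomial (Fin 3) K) (FractionRing (MvPolynomial (Fin 3) K))
  have hQ : f Q ≠ 0 := algebraMap_frac_ne_zero hQ0
  have hX : f (X 0) ≠ 0 := algebraMap_frac_ne_zero (X_ne_zero 0)
  have hC0 : f (C (defCoeff b H 0)) ≠ 0 :=
    algebraMap_frac_ne_zero ((map_ne_zero_iff _ (C_injective _ _)).2 h0)
  refine ⟨![-(f (X 1 * g 0 + X 2 * g 1)) / (f (X 0) * f Q), f (g 0) / f Q, f (g 1) / f Q],
    ?_, fun j => ?_⟩
  swap
  · fin_cases j <;> rfl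
  rw [mem_logForms_iff, A.toMulti_Q_eq b hH, hlinH]
  have hmult : ∀ s, A.toMulti.mult s = 1 := fun s => rfl
  change (∀ i, IsPoly (f _ * _)) ∧ ∀ s ∈ A.hyperplanes, ∀ i j,
    IsPoly (f _ * ((f _)⁻¹ * (f _ * _ - f _ * _)))
  -- By antisymmetry only the three wedge coefficients with `i < j` need checking.
  have anti : ∀ (P L : FractionRing (MvPolynomial (Fin 3) K))
      (ω : Fin 3 → FractionRing (MvPolynomial (Fin 3) K)) (c : Fin 3 → MvPolynomial (Fin 3) K),
      IsPoly (P * (L⁻¹ * (f (c 0) * ω 1 - f (c 1) * ω 0))) →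
      IsPoly (P * (L⁻¹ * (f (c 0) * ω 2 - f (c 2) * ω 0))) →
      IsPoly (P * (L⁻¹ * (f (c 1) * ω 2 - f (c 2) * ω 1))) →
      ∀ i j, IsPoly (P * (L⁻¹ * (f (c i) * ω j - f (c j) * ω i))) := by
    intro P L ω c h01 h02 h12 i j
    have hneg : ∀ i j, IsPoly (P * (L⁻¹ * (f (c i) * ω j - f (c j) * ω i))) →
        IsPoly (P * (L⁻¹ * (f (c j) * ω i - f (c i) * ω j))) := by
      rintro i j ⟨q, hq⟩
      exact ⟨-q, by rw [map_neg, hq]; ring⟩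
    have hdiag : ∀ i, IsPoly (P * (L⁻¹ * (f (c i) * ω i - f (c i) * ω i))) := fun i =>
      ⟨0, by simp⟩
    fin_cases i <;> fin_cases j
    · exact hdiag 0
    · exact h01
    · exact h02
    · exact hneg 0 1 h01
    · exact hdiag 1
    · exact h12
    · exact hneg 0 2 h02
    · exact hneg 1 2 h12
    · exact hdiag 2
  constructor
  · intro i
    fin_cases i
    · refine ⟨-(C (defCoeff b H 0) * (X 1 * g 0 + X 2 * g 1)), ?_⟩
      change f _ = f _ * (-(f _) / (f _ * f _))
      rw [map_neg, map_mul f _ Q, map_mul f _ (X 0), map_mul f _ (X 1 * g 0 + X 2 * g 1)]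
      field_simp
    · refine ⟨C (defCoeff b H 0) * X 0 * g 0, ?_⟩
      change f _ = f _ * (f _ / f _)
      rw [map_mul, map_mul f _ Q]
      field_simp
    · refine ⟨C (defCoeff b H 0) * X 0 * g 1, ?_⟩
      change f _ = f _ * (f _ / f _)
      rw [map_mul, map_mul f _ Q]
      field_simp
  · intro s hs
    by_cases hsH : s = H
    · subst hsH
      rw [hmult, pow_one, hlinH]
      refine anti _ _ _ (fun i => C (defCoeff b s i)) ?_ ?_ ?_
      · refine ⟨C (defCoeff b s 0) * g 0, ?_⟩
        change f _ = f _ * ((f _)⁻¹ * (f _ * (f _ / f _) - _))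
        rw [h1, C_0, map_zero, zero_mul, sub_zero, map_mul f _ Q, map_mul f _ (X 0),
          map_mul f _ (g 0)]
        field_simp
      · refine ⟨C (defCoeff b s 0) * g 1, ?_⟩
        change f _ = f _ * ((f _)⁻¹ * (f _ * (f _ / f _) - _))
        rw [h2, C_0, map_zero, zero_mul, sub_zero, map_mul f _ Q, map_mul f _ (X 0),
          map_mul f _ (g 1)]
        field_simp
      · refine ⟨0, ?_⟩
        rw [h1, h2, C_0, map_zero, zero_mul, zero_mul, sub_zero, mul_zero, mul_zero]
    · obtain ⟨q, hq⟩ := hg s (Finset.mem_erase.2 ⟨hsH, hs⟩)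
      have hls : f (lin (defCoeff b s)) ≠ 0 := algebraMap_frac_ne_zero (hne s hs)
      have hq' := congrArg f hq
      simp only [Matrix.cons_val_zero, Matrix.cons_val_one, map_sub, map_mul] at hq'
      have hl' := congrArg f (lin_three (defCoeff b s))
      simp only [map_add, map_mul] at hl'
      rw [hmult, pow_one]
      refine anti _ _ _ (fun i => C (defCoeff b s i)) ?_ ?_ ?_
      -- Write α for the form of `s`. Eliminating a_0 z_0 by α = a_0 z_0 + a_1 z_1 + a_2 z_2 and
      -- using a_1 g_1 - a_2 g_0 = α q gives a_0 ω_1 - a_1 ω_0 = α (g_0 + z_2 q) / (z_0 Q). The next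
      -- witness arises in the same way.
      · refine ⟨C (defCoeff b H 0) * (g 0 + X 2 * q), ?_⟩
        change f _ = f _ * ((f _)⁻¹ * (f _ * (f _ / f _) - f _ * (-(f _) / (f _ * f _))))
        simp only [map_add, map_mul]
        field_simp
        linear_combination f Q * f (g 0) * hl' - f Q * f (X 2) * hq'
      · refine ⟨C (defCoeff b H 0) * (g 1 - X 1 * q), ?_⟩
        change f _ = f _ * ((f _)⁻¹ * (f _ * (f _ / f _) - f _ * (-(f _) / (f _ * f _))))
        simp only [map_add, map_mul, map_sub]
        field_simp
        linear_combination f Q * f (g 1) * hl' + f Q * f (X 1) * hq'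
      · refine ⟨C (defCoeff b H 0) * X 0 * q, ?_⟩
        change f _ = f _ * ((f _)⁻¹ * (f _ * (f _ / f _) - f _ * (f _ / f _)))
        simp only [map_mul]
        field_simp
        linear_combination -f Q * hq'

open Classical in
/-- The image of the restriction map is the space of restricted forms, divided by `Q`. -/
theorem Arrangement.map_divForm_restrictedForms :
    (restrictedForms (defCoeff b) (A.hyperplanes.erase H)).map
      (divForm ((A.restriction H hH).Q bH)) = A.resImage H hH b bH hb := by
  obtain ⟨u, hu, hQ⟩ := A.exists_polyRestrict_prod_erase hH hb
  have hQ0 := (A.restriction H hH).Q_ne_zero bH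
  have hne : polyRestrict (∏ s ∈ A.hyperplanes.erase H, lin (defCoeff b s)) ≠ 0 := by
    rw [hQ]
    exact mul_ne_zero ((map_ne_zero_iff _ (C_injective _ _)).2 hu) hQ0
  have hfQ := algebraMap_frac_ne_zero hQ0
  have hfu : algebraMap (MvPolynomial (Fin 2) K) (FractionRing (MvPolynomial (Fin 2) K))
      (C u) ≠ 0 := algebraMap_frac_ne_zero ((map_ne_zero_iff _ (C_injective _ _)).2 hu)
  -- The product of the restricted forms is `u` times the defining polynomial of the restricted
  -- multiarrangement; the nonzero scalar does not affect the image as a subspace.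
  have key : ∀ (ω : A.toMulti.logForms b) (g : Fin 2 → MvPolynomial (Fin 3) K),
      (∀ j : Fin 2, ω.1 j.succ = algebraMap _ _ (g j) /
        algebraMap _ _ (∏ s ∈ A.hyperplanes.erase H, lin (defCoeff b s))) →
      u • A.res H hH b bH hb ω = divForm ((A.restriction H hH).Q bH) (vecRestrict K 2 g) := by
    intro ω g h
    funext j
    have h2 := (A.isRestriction_res H hH b bH hb ω j).unique ⟨g j, _, hne, h j, rfl⟩
    have hsm : ∀ x : FractionRing (MvPolynomial (Fin 2) K),
        u • x = algebraMap (MvPolynomial (Fin 2) K) (FractionRing (MvPolynomial (Fin 2) K)) (C u) * x := by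
      intro x
      rw [Algebra.smul_def, IsScalarTower.algebraMap_apply K (MvPolynomial (Fin 2) K)]
      rfl
    rw [Pi.smul_apply, h2, hsm, hQ, map_mul, divForm_apply, vecRestrict_apply]
    field_simp
  apply le_antisymm
  · rintro _ ⟨_, ⟨g, hg, rfl⟩, rfl⟩
    obtain ⟨ω, hω, h⟩ := A.exists_mem_logForms_of_lineForms hH hb hg
    rw [← key ⟨ω, hω⟩ g h, ← map_smul]
    exact ⟨_, rfl⟩
  · rintro _ ⟨ω, rfl⟩
    obtain ⟨g, hg, h⟩ := A.exists_lineForms_of_mem_logForms hH hb ω.2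
    refine (Submodule.smul_mem_iff _ hu).1 ?_
    rw [key ω g h]
    exact ⟨_, ⟨g, hg, rfl⟩, rfl⟩

end RestrictionImage

end HypArr

/-! ### The codimension formula -/

theorem mainTheorem3 {K : Type*} [Field K] [CharZero K]
    (A : HypArr.Arrangement K (Fin 3 → K)) (H : Submodule K (Fin 3 → K))
    (hH : H ∈ A.hyperplanes)
    (b : Module.Basis (Fin 3) K (Fin 3 → K)) (bH : Module.Basis (Fin 2) K H)
    (hb : ∀ i, (bH i : Fin 3 → K) = b i.succ) :
    (∃ d : Fin 2 → ℕ, (A.restriction H hH).IsMultiexponents bH d) ∧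
    A.resImage H hH b bH hb ≤ ((A.restriction H hH).logForms bH).restrictScalars K ∧
    ∀ d : Fin 2 → ℕ, (A.restriction H hH).IsMultiexponents bH d →
      Module.Finite K (((A.restriction H hH).logForms bH).restrictScalars K ⧸
        (A.resImage H hH b bH hb).submoduleOf
          (((A.restriction H hH).logForms bH).restrictScalars K)) ∧
      (Module.finrank K (((A.restriction H hH).logForms bH).restrictScalars K ⧸
        (A.resImage H hH b bH hb).submoduleOf
          (((A.restriction H hH).logForms bH).restrictScalars K)) : ℤ) =
        A.reducedCharPoly.eval 0 - (d 0 : ℤ) * (d 1 : ℤ) := by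
  have hinj := HypArr.divForm_injective ((A.restriction H hH).Q_ne_zero bH)
  refine ⟨?_, ?_, fun d hd => ?_⟩
  · obtain ⟨d, θ, hθ⟩ := HypArr.exists_basis_planeForms (k := (A.restriction H hH).mult)
      fun X hX => HypArr.defCoeff_ne_zero bH ((A.restriction H hH).codim_one X hX)
    exact ⟨d, (HypArr.isMultiexponents_iff _ bH).2 ⟨θ, hθ⟩⟩
  · rw [← A.map_divForm_restrictedForms hH hb, ← HypArr.map_divForm_planeForms]
    exact Submodule.map_mono (A.restrictedForms_le_planeForms hH hb)
  · obtain ⟨θ, hθ⟩ := (HypArr.isMultiexponents_iff _ bH).1 hd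
    obtain ⟨hfin, hrank⟩ := A.finrank_quotient_restrictedForms hH hb θ hθ
    -- Both spaces are images of spaces of numerators under the injective division by `Q`, so the
    -- quotient is that of the numerators.
    rw [← A.map_divForm_restrictedForms hH hb, ← HypArr.map_divForm_planeForms,
      ← (HypArr.quotientMapEquiv hinj _ _).finrank_eq]
    exact ⟨Module.Finite.equiv (HypArr.quotientMapEquiv hinj _ _), hrank⟩
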